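/- **Setting.** Let $n\ge 0$, $r_\infty\ge 1$, $r_1,\dots,r_n\ge 1$ be integers, and let $t_{\infty,0},t_{X_1,0},\dots,t_{X_n,0}\in\mathbb C$ be fixed. A parameter point $\mathbf t$ consists of irregular times $t_{\infty,k}$ ($1\le k\le r_\infty-1$), $t_{X_s,k}$ ($1\le k\le r_s-1$) and of pole positions $X_s\in\mathbb C$. Let $S$ be the part of an open set $U$ of parameter points on which the "trivial times" have the following values: $t_{\infty,r_\infty-1}=1$, $t_{\infty,r_\infty-2}=0$ if $r_\infty\ge3$; $t_{\infty,1}=1$, $X_1=0$ if $r_\infty=2$; $X_1=0$, $X_2=1$ if $r_\infty=1$, $n\ge2$; $X_1=0$, $t_{X_1,r_1-1}=1$ if $r_\infty=n=1$. Assume that $X_1,\dots,X_n$ are pairwise distinct on $S$. Let $$\mathcal L_\alpha=\sum_{k=1}^{r_\infty-1}\alpha_{\infty,k}\partial_{t_{\infty,k}}+\sum_{s}\sum_{k=1}^{r_s-1}\alpha_{X_s,k}\partial_{t_{X_s,k}}+\sum_s\alpha_{X_s}\partial_{X_s},$$ where $\alpha$ may depend on $\mathbf t$ and has zero components along the trivial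 times, and let $\omega$ be a nowhere zero holomorphic function on $S$. For $\mathbf t\in S$ let $\tilde L(\lambda)$ be a rational $\mathfrak{sl}_2(\mathbb C)$-valued matrix $$\tilde L(\lambda)=\sum_{k=1}^{r_\infty-1}\tilde L^{[\infty,k]}\lambda^{k-1}+\sum_{s=1}^n\sum_{k=0}^{r_s-1}\frac{\tilde L^{[X_s,k]}}{(\lambda-X_s)^{k+1}}$$ whose leading coefficients at the poles have distinct eigenvalues (so $t_{\infty,r_\infty-1}\neq0$), normalized at infinity: if $r_\infty\ge3$, $\tilde L^{[\infty,r_\infty-1]}=\mathrm{diag}(-t_{\infty,r_\infty-1},t_{\infty,r_\infty-1})$ and $\tilde L^{[\infty,r_\infty-2]}_{1,2}=\omega$; if $r_\infty=2$, $\tilde L^{[\infty,1]}=\mathrm{diag}(-t_{\infty,1},t_{\infty,1})$ and $\sum_s\tilde L^{[X_s,0]}_{1,2}=\omega$; if $r_\infty=1$, $\sum_s\tilde L^{[X_s,0]}=\mathrm{diag}(-t_{\infty,0},t_{\infty,0})$ and $\sum_s(\tilde L^{[X_s,1]}+X_s\tilde L^{[X_s,0]})_{1,2}=\omega$ (with $\tilde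 L^{[X_s,1]}=0$ if $r_s=1$). Let $\tilde A_\alpha(\lambda)$ be a matrix of rational functions of $\lambda$ with poles only at $\infty,X_1,\dots,X_n$, such that at each pole $p$, with local coordinate $z=\lambda-X_s$, resp. $z=1/\lambda$, the system $\partial_\lambda\Psi=\tilde L\Psi$, $\mathcal L_\alpha\Psi=\tilde A_\alpha\Psi$ has on $S$ a formal solution $$\Psi_p=F_p(z)\,\mathrm{diag}(e^{T_p},e^{-T_p}),\qquad T_p=-\sum_{k=1}^{r_p-1}\frac{t_{p,k}}{k\,z^k}+t_{p,0}\log z ,$$ where $F_p$ is a matrix of formal power series in $z$ with coefficients holomorphic on $S$ and $\det F_p=1$ ($\mathcal L_\alpha$ acts with $\lambda$ fixed). **The coefficients $\nu$.** With $G=\begin{pmatrix}1&0\\ \tilde L_{1,1}&\tilde L_{1,2}\end{pmatrix}$ let $A_\alpha=G\tilde A_\alpha G^{-1}+\mathcal L_\alpha[G]G^{-1}$, and define $\nu_{\infty,k}$, $\nu_{X_s,k}$ by the expansions $[A_\alpha]_{1,2}=\sum_k\nu_{\infty,k}\lambda^{-k}$ at $\infty$ and $[A_\alpha]_{1,2}=\sum_{k\ge0}\nu_{X_s,k}(\lambda-X_s)^k$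 at $X_s$. **Geometric Darboux coordinates.** Let $g=r_\infty+\sum_sr_s-3\ge0$, and suppose that, at the point $\mathbf t\in S$ considered, $\tilde L_{1,2}=\omega\prod_{j=1}^g(\lambda-q_j)/\prod_s(\lambda-X_s)^{r_s}$ with $q_1,\dots,q_g$ pairwise distinct and different from all $X_s$. Let $p_i=\tilde L_{1,1}(q_i)$. The coordinates $Q$ are the functions of $q$ given by $$\omega\frac{\prod_{j}(\lambda-q_j)}{\prod_s(\lambda-X_s)^{r_s}}=\sum_{s=1}^n\sum_{k=1}^{r_s}\frac{Q_{X_s,k}}{(\lambda-X_s)^k}+\sum_{k=0}^{r_\infty-4}Q_{\infty,k}\lambda^k+\omega\,\delta_{r_\infty\ge3}\lambda^{r_\infty-3}$$ (and $Q_{X_s,k}=0$ for $k>r_s$), and $P$ satisfies $$p_i=\sum_{k=0}^{r_\infty-4}P_{\infty,k}\frac{\partial Q_{\infty,k}}{\partial q_i}+\sum_s\sum_{k=1}^{r_s}P_{X_s,k}\frac{\partial Q_{X_s,k}}{\partial q_i}\quad(1\le i\le g),$$ together with $\sum_s\sum_{m=1}^{r_s}P_{X_s,m}Q_{X_s,m}=0$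 if $r_\infty\le2$ and $\sum_s\sum_{m=1}^{r_s-1}P_{X_s,m}Q_{X_s,m+1}+\sum_s\sum_{m=1}^{r_s}X_sP_{X_s,m}Q_{X_s,m}=0$ if $r_\infty=1$. Put $$g_0=\begin{cases}t_{\infty,r_\infty-2}+t_{\infty,r_\infty-1}\big(\sum_jq_j-\sum_sr_sX_s\big)&r_\infty\ge2,\\ t_{\infty,0}\big(\sum_jq_j-\sum_sr_sX_s\big)-\sum_s\big(X_s\tilde L^{[X_s,0]}+\tilde L^{[X_s,1]}\big)_{1,1}&r_\infty=1.\end{cases}$$ $[f]_{a,-}$ is the singular part of $f$ at $a\in\mathbb C$ (strictly negative powers of $\lambda-a$), $[f]_{\infty,+}$ the polynomial part at infinity (constant term included), $\mathrm{Res}_{\lambda\to\infty}f$ is minus the coefficient of $\lambda^{-1}$. Empty sums are $0$; $\delta_{r_\infty,i}=1$ if $r_\infty=i$, else $0$; $\delta_{r_\infty\ge i}=1$ if $r_\infty\ge i$, else $0$. **Theorem.** The following hold. *Coefficients $\nu$.* $\nu_{X_s,0}=-\alpha_{X_s}$; for every $s$ and $1\le i\le r_s-1$: $\sum_{j=1}^it_{X_s,r_s-1-(i-j)}\nu_{X_s,j}=-\frac{\alpha_{X_s,r_s-i}}{r_s-i}$;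 for $1\le i\le r_\infty-3$: $\sum_{j=1}^it_{\infty,r_\infty-1-(i-j)}\nu_{\infty,j}=\frac{\alpha_{\infty,r_\infty-2-i}}{r_\infty-2-i}$. If $r_\infty\ge3$, $$\omega\nu_{\infty,r_\infty-2}=\sum_s\sum_{k=1}^{r_s}\nu_{X_s,k-1}Q_{X_s,k}-\sum_{j=1}^{r_\infty-3}\nu_{\infty,j}Q_{\infty,j-1},$$ $$\omega\nu_{\infty,r_\infty-1}=\sum_s\Big(\sum_{k=2}^{r_s}\nu_{X_s,k-2}Q_{X_s,k}+X_s\sum_{k=1}^{r_s}\nu_{X_s,k-1}Q_{X_s,k}\Big)-\sum_{j=2}^{r_\infty-2}\nu_{\infty,j}Q_{\infty,j-2}-\nu_{\infty,1}\sum_sQ_{X_s,1}.$$ If $r_\infty=2$: $\sum_s\sum_{k=1}^{r_s}\nu_{X_s,k-1}Q_{X_s,k}=\omega\nu_{\infty,0}$. If $r_\infty=1$, with $\Sigma:=\sum_s(X_s^2Q_{X_s,1}+2X_sQ_{X_s,2}+Q_{X_s,3})$: $\omega\nu_{\infty,-1}=\sum_s\sum_{k=1}^{r_s}\nu_{X_s,k-1}Q_{X_s,k}$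 and $$\Sigma\,\nu_{\infty,-1}+\omega\nu_{\infty,0}=\sum_s\Big(\sum_{k=2}^{r_s}\nu_{X_s,k-2}Q_{X_s,k}+X_s\sum_{k=1}^{r_s}\nu_{X_s,k-1}Q_{X_s,k}\Big).$$ *First rows and traces.* $$\tilde L_{1,2}=\sum_s\sum_{k=1}^{r_s}\frac{Q_{X_s,k}}{(\lambda-X_s)^k}+\sum_{k=0}^{r_\infty-4}Q_{\infty,k}\lambda^k+\omega\delta_{r_\infty\ge3}\lambda^{r_\infty-3},$$ $$\tilde L_{1,1}=-\omega\sum_{k=0}^{r_\infty-4}P_{\infty,r_\infty-4-k}\lambda^k-\sum_{k=0}^{r_\infty-5}\sum_{m=0}^{r_\infty-5-k}P_{\infty,m}Q_{\infty,k+1+m}\lambda^k+\sum_s\sum_{k=1}^{r_s}\sum_{m=1}^{r_s+1-k}\frac{P_{X_s,m}Q_{X_s,k+m-1}}{(\lambda-X_s)^k}-\frac{t_{\infty,r_\infty-1}\lambda+g_0}{\omega}\tilde L_{1,2},$$ $$[\tilde A_\alpha]_{1,2}=\omega\nu_{\infty,1}\delta_{r_\infty\ge4}\lambda^{r_\infty-4}+\sum_{j=0}^{r_\infty-5}\Big(\omega\nu_{\infty,r_\infty-3-j}+\sum_{k=j+1}^{r_\infty-4}\nu_{\infty,k-j}Q_{\infty,k}\Big)\lambda^j+\sum_s\sum_{j=1}^{r_s}\frac{\sum_{k=j}^{r_s}\nu_{X_s,k-j}Q_{X_s,k}}{(\lambda-X_s)^{j}},$$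 and, with $\kappa:=\omega P_{\infty,0}+\frac{t_{\infty,r_\infty-1}Q_{\infty,r_\infty-5}+Q_{\infty,r_\infty-4}g_0}{\omega}$ (used for $r_\infty\ge5$), $$\begin{aligned}[\tilde A_\alpha]_{1,1}=&\ \tfrac1{2\omega}\mathcal L_\alpha[\omega]-t_{\infty,1}\nu_{\infty,0}\delta_{r_\infty,2}+\big(\tfrac12-t_{\infty,0}\big)\nu_{\infty,-1}\delta_{r_\infty,1}-t_{\infty,r_\infty-1}\nu_{\infty,1}\lambda^{r_\infty-3}\delta_{r_\infty\ge3}-t_{\infty,r_\infty-1}\nu_{\infty,2}\lambda^{r_\infty-4}\delta_{r_\infty\ge4}\\&-\big(t_{\infty,r_\infty-1}\nu_{\infty,3}+\kappa\,\nu_{\infty,1}\big)\lambda^{r_\infty-5}\delta_{r_\infty\ge5}-\sum_{j=0}^{r_\infty-6}\Big[t_{\infty,r_\infty-1}\nu_{\infty,r_\infty-2-j}+\kappa\,\nu_{\infty,r_\infty-4-j}\\&+\sum_{i=1}^{r_\infty-5-j}\nu_{\infty,i}\Big(\omega P_{\infty,r_\infty-4-i-j}+\sum_{m=0}^{r_\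infty-5-i-j}P_{\infty,m}Q_{\infty,j+i+1+m}+\tfrac{t_{\infty,r_\infty-1}Q_{\infty,j+i-1}+g_0Q_{\infty,j+i}}{\omega}\Big)\Big]\lambda^j\\&+\sum_s\Big(P_{X_s,1}-\tfrac{t_{\infty,r_\infty-1}X_s+g_0}{\omega}\Big)\frac{Q_{X_s,r_s}\nu_{X_s,0}}{(\lambda-X_s)^{r_s}}+\sum_s\sum_{k=1}^{r_s-1}\Big[\sum_{i=0}^{r_s-k}\sum_{m=1}^{r_s+1-k-i}\nu_{X_s,i}P_{X_s,m}Q_{X_s,k+i+m-1}\\&-\tfrac{t_{\infty,r_\infty-1}X_s+g_0}{\omega}\sum_{i=0}^{r_s-k}\nu_{X_s,i}Q_{X_s,k+i}-\tfrac{t_{\infty,r_\infty-1}}{\omega}\sum_{i=0}^{r_s-1-k}\nu_{X_s,i}Q_{X_s,k+i+1}\Big](\lambda-X_s)^{-k},\end{aligned}$$ and $\tilde L_{2,2}=-\tilde L_{1,1}$, $[\tilde A_\alpha]_{2,2}=-[\tilde A_\alpha]_{1,1}$. *Entry $\tilde L_{2,1}$.* Let $N_\infty=\sum_{j=r_\infty-3}^{2r_\infty-4}\big(\sum_{m=0}^{2r_\infty-4-j}t_{\infty,r_\infty-1-m}t_{\infty,j+m-r_\infty+3}\big)\lambda^j$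 (for $r_\infty\ge3$) and $N_s=\sum_{j=r_s+1}^{2r_s}\big(\sum_{m=0}^{2r_s-j}t_{X_s,r_s-1-m}t_{X_s,j+m-r_s-1}\big)(\lambda-X_s)^{-j}$. * If $r_\infty\ge3$: $\tilde L_{2,1}=\Big[\frac{N_\infty-\tilde L_{1,1}^2}{\tilde L_{1,2}}\Big]_{\infty,+}+\sum_s\Big[\frac{N_s-\tilde L_{1,1}^2}{\tilde L_{1,2}}\Big]_{X_s,-}$. * If $r_\infty=2$: $\tilde L_{2,1}=\sum_s\Big[\frac{N_s-\tilde L_{1,1}^2}{\tilde L_{1,2}}\Big]_{X_s,-}$. * If $r_\infty=1$: with $\mathring L_{1,1}:=\tilde L_{1,1}+\frac{t_{\infty,0}\lambda+g_0}{\omega}\tilde L_{1,2}=\sum_s\sum_{k=1}^{r_s}\sum_{m=1}^{r_s+1-k}P_{X_s,m}Q_{X_s,k+m-1}(\lambda-X_s)^{-k}$, $$\tilde L_{2,1}=\sum_s\Big[\frac{N_s-\mathring L_{1,1}^2}{\tilde L_{1,2}}\Big]_{X_s,-}+\frac{2(t_{\infty,0}\lambda+g_0)}{\omega}\mathring L_{1,1}-\frac{(t_{\infty,0}\lambda+g_0)^2}{\omega^2}\tilde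 L_{1,2}+\frac{t_{\infty,0}^2}{\omega}.$$ *Entry $[\tilde A_\alpha]_{2,1}$.* Let $$N^\nu_\infty=\sum_{k=r_\infty-3}^{2r_\infty-5}\Big(\sum_{j=k+1}^{2r_\infty-4}\sum_{m=0}^{2r_\infty-4-j}t_{\infty,r_\infty-1-m}t_{\infty,j+m-r_\infty+3}\nu_{\infty,j-k}\Big)\lambda^k\quad(r_\infty\ge3),$$ $$N^\nu_s=\sum_{k=r_s+1}^{2r_s}\Big(\sum_{j=k}^{2r_s}\sum_{m=0}^{2r_s-j}t_{X_s,r_s-1-m}t_{X_s,j+m-r_s-1}\nu_{X_s,j-k}\Big)(\lambda-X_s)^{-k},$$ $$\Phi=\frac{\tilde L_{1,1}}{\tilde L_{1,2}}\Big(\frac{\tilde L_{1,1}}{\tilde L_{1,2}}[\tilde A_\alpha]_{1,2}-2[\tilde A_\alpha]_{1,1}\Big),\qquad \mathcal S=\sum_s\Big[\frac{N^\nu_s}{\tilde L_{1,2}}\Big]_{X_s,-}+\sum_s[\Phi]_{X_s,-}.$$ * If $r_\infty\ge3$: $$[\tilde A_\alpha]_{2,1}=-\frac{t_{\infty,r_\infty-1}}{\omega^2}\mathcal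 L_\alpha[\omega]\,\lambda+\frac2\omega\operatorname*{Res}_{\lambda\to\infty}\Big([\tilde A_\alpha]_{1,1}-\frac{\tilde L_{1,1}}{\tilde L_{1,2}}[\tilde A_\alpha]_{1,2}\Big)+\frac{C}{\omega^3}\mathcal L_\alpha[\omega]+\Big[\frac{N^\nu_\infty}{\tilde L_{1,2}}\Big]_{\infty,+}+[\Phi]_{\infty,+}+\mathcal S,$$ where $C=Q_{\infty,r_\infty-4}$ if $r_\infty\ge4$ and $C=\sum_sQ_{X_s,1}$ if $r_\infty=3$. * If $r_\infty\in\{1,2\}$: $[\tilde A_\alpha]_{2,1}=\mathcal S$. *Value of $g_0$.* * If $r_\infty\ge4$: $g_0=t_{\infty,r_\infty-2}-\frac{t_{\infty,r_\infty-1}}{\omega}Q_{\infty,r_\infty-4}=-\frac{Q_{\infty,r_\infty-4}}{\omega}$. * If $r_\infty=3$: $g_0=t_{\infty,1}-\frac{t_{\infty,2}}{\omega}\sum_sQ_{X_s,1}=-\frac1\omega\sum_sQ_{X_s,1}$. * If $r_\infty=2$: $g_0=t_{\infty,0}-\frac{t_{\infty,1}}{\omega}\sum_s(Q_{X_s,2}+X_sQ_{X_s,1})=t_{\infty,0}-\frac1\omega\sum_s(Q_{X_s,2}+X_sQ_{X_s,1})$.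 * If $r_\infty=1$: $$g_0=\frac1\omega\Big(\frac12-t_{\infty,0}\Big)\Sigma-\frac1{2t_{\infty,0}}\operatorname*{Res}_{\lambda\to\infty}\lambda^2\Big[\mathring L_{1,1}^2+\partial_\lambda\mathring L_{1,1}-\frac{t_{\infty,0}}{\omega}\tilde L_{1,2}-\mathring L_{1,1}\frac{\partial_\lambda\tilde L_{1,2}}{\tilde L_{1,2}}+\frac{t_{\infty,0}^2}{\omega}\tilde L_{1,2}+\tilde L_{1,2}\sum_s\Big[\frac{N_s-\mathring L_{1,1}^2}{\tilde L_{1,2}}\Big]_{X_s,-}\Big].$$ -/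

import Mathlib

noncomputable section

namespace GeoLax

/-! ### Rational functions of the spectral parameter and their Laurent expansions -/

/-- The spectral parameter, as a rational function. -/
abbrev lam : RatFunc ℂ := RatFunc.X

/-- Laurent expansion of a rational function at a finite point `a`, in the local variable
`z` = (spectral parameter) - `a`. -/
def expAt (a : ℂ) (f : RatFunc ℂ) : LaurentSeries ℂ :=
  RatFunc.eval HahnSeries.C (HahnSeries.C a + HahnSeries.single 1 1) f

/-- Laurent expansion of a rational function at infinity, in the local variable
`z` = 1 / (spectral parameter). -/
def expInf (f : RatFunc ℂ) : LaurentSeries ℂ :=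
  RatFunc.eval HahnSeries.C (HahnSeries.single (-1) 1) f

/-- The singular part `[f]_{a,-}` at a finite point. -/
def singPart (a : ℂ) (f : RatFunc ℂ) : RatFunc ℂ :=
  ∑ k ∈ Finset.Icc 1 (-(expAt a f).order).toNat,
    RatFunc.C ((expAt a f).coeff (-(k : ℤ))) * ((lam - RatFunc.C a) ^ k)⁻¹

/-- The polynomial part `[f]_{∞,+}` at infinity (constant term included). -/
def polyPart (f : RatFunc ℂ) : RatFunc ℂ :=
  ∑ k ∈ Finset.range ((-(expInf f).order).toNat + 1),
    RatFunc.C ((expInf f).coeff (-(k : ℤ))) * lam ^ k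

/-- The residue at infinity: minus the coefficient of (spectral parameter)⁻¹. -/
def resInf (f : RatFunc ℂ) : ℂ := -(expInf f).coeff 1

/-- Derivative of a rational function with respect to the spectral parameter. -/
def dLam (f : RatFunc ℂ) : RatFunc ℂ :=
  (algebraMap (Polynomial ℂ) (RatFunc ℂ) (Polynomial.derivative f.num * f.denom
      - f.num * Polynomial.derivative f.denom))
    / (algebraMap (Polynomial ℂ) (RatFunc ℂ) f.denom) ^ 2

/-! ### Pole structure, irregular times and deformation operators -/

/-- Number `n` of finite poles, the orders `rInf`, `r s` of the poles at infinity and at the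
finite poles, and the monodromies `t_{∞,0}`, `t_{X_s,0}` (which are fixed parameters). -/
structure Setting where
  n : ℕ
  rInf : ℕ
  r : Fin n → ℕ
  one_le_rInf : 1 ≤ rInf
  one_le_r : ∀ s, 1 ≤ r s
  t0Inf : ℂ
  t0X : Fin n → ℂ

variable (D : Setting)

/-- Index set of the deformation parameters: `t_{∞,k}` for `1 ≤ k ≤ rInf - 1`, `t_{X_s,k}` for
`1 ≤ k ≤ r s - 1`, and the positions `X_s` of the finite poles. -/
abbrev TimeIdx := Fin (D.rInf - 1) ⊕ (Σ s : Fin D.n, Fin (D.r s - 1)) ⊕ Fin D.n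

/-- The space of all deformation parameters (also the space of the vectors `α`). -/
abbrev Times := TimeIdx D → ℂ

variable {D}

/-- The `(∞,k)` component, `1 ≤ k ≤ rInf - 1` (zero for other `k`). -/
def infComp (v : Times D) (k : ℕ) : ℂ :=
  if h : 1 ≤ k ∧ k ≤ D.rInf - 1 then v (Sum.inl ⟨k - 1, by omega⟩) else 0

/-- The `(X_s,k)` component, `1 ≤ k ≤ r s - 1` (zero for other `k`). -/
def poleComp (v : Times D) (s : Fin D.n) (k : ℕ) : ℂ :=
  if h : 1 ≤ k ∧ k ≤ D.r s - 1 then v (Sum.inr (Sum.inl ⟨s, ⟨k - 1, by omega⟩⟩)) else 0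

/-- The component along the position of the `s`-th pole. For a point of the parameter space this
is the position `X_s` itself, for a vector `α` it is `α_{X_s}`. -/
def posComp (v : Times D) (s : Fin D.n) : ℂ := v (Sum.inr (Sum.inr s))

/-- `t_{∞,k}`, including the monodromy `k = 0`. -/
def tInf (τ : Times D) (k : ℕ) : ℂ := if k = 0 then D.t0Inf else infComp τ k

/-- `t_{X_s,k}`, including the monodromy `k = 0`. -/
def tX (τ : Times D) (s : Fin D.n) (k : ℕ) : ℂ := if k = 0 then D.t0X s else poleComp τ s k

/-- The values given to the trivial times. -/
def Normalized (τ : Times D) : Prop :=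
  (3 ≤ D.rInf → tInf τ (D.rInf - 1) = 1 ∧ tInf τ (D.rInf - 2) = 0) ∧
  (D.rInf = 2 → tInf τ 1 = 1 ∧ ∀ s : Fin D.n, s.val = 0 → posComp τ s = 0) ∧
  (D.rInf = 1 → 2 ≤ D.n → ∀ s : Fin D.n,
    (s.val = 0 → posComp τ s = 0) ∧ (s.val = 1 → posComp τ s = 1)) ∧
  (D.rInf = 1 → D.n = 1 → ∀ s : Fin D.n, posComp τ s = 0 ∧ tX τ s (D.r s - 1) = 1)

/-- Deformation vectors that do not move the trivial times. -/
def Tangent (v : Times D) : Prop :=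
  (3 ≤ D.rInf → infComp v (D.rInf - 1) = 0 ∧ infComp v (D.rInf - 2) = 0) ∧
  (D.rInf = 2 → infComp v 1 = 0 ∧ ∀ s : Fin D.n, s.val = 0 → posComp v s = 0) ∧
  (D.rInf = 1 → 2 ≤ D.n → ∀ s : Fin D.n, s.val ≤ 1 → posComp v s = 0) ∧
  (D.rInf = 1 → D.n = 1 → ∀ s : Fin D.n, posComp v s = 0 ∧ poleComp v s (D.r s - 1) = 0)

/-- The part of an open set `U` on which the trivial times have their prescribed values. -/
def domain (U : Set (Times D)) : Set (Times D) := U ∩ {τ | Normalized τ}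

/-- The deformation operator `𝓛_α = ∑ α_i ∂_i`, the sum running over all `t_{∞,k}`, `t_{X_s,k}`
and `X_s`, applied to a function of the deformation parameters. -/
def deform (α : Times D → Times D) (f : Times D → ℂ) (τ : Times D) : ℂ :=
  ∑ i, α τ i * deriv (fun x => f (Function.update τ i x)) (τ i)

/-- `𝓛_α` applied coefficient by coefficient to a matrix of power series in a local variable. -/
def deformSeries (α : Times D → Times D)
    (F : Times D → Matrix (Fin 2) (Fin 2) (PowerSeries ℂ)) (τ : Times D) :
    Matrix (Fin 2) (Fin 2) (PowerSeries ℂ) :=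
  Matrix.of fun i j => PowerSeries.mk fun k => deform α (fun τ' => (F τ' i j).coeff k) τ

/-! ### Representatives normalized at infinity -/

/-- `M` is an `sl₂` rational matrix with poles of orders `rInf`, `r s` whose leading coefficients
have distinct eigenvalues (a traceless `2 × 2` matrix has distinct eigenvalues exactly when its
determinant is nonzero), normalized at infinity with upper right normalization constant `w`.
Here `LI k` is the coefficient of the power `k - 1` of the spectral parameter and `LX s k` that of
the power `-(k + 1)` of its difference with `X_s`. -/
def IsRepresentative (τ : Times D) (w : ℂ) (M : Matrix (Fin 2) (Fin 2) (RatFunc ℂ)) : Prop :=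
  w ≠ 0 ∧ ∃ (LI : ℕ → Matrix (Fin 2) (Fin 2) ℂ) (LX : Fin D.n → ℕ → Matrix (Fin 2) (Fin 2) ℂ),
    (∀ k, (LI k).trace = 0) ∧ (∀ s k, (LX s k).trace = 0) ∧
    (∀ s k, D.r s ≤ k → LX s k = 0) ∧
    M = ∑ k ∈ Finset.Icc 1 (D.rInf - 1), lam ^ (k - 1) • (LI k).map RatFunc.C
      + ∑ s, ∑ k ∈ Finset.range (D.r s),
          ((lam - RatFunc.C (posComp τ s)) ^ (k + 1))⁻¹ • (LX s k).map RatFunc.C ∧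
    tInf τ (D.rInf - 1) ≠ 0 ∧ (∀ s, (LX s (D.r s - 1)).det ≠ 0) ∧
    (3 ≤ D.rInf →
      LI (D.rInf - 1) = !![-tInf τ (D.rInf - 1), 0; 0, tInf τ (D.rInf - 1)] ∧
      LI (D.rInf - 2) 0 1 = w) ∧
    (D.rInf = 2 → LI 1 = !![-tInf τ 1, 0; 0, tInf τ 1] ∧ (∑ s, LX s 0) 0 1 = w) ∧
    (D.rInf = 1 → ∑ s, LX s 0 = !![-tInf τ 0, 0; 0, tInf τ 0] ∧
      (∑ s, LX s 1 + ∑ s, posComp τ s • LX s 0) 0 1 = w)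

/-! ### Isomonodromic Lax pairs

Near each pole the wave matrix has the form `F(z) diag(exp T(z), exp (-T(z)))` with `F` a formal
power series with coefficients depending on the deformation parameters, where
`T = -∑_{k ≥ 1} t_{p,k} / (k z^k) + t_{p,0} log z`. -/

/-- Coefficients of a matrix of power series as Laurent series. -/
def toLaurent (F : Matrix (Fin 2) (Fin 2) (PowerSeries ℂ)) :
    Matrix (Fin 2) (Fin 2) (LaurentSeries ℂ) :=
  F.map fun f => ((f : PowerSeries ℂ) : LaurentSeries ℂ)

/-- `diag(1,-1)`. -/
def sigma3 : Matrix (Fin 2) (Fin 2) (LaurentSeries ℂ) := !![1, 0; 0, -1]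

/-- Derivative of `F` with respect to its variable. -/
def dz (F : Matrix (Fin 2) (Fin 2) (PowerSeries ℂ)) : Matrix (Fin 2) (Fin 2) (PowerSeries ℂ) :=
  F.map (PowerSeries.derivative ℂ)

/-- Derivative of the exponent `T` at `X_s` with respect to the spectral parameter:
`∑_{k=0}^{r_s-1} t_{X_s,k} z^{-k-1}`. -/
def dLamTX (τ : Times D) (s : Fin D.n) : LaurentSeries ℂ :=
  ∑ k ∈ Finset.range (D.r s), HahnSeries.single (-(k : ℤ) - 1) (tX τ s k)

/-- `𝓛_α` of the exponent `T` at `X_s`, the spectral parameter being fixed: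
`-∑_{k=1}^{r_s-1} α_{X_s,k} / (k z^k) - α_{X_s} ∑_{k=0}^{r_s-1} t_{X_s,k} z^{-k-1}`. -/
def deformTX (v τ : Times D) (s : Fin D.n) : LaurentSeries ℂ :=
  -∑ k ∈ Finset.Icc 1 (D.r s - 1), HahnSeries.single (-(k : ℤ)) (poleComp v s k / k)
    - HahnSeries.C (posComp v s) * dLamTX τ s

/-- Derivative of the exponent `T` at infinity with respect to the spectral parameter:
minus the sum of `t_{∞,k}` times its powers `k - 1`, `0 ≤ k ≤ rInf - 1` (with `z` its inverse). -/
def dLamTInf (τ : Times D) : LaurentSeries ℂ :=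
  -∑ k ∈ Finset.range D.rInf, HahnSeries.single (1 - (k : ℤ)) (tInf τ k)

/-- `𝓛_α` of the exponent `T` at infinity: `-∑_{k=1}^{rInf-1} α_{∞,k} / (k z^k)`. -/
def deformTInf (v : Times D) : LaurentSeries ℂ :=
  -∑ k ∈ Finset.Icc 1 (D.rInf - 1), HahnSeries.single (-(k : ℤ)) (infComp v k / k)

/-- The columns of `F · diag(exp T, exp (-T))` at `X_s` solve both equations of the Lax system
with matrices `M` and `B`. Differentiating with the spectral parameter fixed, `𝓛_α` acts on the
coefficients of `F` and on the local variable `z`, for which `𝓛_α[z] = -α_{X_s}`. -/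
def SolvesAtPole (α : Times D → Times D) (s : Fin D.n)
    (F : Times D → Matrix (Fin 2) (Fin 2) (PowerSeries ℂ)) (τ : Times D)
    (M B : Matrix (Fin 2) (Fin 2) (RatFunc ℂ)) : Prop :=
  M.map (expAt (posComp τ s)) * toLaurent (F τ)
      = toLaurent (dz (F τ)) + dLamTX τ s • (toLaurent (F τ) * sigma3) ∧
  B.map (expAt (posComp τ s)) * toLaurent (F τ)
      = toLaurent (deformSeries α F τ)
          - (HahnSeries.C (posComp (α τ) s) : LaurentSeries ℂ) • toLaurent (dz (F τ))
        + deformTX (α τ) τ s • (toLaurent (F τ) * sigma3)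

/-- The same at infinity, where the derivative with respect to the spectral parameter is
`-z² d/dz`. -/
def SolvesAtInf (α : Times D → Times D)
    (F : Times D → Matrix (Fin 2) (Fin 2) (PowerSeries ℂ)) (τ : Times D)
    (M B : Matrix (Fin 2) (Fin 2) (RatFunc ℂ)) : Prop :=
  M.map expInf * toLaurent (F τ)
      = -((HahnSeries.single 2 1 : LaurentSeries ℂ) • toLaurent (dz (F τ)))
        + dLamTInf τ • (toLaurent (F τ) * sigma3) ∧
  B.map expInf * toLaurent (F τ)
      = toLaurent (deformSeries α F τ) + deformTInf (α τ) • (toLaurent (F τ) * sigma3)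

/-- `F` has holomorphic coefficients and determinant one. -/
def IsGauge (S : Set (Times D)) (F : Times D → Matrix (Fin 2) (Fin 2) (PowerSeries ℂ)) : Prop :=
  (∀ i j k, DifferentiableOn ℂ (fun τ => (F τ i j).coeff k) S) ∧ ∀ τ ∈ S, (F τ).det = 1

/-- `(L, A)` is an isomonodromic `sl₂` Lax pair over `domain U` for the deformation vector field
`α`: `L` is normalized at infinity with constant `ω`, the entries of `A` are rational with poles
only at infinity and at the `X_s`, and the formal wave matrix at each pole, with the irregular
times of the parameter point and the given monodromies, solves `∂Ψ = LΨ` and `𝓛_α[Ψ] = AΨ`. -/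
structure IsLaxPair (U : Set (Times D)) (ω : Times D → ℂ) (α : Times D → Times D)
    (L A : Times D → Matrix (Fin 2) (Fin 2) (RatFunc ℂ)) : Prop where
  isOpen : IsOpen U
  distinct : ∀ τ ∈ domain U, Function.Injective (posComp τ)
  tangent : ∀ τ ∈ domain U, Tangent (α τ)
  differentiable_omega : DifferentiableOn ℂ ω (domain U)
  representative : ∀ τ ∈ domain U, IsRepresentative τ (ω τ) (L τ)
  poles : ∀ τ ∈ domain U, ∀ i j, ∀ a : ℂ, (∀ s, a ≠ posComp τ s) → (A τ i j).denom.eval a ≠ 0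
  solves_inf : ∃ F, IsGauge (domain U) F ∧ ∀ τ ∈ domain U, SolvesAtInf α F τ (L τ) (A τ)
  solves_pole : ∀ s, ∃ F, IsGauge (domain U) F ∧
    ∀ τ ∈ domain U, SolvesAtPole α s F τ (L τ) (A τ)

/-! ### The oper gauge -/

/-- The gauge matrix to the oper form. -/
def gaugeG (M : Matrix (Fin 2) (Fin 2) (RatFunc ℂ)) : Matrix (Fin 2) (Fin 2) (RatFunc ℂ) :=
  !![1, 0; M 0 0, M 0 1]

/-- The entry `[A_α]_{1,2}` of the auxiliary matrix `G B G⁻¹ + 𝓛_α[G] G⁻¹` in the oper gauge (the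
second term does not contribute, since the first row of `G` is constant). -/
def operA12 (M B : Matrix (Fin 2) (Fin 2) (RatFunc ℂ)) : RatFunc ℂ :=
  (gaugeG M * B * (gaugeG M)⁻¹) 0 1

/-- The coefficients `ν_{∞,k}`: `[A_α]_{1,2}` is the sum of `ν_{∞,k}` times the power `-k` of the
spectral parameter at infinity. -/
def nuInf (M B : Matrix (Fin 2) (Fin 2) (RatFunc ℂ)) (k : ℤ) : ℂ :=
  (expInf (operA12 M B)).coeff k

/-- The coefficients `ν_{X_s,k}` of the expansion of `[A_α]_{1,2}` at `X_s`. -/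
def nuX (τ : Times D) (M B : Matrix (Fin 2) (Fin 2) (RatFunc ℂ)) (s : Fin D.n) (k : ℕ) : ℂ :=
  (expAt (posComp τ s) (operA12 M B)).coeff (k : ℤ)

/-- The lower triangular Toeplitz matrix `M_∞` of size `rInf - 3`. -/
def matInf (τ : Times D) : Matrix (Fin (D.rInf - 3)) (Fin (D.rInf - 3)) ℂ :=
  Matrix.of fun i j => if j ≤ i then tInf τ (D.rInf - 1 - ((i : ℕ) - (j : ℕ))) else 0

/-- The lower triangular Toeplitz matrix `M_{X_s}` of size `r s - 1`. -/
def matX (τ : Times D) (s : Fin D.n) : Matrix (Fin (D.r s - 1)) (Fin (D.r s - 1)) ℂ :=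
  Matrix.of fun i j => if j ≤ i then tX τ s (D.r s - 1 - ((i : ℕ) - (j : ℕ))) else 0

/-! ### Darboux coordinates -/

section Darboux

variable {g : ℕ}

/-- `w ∏_j (· - q_j) / ∏_s (· - X_s)^{r_s}`. -/
def factorized (τ : Times D) (w : ℂ) (q : Fin g → ℂ) : RatFunc ℂ :=
  RatFunc.C w * (∏ j, (lam - RatFunc.C (q j)))
    / ∏ s, (lam - RatFunc.C (posComp τ s)) ^ D.r s

/-- `Q_{∞,k}` as a function of `q`: coefficient of the `k`-th power of the spectral parameter in
the polar form of `factorized`. It is used for `0 ≤ k ≤ rInf - 4`. -/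
def QInf (τ : Times D) (w : ℂ) (q : Fin g → ℂ) (k : ℕ) : ℂ :=
  (expInf (factorized τ w q)).coeff (-(k : ℤ))

/-- `Q_{X_s,k}` as a function of `q`: coefficient of the power `-k` at `X_s` in the polar form of
`factorized`. It vanishes for `k > r s`. -/
def QX (τ : Times D) (w : ℂ) (q : Fin g → ℂ) (s : Fin D.n) (k : ℕ) : ℂ :=
  (expAt (posComp τ s) (factorized τ w q)).coeff (-(k : ℤ))

/-- The constant `g₀` in the gauge transformation to the oper form. For `rInf = 1` the residue
matrix and its successor at `X_s` enter through their upper left entries. -/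
def gZero (τ : Times D) (M : Matrix (Fin 2) (Fin 2) (RatFunc ℂ)) (q : Fin g → ℂ) : ℂ :=
  if 2 ≤ D.rInf then
    tInf τ (D.rInf - 2)
      + tInf τ (D.rInf - 1) * (∑ j, q j - ∑ s, (D.r s : ℂ) * posComp τ s)
  else
    tInf τ 0 * (∑ j, q j - ∑ s, (D.r s : ℂ) * posComp τ s)
      - ∑ s, (posComp τ s * (expAt (posComp τ s) (M 0 0)).coeff (-1)
          + (expAt (posComp τ s) (M 0 0)).coeff (-2))

/-- `q` are the (pairwise distinct) zeros of `M₁₂`, and `(Q, P)` are the geometric Darboux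
coordinates of `M`: with `p_i = M₁₁(q_i)` one has `p_i = ∑ P ∂Q/∂q_i`, with the additional
constraints on `P` for `rInf ≤ 2` (the additional relations on `Q` alone hold by definition of
`Q`). -/
structure IsGeometricDarboux (τ : Times D) (w : ℂ) (M : Matrix (Fin 2) (Fin 2) (RatFunc ℂ))
    (q : Fin g → ℂ) (PInf : ℕ → ℂ) (PX : Fin D.n → ℕ → ℂ) : Prop where
  q_injective : Function.Injective q
  q_ne : ∀ j s, q j ≠ posComp τ s
  entry12 : M 0 1 = factorized τ w q
  p_eq : ∀ i, (M 0 0).eval (RingHom.id ℂ) (q i)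
    = ∑ k ∈ Finset.range (D.rInf - 3),
        PInf k * deriv (fun x => QInf τ w (Function.update q i x) k) (q i)
      + ∑ s, ∑ k ∈ Finset.Icc 1 (D.r s),
          PX s k * deriv (fun x => QX τ w (Function.update q i x) s k) (q i)
  constraint₁ : D.rInf ≤ 2 → ∑ s, ∑ m ∈ Finset.Icc 1 (D.r s), PX s m * QX τ w q s m = 0
  constraint₂ : D.rInf = 1 →
    ∑ s, ∑ m ∈ Finset.Icc 1 (D.r s - 1), PX s m * QX τ w q s (m + 1)
      + ∑ s, ∑ m ∈ Finset.Icc 1 (D.r s), posComp τ s * PX s m * QX τ w q s m = 0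

end Darboux

/-! ### The explicit expressions -/

variable (D) in
/-- The numbers out of which the explicit expressions are built: the parameter point, `ω` and
`𝓛_α[ω]`, the coordinates `Q` and `P`, `g₀` and the coefficients `ν`. -/
structure Coords where
  τ : Times D
  ω : ℂ
  dω : ℂ
  g₀ : ℂ
  QI : ℕ → ℂ
  QX : Fin D.n → ℕ → ℂ
  PI : ℕ → ℂ
  PX : Fin D.n → ℕ → ℂ
  νI : ℤ → ℂ
  νX : Fin D.n → ℕ → ℂ

/-- The numbers attached to a Lax pair and its geometric Darboux coordinates. -/
def coords {g : ℕ} (ω : Times D → ℂ) (α : Times D → Times D)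
    (L A : Times D → Matrix (Fin 2) (Fin 2) (RatFunc ℂ)) (τ : Times D) (q : Fin g → ℂ)
    (PInf : ℕ → ℂ) (PX : Fin D.n → ℕ → ℂ) : Coords D where
  τ := τ
  ω := ω τ
  dω := deform α ω τ
  g₀ := gZero τ (L τ) q
  QI := GeoLax.QInf τ (ω τ) q
  QX := GeoLax.QX τ (ω τ) q
  PI := PInf
  PX := PX
  νI := nuInf (L τ) (A τ)
  νX := nuX τ (L τ) (A τ)

namespace Coords

variable (c : Coords D)

/-- The position `X_s`. -/
def X (s : Fin D.n) : ℂ := posComp c.τ s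

/-- `t_{∞,k}`. -/
def tI (k : ℕ) : ℂ := GeoLax.tInf c.τ k

/-- `t_{X_s,k}`. -/
def tX (s : Fin D.n) (k : ℕ) : ℂ := GeoLax.tX c.τ s k

/-- The power `-k` of (spectral parameter) - `X_s`. -/
def pw (s : Fin D.n) (k : ℕ) : RatFunc ℂ := ((lam - RatFunc.C (c.X s)) ^ k)⁻¹

/-- Polar form of the `(1,2)` entry of the Lax matrix. -/
def L12 : RatFunc ℂ :=
  ∑ s, ∑ k ∈ Finset.Icc 1 (D.r s), RatFunc.C (c.QX s k) * c.pw s k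
    + ∑ k ∈ Finset.range (D.rInf - 3), RatFunc.C (c.QI k) * lam ^ k
    + if 3 ≤ D.rInf then RatFunc.C c.ω * lam ^ (D.rInf - 3) else 0

/-- The part of the `(1,1)` entry at the finite poles that is bilinear in `P` and `Q`. -/
def ring11 : RatFunc ℂ :=
  ∑ s, ∑ k ∈ Finset.Icc 1 (D.r s), ∑ m ∈ Finset.Icc 1 (D.r s + 1 - k),
    RatFunc.C (c.PX s m * c.QX s (k + m - 1)) * c.pw s k

/-- The `(1,1)` entry of the Lax matrix. -/
def L11 : RatFunc ℂ :=
  -RatFunc.C c.ω * ∑ k ∈ Finset.range (D.rInf - 3), RatFunc.C (c.PI (D.rInf - 4 - k)) * lam ^ k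
    - ∑ k ∈ Finset.range (D.rInf - 4), ∑ m ∈ Finset.range (D.rInf - 4 - k),
        RatFunc.C (c.PI m * c.QI (k + 1 + m)) * lam ^ k
    + c.ring11
    - (RatFunc.C (c.tI (D.rInf - 1)) * lam + RatFunc.C c.g₀) / RatFunc.C c.ω * c.L12

/-- The `(1,2)` entry of the auxiliary matrix. -/
def A12 : RatFunc ℂ :=
  (if 4 ≤ D.rInf then RatFunc.C (c.ω * c.νI 1) * lam ^ (D.rInf - 4) else 0)
    + ∑ j ∈ Finset.range (D.rInf - 4),
        RatFunc.C (c.ω * c.νI ((D.rInf : ℤ) - 3 - j)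
          + ∑ k ∈ Finset.Icc (j + 1) (D.rInf - 4), c.νI ((k : ℤ) - j) * c.QI k) * lam ^ j
    + ∑ s, ∑ j ∈ Finset.Icc 1 (D.r s),
        RatFunc.C (∑ k ∈ Finset.Icc j (D.r s), c.νX s (k - j) * c.QX s k) * c.pw s j

/-- `ω P_{∞,0} + (t_{∞,rInf-1} Q_{∞,rInf-5} + Q_{∞,rInf-4} g₀) / ω`. -/
def kappa : ℂ :=
  c.ω * c.PI 0
    + (c.tI (D.rInf - 1) * c.QI (D.rInf - 5) + c.QI (D.rInf - 4) * c.g₀) / c.ω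

/-- Polynomial part of the `(1,1)` entry of the auxiliary matrix. -/
def A11Poly : RatFunc ℂ :=
  RatFunc.C (1 / (2 * c.ω) * c.dω)
    - (if D.rInf = 2 then RatFunc.C (c.tI 1 * c.νI 0) else 0)
    + (if D.rInf = 1 then RatFunc.C ((1 / 2 - c.tI 0) * c.νI (-1)) else 0)
    - (if 3 ≤ D.rInf then
        RatFunc.C (c.tI (D.rInf - 1) * c.νI 1) * lam ^ (D.rInf - 3) else 0)
    - (if 4 ≤ D.rInf then
        RatFunc.C (c.tI (D.rInf - 1) * c.νI 2) * lam ^ (D.rInf - 4) else 0)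
    - (if 5 ≤ D.rInf then
        RatFunc.C (c.tI (D.rInf - 1) * c.νI 3 + c.kappa * c.νI 1) * lam ^ (D.rInf - 5) else 0)
    - ∑ j ∈ Finset.range (D.rInf - 5), RatFunc.C
        (c.tI (D.rInf - 1) * c.νI ((D.rInf : ℤ) - 2 - j)
          + c.νI ((D.rInf : ℤ) - 4 - j) * c.kappa
          + ∑ i ∈ Finset.Icc 1 (D.rInf - 5 - j), c.νI i *
              (c.ω * c.PI (D.rInf - 4 - i - j)
                + ∑ m ∈ Finset.range (D.rInf - 4 - i - j), c.PI m * c.QI (j + i + 1 + m)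
                + (c.tI (D.rInf - 1) * c.QI (j + i - 1) + c.g₀ * c.QI (j + i)) / c.ω))
        * lam ^ j

/-- Singular part at the finite poles of the `(1,1)` entry of the auxiliary matrix. -/
def A11Sing : RatFunc ℂ :=
  ∑ s, RatFunc.C ((c.PX s 1 - (c.tI (D.rInf - 1) * c.X s + c.g₀) / c.ω)
      * c.QX s (D.r s) * c.νX s 0) * c.pw s (D.r s)
    + ∑ s, ∑ k ∈ Finset.Icc 1 (D.r s - 1), RatFunc.C
        (∑ i ∈ Finset.range (D.r s - k + 1), ∑ m ∈ Finset.Icc 1 (D.r s + 1 - k - i),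
            c.νX s i * c.PX s m * c.QX s (k + i + m - 1)
          - (c.tI (D.rInf - 1) * c.X s + c.g₀) / c.ω
              * ∑ i ∈ Finset.range (D.r s - k + 1), c.νX s i * c.QX s (k + i)
          - c.tI (D.rInf - 1) / c.ω
              * ∑ i ∈ Finset.range (D.r s - k), c.νX s i * c.QX s (k + i + 1))
        * c.pw s k

/-- The `(1,1)` entry of the auxiliary matrix. -/
def A11 : RatFunc ℂ := c.A11Poly + c.A11Sing

/-- `∑_{j=rInf-3}^{2rInf-4} (∑_m t_{∞,rInf-1-m} t_{∞,j+m-rInf+3}) (·)^j` (for `rInf ≥ 3`). -/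
def numInf : RatFunc ℂ :=
  ∑ j ∈ Finset.Icc (D.rInf - 3) (2 * D.rInf - 4), RatFunc.C
    (∑ m ∈ Finset.range (2 * D.rInf - 4 - j + 1),
      c.tI (D.rInf - 1 - m) * c.tI (j + m + 3 - D.rInf)) * lam ^ j

/-- `∑_{j=r_s+1}^{2r_s} (∑_m t_{X_s,r_s-1-m} t_{X_s,j+m-r_s-1}) (· - X_s)^{-j}`. -/
def numX (s : Fin D.n) : RatFunc ℂ :=
  ∑ j ∈ Finset.Icc (D.r s + 1) (2 * D.r s), RatFunc.C
    (∑ m ∈ Finset.range (2 * D.r s - j + 1),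
      c.tX s (D.r s - 1 - m) * c.tX s (j + m - D.r s - 1)) * c.pw s j

/-- `∑_{k=rInf-3}^{2rInf-5} (∑_{j=k+1}^{2rInf-4} ∑_m t_{∞,rInf-1-m} t_{∞,j+m-rInf+3}
ν_{∞,j-k}) (·)^k` (for `rInf ≥ 3`). -/
def numNuInf : RatFunc ℂ :=
  ∑ k ∈ Finset.Icc (D.rInf - 3) (2 * D.rInf - 5), RatFunc.C
    (∑ j ∈ Finset.Icc (k + 1) (2 * D.rInf - 4), ∑ m ∈ Finset.range (2 * D.rInf - 4 - j + 1),
      c.tI (D.rInf - 1 - m) * c.tI (j + m + 3 - D.rInf) * c.νI ((j : ℤ) - k)) * lam ^ k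

/-- `∑_{k=r_s+1}^{2r_s} (∑_{j=k}^{2r_s} ∑_m t_{X_s,r_s-1-m} t_{X_s,j+m-r_s-1} ν_{X_s,j-k})
(· - X_s)^{-k}`. -/
def numNuX (s : Fin D.n) : RatFunc ℂ :=
  ∑ k ∈ Finset.Icc (D.r s + 1) (2 * D.r s), RatFunc.C
    (∑ j ∈ Finset.Icc k (2 * D.r s), ∑ m ∈ Finset.range (2 * D.r s - j + 1),
      c.tX s (D.r s - 1 - m) * c.tX s (j + m - D.r s - 1) * c.νX s (j - k)) * c.pw s k

/-- `∑_s [(numX_s - f²) / L12]_{X_s,-}`. -/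
def singL21 (f : RatFunc ℂ) : RatFunc ℂ :=
  ∑ s, singPart (c.X s) ((c.numX s - f ^ 2) / c.L12)

/-- `(L11/L12) ((L11/L12) A12 - 2 A11)`. -/
def mixed : RatFunc ℂ := c.L11 / c.L12 * (c.L11 / c.L12 * c.A12 - 2 * c.A11)

/-- The part of the `(2,1)` entry of the auxiliary matrix that is singular at the finite poles. -/
def A21Sing : RatFunc ℂ :=
  ∑ s, singPart (c.X s) (c.numNuX s / c.L12) + ∑ s, singPart (c.X s) c.mixed

/-- `(t_{∞,0} · + g₀) / ω`, used for `rInf = 1`. -/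
def slope : RatFunc ℂ := (RatFunc.C (c.tI 0) * lam + RatFunc.C c.g₀) / RatFunc.C c.ω

/-- `∑_s (X_s² Q_{X_s,1} + 2 X_s Q_{X_s,2} + Q_{X_s,3})`. -/
def sigma : ℂ := ∑ s, (c.X s ^ 2 * c.QX s 1 + 2 * c.X s * c.QX s 2 + c.QX s 3)

/-- `∑_s ∑_{k=1}^{r_s} ν_{X_s,k-1} Q_{X_s,k}`. -/
def nuQ₁ : ℂ := ∑ s, ∑ k ∈ Finset.Icc 1 (D.r s), c.νX s (k - 1) * c.QX s k

/-- `∑_s (∑_{k=2}^{r_s} ν_{X_s,k-2} Q_{X_s,k} + X_s ∑_{k=1}^{r_s} ν_{X_s,k-1} Q_{X_s,k})`. -/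
def nuQ₂ : ℂ :=
  ∑ s, (∑ k ∈ Finset.Icc 2 (D.r s), c.νX s (k - 2) * c.QX s k
    + c.X s * ∑ k ∈ Finset.Icc 1 (D.r s), c.νX s (k - 1) * c.QX s k)

end Coords

end GeoLax

end

/-!
Write `a = L₁₁`, `b = L₁₂`, `c = L₂₁` and `ν = A₁₂ / L₁₂`. Since the gauge matrix `G` has first row
`(1, 0)`, this `ν` is the entry `[A_α]₁₂` in the oper gauge (`operA12_eq`). Every formula of the
theorem identifies a rational function, and a rational function without finite poles that vanishes
at infinity is zero (`eq_of_holAt_sub`). So it suffices to know the singular parts of `L` and `A`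
at all poles, and these are forced by the formal solutions.

*Local analysis.* At a pole the formal solution `F exp(T σ₃)` with `det F = 1` gives
`L = F' F⁻¹ + T' F σ₃ F⁻¹` and `A = 𝓛[F] F⁻¹ + 𝓛[T] F σ₃ F⁻¹`. At `X_s` (`local_finite`) comparing
the upper right entries yields `ν T' = 𝓛[T] + O(1)`, hence `A = ν L + O(1)`, and the determinant
yields `a² + b c = T'² + O(z^{-r})`. At infinity analogous relations hold
(`gauge_offdiag_eq_zero`, `lax_expansion_inf`, `auxiliary_expansion_inf`), because the normalization
of `L` makes the constant term of `F` diagonal; differentiating the expression of `ω` by the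
coefficients of `F` along `𝓛_α` produces the terms `𝓛_α[ω] / ω`. This needs `𝓛_α` to be a
derivation on functions holomorphic on the slice, which holds because `α` does not move the
trivial times.

*The coefficients `ν`.* The Toeplitz systems are the coefficients of `ν T' = 𝓛[T] + O(1)`. The
remaining relations are the residue theorem for `A₁₂ = ν b` and `λ A₁₂`.

*The first rows.* The expression of `L₁₂` is its decomposition into polar and polynomial parts. For
`L₁₁`, let `E` be the difference of `L₁₁ + (t_{∞,r_∞-1} λ + g₀) b / ω` and the part bilinear in `P`
and `Q`. The relations defining `P` telescope to `E(q_i) = 0`, the value of `g₀` and the constraints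
on `P` kill the leading terms of `E` at infinity, and then `E / b` has no poles and vanishes at
infinity (`Describes.L00_add_eq`). The first row of `A` follows from `A = ν L + O(1)`.

*The lower left entries.* At `X_s` one has `c = (T'² - a²) / b + O(1)` and
`A₂₁ = ν (T'² - a²) / b + O(1)`, with a similar relation at infinity; the truncated squares `N` may
replace `T'²` since `b` has a pole of exact order `r`.

*The value of `g₀`.* For `r_∞ ≥ 2` it is read off from the subleading coefficient of `b` at
infinity. For `r_∞ = 1` the function whose residue is taken is `a² + b c + a' - a b' / b`, and the
residue is affine in `g₀`.
-/

open HahnSeries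

namespace GeoLax

/-! ### Laurent series vanishing to a given order -/

/-- All coefficients of the Laurent series `x` below degree `n` are zero, i.e. `x = O(zⁿ)`. -/
def VanishesTo (n : ℤ) (x : LaurentSeries ℂ) : Prop := ∀ k < n, x.coeff k = 0

namespace VanishesTo

variable {n m : ℤ} {x y : LaurentSeries ℂ}

theorem mono (hx : VanishesTo n x) (h : m ≤ n) : VanishesTo m x :=
  fun k hk => hx k (hk.trans_le h)

theorem zero (n : ℤ) : VanishesTo n 0 := fun _ _ => rfl

theorem add (hx : VanishesTo n x) (hy : VanishesTo n y) : VanishesTo n (x + y) :=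
  fun k hk => by rw [coeff_add, hx k hk, hy k hk, add_zero]

theorem neg (hx : VanishesTo n x) : VanishesTo n (-x) :=
  fun k hk => by rw [coeff_neg, hx k hk, neg_zero]

theorem sub (hx : VanishesTo n x) (hy : VanishesTo n y) : VanishesTo n (x - y) :=
  fun k hk => by rw [coeff_sub, hx k hk, hy k hk, sub_zero]

theorem sum {ι : Type*} {s : Finset ι} {f : ι → LaurentSeries ℂ}
    (h : ∀ i ∈ s, VanishesTo n (f i)) : VanishesTo n (∑ i ∈ s, f i) := fun k hk => by
  rw [coeff_sum]
  exact Finset.sum_eq_zero fun i hi => h i hi k hk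

theorem single (n : ℤ) (c : ℂ) : VanishesTo n (single n c : LaurentSeries ℂ) :=
  fun _ hk => coeff_single_of_ne hk.ne

theorem C (c : ℂ) : VanishesTo 0 (HahnSeries.C c : LaurentSeries ℂ) := single 0 c

theorem one : VanishesTo 0 (1 : LaurentSeries ℂ) := single 0 1

/-- Factorization as `zⁿ` times a power series. -/
theorem exists_eq (hx : VanishesTo n x) :
    x = HahnSeries.single n 1 *
      ((PowerSeries.mk fun i : ℕ => x.coeff (n + i) : PowerSeries ℂ) : LaurentSeries ℂ) := by
  ext k
  rw [coeff_single_mul, one_mul, PowerSeries.coeff_coe]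
  split_ifs with h
  · exact hx k (by omega)
  · rw [PowerSeries.coeff_mk]
    congr 1
    omega

/-- The Cauchy product formula for series with poles of bounded order. -/
theorem coeff_mul (hx : VanishesTo n x) (hy : VanishesTo m y) (k : ℕ) :
    (x * y).coeff (n + m + k)
      = ∑ i ∈ Finset.range (k + 1), x.coeff (n + i) * y.coeff (m + k - i) := by
  conv_lhs => rw [hx.exists_eq, hy.exists_eq]
  rw [mul_mul_mul_comm, single_mul_single, ← PowerSeries.coe_mul, one_mul, coeff_single_mul,
    one_mul, add_sub_cancel_left, LaurentSeries.coeff_coe_powerSeries, PowerSeries.coeff_mul,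
    Finset.Nat.sum_antidiagonal_eq_sum_range_succ_mk]
  refine Finset.sum_congr rfl fun i hi => ?_
  rw [Finset.mem_range] at hi
  rw [PowerSeries.coeff_mk, PowerSeries.coeff_mk]
  congr 2
  omega

theorem mul (hx : VanishesTo n x) (hy : VanishesTo m y) : VanishesTo (n + m) (x * y) := by
  intro k hk
  rw [hx.exists_eq, hy.exists_eq, mul_mul_mul_comm, single_mul_single, ← PowerSeries.coe_mul,
    one_mul, coeff_single_mul, one_mul, PowerSeries.coeff_coe, if_pos (by omega)]

theorem mul' {l : ℤ} (hx : VanishesTo n x) (hy : VanishesTo m y) (h : l ≤ n + m) :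
    VanishesTo l (x * y) := (hx.mul hy).mono h

theorem coeff_mul_low {l : ℤ} (hx : VanishesTo n x) (hy : VanishesTo m y) (h : l = n + m) :
    (x * y).coeff l = x.coeff n * y.coeff m := by
  have := hx.coeff_mul hy 0
  simpa [h] using this

theorem coeff_mul_succ {l : ℤ} (hx : VanishesTo n x) (hy : VanishesTo m y) (h : l = n + m + 1) :
    (x * y).coeff l = x.coeff n * y.coeff (m + 1) + x.coeff (n + 1) * y.coeff m := by
  have := hx.coeff_mul hy 1
  simpa [h, Finset.sum_range_succ] using this

theorem div (hx : VanishesTo n x) (hy : VanishesTo m y) (h : y.coeff m ≠ 0) :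
    VanishesTo (n - m) (x / y) := by
  have hy0 : y ≠ 0 := by rintro rfl; simp at h
  by_contra hcon
  have hz : x / y ≠ 0 := by intro h0; rw [h0] at hcon; exact hcon (zero _)
  have ho : VanishesTo (x / y).order (x / y) := fun k hk => coeff_eq_zero_of_lt_order hk
  have hlt : (x / y).order < n - m := by
    by_contra hge
    exact hcon (ho.mono (not_lt.1 hge))
  have h1 := ho.coeff_mul_low hy rfl
  rw [div_mul_cancel₀ _ hy0, hx _ (by omega)] at h1
  exact mul_ne_zero (by simpa using coeff_order_eq_zero.not.2 hz) h h1.symm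

theorem div' {l : ℤ} (hx : VanishesTo n x) (hy : VanishesTo m y) (h : y.coeff m ≠ 0)
    (hl : l ≤ n - m) : VanishesTo l (x / y) := (hx.div hy h).mono hl

theorem pow (hx : VanishesTo n x) (k : ℕ) : VanishesTo (k * n) (x ^ k) := by
  induction k with
  | zero => simpa using one
  | succ k ih => rw [pow_succ]; exact ih.mul' hx (by push_cast; linarith)

end VanishesTo

theorem vanishesTo_coe (f : PowerSeries ℂ) : VanishesTo 0 (f : LaurentSeries ℂ) := fun k hk => by
  rw [PowerSeries.coeff_coe, if_pos hk]

theorem coeff_coe_zero (f : PowerSeries ℂ) :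
    (f : LaurentSeries ℂ).coeff 0 = PowerSeries.coeff 0 f := by
  simpa using LaurentSeries.coeff_coe_powerSeries f 0

theorem coeff_coe_one (f : PowerSeries ℂ) :
    (f : LaurentSeries ℂ).coeff 1 = PowerSeries.coeff 1 f := by
  simpa using LaurentSeries.coeff_coe_powerSeries f 1

theorem vanishesTo_one_coe {f : PowerSeries ℂ} (h : PowerSeries.coeff 0 f = 0) :
    VanishesTo 1 (f : LaurentSeries ℂ) := fun k hk => by
  rcases lt_or_ge k 0 with h0 | h0
  · exact vanishesTo_coe f k h0
  · obtain rfl : k = 0 := by omega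
    rw [coeff_coe_zero, h]

theorem coeff_C_mul' (c : ℂ) (x : LaurentSeries ℂ) (k : ℤ) :
    (C c * x).coeff k = c * x.coeff k := by
  rw [C_mul_eq_smul, coeff_smul, smul_eq_mul]

/-! ### The expansions as ring homomorphisms -/

/-- The Taylor expansion of a polynomial at `a`. -/
theorem eval₂_at_eq_coe (a : ℂ) (p : Polynomial ℂ) :
    p.eval₂ C (C a + single 1 1 : LaurentSeries ℂ)
      = (((p.comp (Polynomial.X + Polynomial.C a) : Polynomial ℂ) : PowerSeries ℂ)
          : LaurentSeries ℂ) := by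
  induction p using Polynomial.induction_on' with
  | add p q hp hq => rw [Polynomial.eval₂_add, hp, hq]; simp
  | monomial n c =>
    simp only [Polynomial.eval₂_monomial, Polynomial.monomial_comp, Polynomial.coe_mul,
      Polynomial.coe_pow, Polynomial.coe_add, Polynomial.coe_X, Polynomial.coe_C,
      map_add, map_pow, map_mul]
    rw [PowerSeries.coe_C, add_comm (C a)]
    congr 2
    rw [PowerSeries.coe_C, PowerSeries.coe_X]

theorem eval₂_at_ne_zero (a : ℂ) {p : Polynomial ℂ} (hp : p ≠ 0) :
    p.eval₂ C (C a + single 1 1 : LaurentSeries ℂ) ≠ 0 := by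
  rw [eval₂_at_eq_coe]
  intro h
  have h1 : (((p.comp (Polynomial.X + Polynomial.C a) : Polynomial ℂ) : PowerSeries ℂ)) = 0 :=
    ofPowerSeries_injective (Γ := ℤ) (by rw [h, map_zero])
  rw [Polynomial.coe_eq_zero_iff] at h1
  exact hp (by
    have := Polynomial.comp_X_add_C_eq_zero_iff.1 h1
    exact this)

theorem coeff_eval₂_inf (p : Polynomial ℂ) (k : ℕ) :
    (p.eval₂ C (single (-1) 1 : LaurentSeries ℂ)).coeff (-(k : ℤ)) = p.coeff k := by
  induction p using Polynomial.induction_on' with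
  | add p q hp hq => simp [hp, hq, Polynomial.eval₂_add]
  | monomial n c =>
    rw [Polynomial.eval₂_monomial, coeff_C_mul', single_pow, coeff_single,
      Polynomial.coeff_monomial]
    by_cases h : n = k
    · simp [h]
    · rw [if_neg (by simp; omega), if_neg h, mul_zero]

theorem eval₂_inf_ne_zero {p : Polynomial ℂ} (hp : p ≠ 0) :
    p.eval₂ C (single (-1) 1 : LaurentSeries ℂ) ≠ 0 := by
  intro h
  apply hp
  ext k
  rw [← coeff_eval₂_inf, h]
  simp

section

variable (a : ℂ) (f g : RatFunc ℂ)

theorem expAt_add : expAt a (f + g) = expAt a f + expAt a g :=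
  RatFunc.eval_add _ _ (eval₂_at_ne_zero a f.denom_ne_zero) (eval₂_at_ne_zero a g.denom_ne_zero)

theorem expAt_mul : expAt a (f * g) = expAt a f * expAt a g :=
  RatFunc.eval_mul _ _ (eval₂_at_ne_zero a f.denom_ne_zero) (eval₂_at_ne_zero a g.denom_ne_zero)

theorem expInf_add : expInf (f + g) = expInf f + expInf g :=
  RatFunc.eval_add _ _ (eval₂_inf_ne_zero f.denom_ne_zero) (eval₂_inf_ne_zero g.denom_ne_zero)

theorem expInf_mul : expInf (f * g) = expInf f * expInf g :=
  RatFunc.eval_mul _ _ (eval₂_inf_ne_zero f.denom_ne_zero) (eval₂_inf_ne_zero g.denom_ne_zero)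

/-- The Laurent expansion at a finite point as a ring homomorphism. -/
noncomputable def expAtHom : RatFunc ℂ →+* LaurentSeries ℂ where
  toFun := expAt a
  map_zero' := RatFunc.eval_zero _ _
  map_one' := RatFunc.eval_one _ _
  map_add' := expAt_add a
  map_mul' := expAt_mul a

/-- The Laurent expansion at infinity as a ring homomorphism. -/
noncomputable def expInfHom : RatFunc ℂ →+* LaurentSeries ℂ where
  toFun := expInf
  map_zero' := RatFunc.eval_zero _ _
  map_one' := RatFunc.eval_one _ _
  map_add' := expInf_add
  map_mul' := expInf_mul

theorem expAt_zero : expAt a 0 = 0 := map_zero (expAtHom a)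
theorem expAt_one : expAt a 1 = 1 := map_one (expAtHom a)
theorem expAt_sub : expAt a (f - g) = expAt a f - expAt a g := map_sub (expAtHom a) f g
theorem expAt_neg : expAt a (-f) = -expAt a f := map_neg (expAtHom a) f
theorem expAt_inv : expAt a f⁻¹ = (expAt a f)⁻¹ := map_inv₀ (expAtHom a) f
theorem expAt_div : expAt a (f / g) = expAt a f / expAt a g := map_div₀ (expAtHom a) f g
theorem expAt_pow (n : ℕ) : expAt a (f ^ n) = expAt a f ^ n := map_pow (expAtHom a) f n
theorem expAt_sum {ι : Type*} (s : Finset ι) (f : ι → RatFunc ℂ) :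
    expAt a (∑ i ∈ s, f i) = ∑ i ∈ s, expAt a (f i) := map_sum (expAtHom a) f s
theorem expAt_prod {ι : Type*} (s : Finset ι) (f : ι → RatFunc ℂ) :
    expAt a (∏ i ∈ s, f i) = ∏ i ∈ s, expAt a (f i) := map_prod (expAtHom a) f s
theorem expAt_C (c : ℂ) : expAt a (RatFunc.C c) = C c := RatFunc.eval_C _ _
theorem expAt_lam : expAt a lam = C a + single 1 1 := RatFunc.eval_X _ _
theorem expAt_two : expAt a 2 = 2 := map_ofNat (expAtHom a) 2

theorem expInf_zero : expInf 0 = 0 := map_zero expInfHom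
theorem expInf_one : expInf 1 = 1 := map_one expInfHom
theorem expInf_sub : expInf (f - g) = expInf f - expInf g := map_sub expInfHom f g
theorem expInf_inv : expInf f⁻¹ = (expInf f)⁻¹ := map_inv₀ expInfHom f
theorem expInf_div : expInf (f / g) = expInf f / expInf g := map_div₀ expInfHom f g
theorem expInf_pow (n : ℕ) : expInf (f ^ n) = expInf f ^ n := map_pow expInfHom f n
theorem expInf_sum {ι : Type*} (s : Finset ι) (f : ι → RatFunc ℂ) :
    expInf (∑ i ∈ s, f i) = ∑ i ∈ s, expInf (f i) := map_sum expInfHom f s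
theorem expInf_prod {ι : Type*} (s : Finset ι) (f : ι → RatFunc ℂ) :
    expInf (∏ i ∈ s, f i) = ∏ i ∈ s, expInf (f i) := map_prod expInfHom f s
theorem expInf_C (c : ℂ) : expInf (RatFunc.C c) = C c := RatFunc.eval_C _ _
theorem expInf_lam : expInf lam = single (-1) 1 := RatFunc.eval_X _ _
theorem expInf_two : expInf 2 = 2 := map_ofNat expInfHom 2

theorem expInf_injective : Function.Injective expInf := expInfHom.injective

theorem expAt_eq_div : expAt a f = f.num.eval₂ C (C a + single 1 1 : LaurentSeries ℂ)
    / f.denom.eval₂ C (C a + single 1 1 : LaurentSeries ℂ) := rfl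

theorem expInf_eq_div : expInf f = f.num.eval₂ C (single (-1) 1 : LaurentSeries ℂ)
    / f.denom.eval₂ C (single (-1) 1 : LaurentSeries ℂ) := rfl

end

theorem vanishesTo_eval₂_at (a : ℂ) (p : Polynomial ℂ) :
    VanishesTo 0 (p.eval₂ C (C a + single 1 1 : LaurentSeries ℂ)) := by
  rw [eval₂_at_eq_coe]; exact vanishesTo_coe _

theorem coeff_zero_eval₂_at (a : ℂ) (p : Polynomial ℂ) :
    (p.eval₂ C (C a + single 1 1 : LaurentSeries ℂ)).coeff 0 = p.eval a := by
  rw [eval₂_at_eq_coe, coeff_coe_zero]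
  simp [Polynomial.coeff_zero_eq_eval_zero]

/-- `f` is holomorphic at the finite point `a`. -/
def HolAt (a : ℂ) (f : RatFunc ℂ) : Prop := VanishesTo 0 (expAt a f)

/-- Holomorphy in terms of expansions and in terms of the reduced denominator agree. -/
theorem holAt_iff (a : ℂ) (f : RatFunc ℂ) : HolAt a f ↔ f.denom.eval a ≠ 0 := by
  constructor
  · intro h h0
    have h1 : f.num.eval₂ C (C a + single 1 1 : LaurentSeries ℂ)
        = expAt a f * f.denom.eval₂ C (C a + single 1 1 : LaurentSeries ℂ) := by
      rw [expAt_eq_div, div_mul_cancel₀ _ (eval₂_at_ne_zero a f.denom_ne_zero)]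
    have h2 : f.num.eval a = 0 := by
      rw [← coeff_zero_eval₂_at, h1,
        VanishesTo.coeff_mul_low h (vanishesTo_eval₂_at a f.denom) (zero_add 0).symm,
        coeff_zero_eval₂_at, h0, mul_zero]
    obtain ⟨u, v, huv⟩ := f.isCoprime_num_denom
    have := congrArg (Polynomial.eval a) huv
    simp [h2, h0] at this
  · intro h
    exact (vanishesTo_eval₂_at a f.num).div (vanishesTo_eval₂_at a f.denom)
      (by rwa [coeff_zero_eval₂_at])

theorem HolAt.eval_eq {a : ℂ} {f : RatFunc ℂ} (h : HolAt a f) :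
    f.eval (RingHom.id ℂ) a = (expAt a f).coeff 0 := by
  have h0 := (holAt_iff a f).1 h
  have h1 : f.num.eval₂ C (C a + single 1 1 : LaurentSeries ℂ)
      = expAt a f * f.denom.eval₂ C (C a + single 1 1 : LaurentSeries ℂ) := by
    rw [expAt_eq_div, div_mul_cancel₀ _ (eval₂_at_ne_zero a f.denom_ne_zero)]
  have h2 : f.num.eval a = (expAt a f).coeff 0 * f.denom.eval a := by
    rw [← coeff_zero_eval₂_at, h1,
        VanishesTo.coeff_mul_low h (vanishesTo_eval₂_at a f.denom) (zero_add 0).symm,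
        coeff_zero_eval₂_at]
  rw [RatFunc.eval]
  change f.num.eval a / f.denom.eval a = _
  rw [h2, mul_div_cancel_right₀ _ h0]

namespace HolAt

variable {a : ℂ} {f g : RatFunc ℂ}

theorem zero : HolAt a 0 := by rw [HolAt, expAt_zero]; exact .zero 0
theorem add (hf : HolAt a f) (hg : HolAt a g) : HolAt a (f + g) := by
  rw [HolAt, expAt_add]; exact VanishesTo.add hf hg
theorem sub (hf : HolAt a f) (hg : HolAt a g) : HolAt a (f - g) := by
  rw [HolAt, expAt_sub]; exact VanishesTo.sub hf hg
theorem neg (hf : HolAt a f) : HolAt a (-f) := by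
  rw [HolAt, expAt_neg]; exact VanishesTo.neg hf
theorem mul (hf : HolAt a f) (hg : HolAt a g) : HolAt a (f * g) := by
  rw [HolAt, expAt_mul]; exact VanishesTo.mul' hf hg (by simp)
theorem pow (hf : HolAt a f) (n : ℕ) : HolAt a (f ^ n) := by
  rw [HolAt, expAt_pow]; exact (VanishesTo.pow hf n).mono (by simp)
theorem C (c : ℂ) : HolAt a (RatFunc.C c) := by rw [HolAt, expAt_C]; exact .C c
theorem lam : HolAt a lam := by
  rw [HolAt, expAt_lam]; exact .add (.C a) ((VanishesTo.single 1 1).mono (by simp))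
theorem sum {ι : Type*} {s : Finset ι} {f : ι → RatFunc ℂ} (h : ∀ i ∈ s, HolAt a (f i)) :
    HolAt a (∑ i ∈ s, f i) := by
  rw [HolAt, expAt_sum]; exact .sum h
theorem inv (hf : HolAt a f) (h : (expAt a f).coeff 0 ≠ 0) : HolAt a f⁻¹ := by
  rw [HolAt, expAt_inv, inv_eq_one_div]
  exact VanishesTo.one.div' hf h (by simp)

end HolAt

theorem expAt_lam_sub (a x : ℂ) :
    expAt a (lam - RatFunc.C x) = C (a - x) + single 1 1 := by
  rw [expAt_sub, expAt_lam, expAt_C, map_sub (C : ℂ →+* LaurentSeries ℂ)]; ring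

theorem expAt_lam_sub_self (a : ℂ) : expAt a (lam - RatFunc.C a) = single 1 1 := by
  rw [expAt_lam_sub, sub_self, C.map_zero, zero_add]

theorem coeff_zero_expAt_lam_sub (a x : ℂ) : (expAt a (lam - RatFunc.C x)).coeff 0 = a - x := by
  rw [expAt_lam_sub, coeff_add]; simp

theorem holAt_lam_sub (a x : ℂ) : HolAt a (lam - RatFunc.C x) := HolAt.lam.sub (.C x)

theorem holAt_pw {a x : ℂ} (h : a ≠ x) (k : ℕ) : HolAt a ((lam - RatFunc.C x) ^ k)⁻¹ := by
  rw [← inv_pow]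
  exact ((holAt_lam_sub a x).inv (by rw [coeff_zero_expAt_lam_sub]; exact sub_ne_zero.2 h)).pow k

theorem expAt_pw_self (a : ℂ) (k : ℕ) :
    expAt a ((lam - RatFunc.C a) ^ k)⁻¹ = single (-(k : ℤ)) 1 := by
  rw [expAt_inv, expAt_pow, expAt_lam_sub_self, single_pow, inv_single]
  simp

theorem expInf_lam_pow (k : ℕ) : expInf (lam ^ k) = single (-(k : ℤ)) 1 := by
  rw [expInf_pow, expInf_lam, single_pow]; simp

theorem expInf_lam_sub (x : ℂ) : expInf (lam - RatFunc.C x) = single (-1) 1 - C x := by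
  rw [expInf_sub, expInf_lam, expInf_C]

theorem vanishesTo_expInf_lam_sub (x : ℂ) : VanishesTo (-1) (expInf (lam - RatFunc.C x)) := by
  rw [expInf_lam_sub]; exact (VanishesTo.single _ _).sub ((VanishesTo.C x).mono (by simp))

theorem coeff_expInf_lam_sub (x : ℂ) : (expInf (lam - RatFunc.C x)).coeff (-1) = 1 := by
  rw [expInf_lam_sub, coeff_sub, C_apply, coeff_single_same, coeff_single_of_ne (by simp), sub_zero]

theorem lam_sub_ne_zero (x : ℂ) : lam - RatFunc.C x ≠ 0 := by
  intro h
  have := coeff_expInf_lam_sub x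
  rw [h, expInf_zero] at this
  simp at this

theorem vanishesTo_expInf_pw (x : ℂ) (k : ℕ) :
    VanishesTo k (expInf ((lam - RatFunc.C x) ^ k)⁻¹) := by
  rw [← inv_pow, expInf_pow, expInf_inv, inv_eq_one_div]
  exact ((VanishesTo.one.div (vanishesTo_expInf_lam_sub x)
    (by rw [coeff_expInf_lam_sub]; simp)).pow k).mono (by simp)

/-- A rational function without poles which vanishes at infinity is zero. -/
theorem eq_zero_of_holAt {f : RatFunc ℂ} (h : ∀ a, HolAt a f) (hinf : VanishesTo 1 (expInf f)) :
    f = 0 := by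
  have hd : f.denom.degree = 0 := by
    by_contra h0
    obtain ⟨a, ha⟩ := IsAlgClosed.exists_root f.denom h0
    exact (holAt_iff a f).1 (h a) ha
  have hd1 : f.denom = 1 := by
    rw [Polynomial.eq_C_of_degree_eq_zero hd]
    have := f.monic_denom
    rw [Polynomial.eq_C_of_degree_eq_zero hd, Polynomial.Monic, Polynomial.leadingCoeff_C] at this
    rw [this, map_one]
  have hn : f.num = 0 := by
    ext k
    rw [← coeff_eval₂_inf]
    have := hinf (-(k : ℤ)) (by omega)
    rw [expInf_eq_div, hd1, Polynomial.eval₂_one, div_one] at this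
    simpa using this
  exact RatFunc.num_eq_zero_iff.1 hn

/-- Two rational functions agree if their difference has no poles and vanishes at infinity. -/
theorem eq_of_holAt_sub {f g : RatFunc ℂ} (h : ∀ a, HolAt a (f - g))
    (hinf : VanishesTo 1 (expInf f - expInf g)) : f = g :=
  sub_eq_zero.1 (eq_zero_of_holAt h (by rwa [expInf_sub]))

/-! ### Singular and polynomial parts -/

theorem vanishesTo_order (x : LaurentSeries ℂ) : VanishesTo x.order x :=
  fun _ hk => coeff_eq_zero_of_lt_order hk

theorem coeff_sum_single_neg (s : Finset ℕ) (c : ℕ → ℂ) (j : ℤ) :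
    (∑ k ∈ s, C (c k) * single (-(k : ℤ)) (1 : ℂ) : LaurentSeries ℂ).coeff j
      = if 0 ≤ -j ∧ (-j).toNat ∈ s then c (-j).toNat else 0 := by
  simp only [coeff_sum, coeff_C_mul', coeff_single]
  split_ifs with h
  · rw [Finset.sum_eq_single (-j).toNat]
    · rw [if_pos (by omega), mul_one]
    · intro b _ hb
      rw [if_neg (by omega), mul_zero]
    · exact fun h' => absurd h.2 h'
  · refine Finset.sum_eq_zero fun b hb => ?_
    rw [if_neg, mul_zero]
    rintro rfl
    exact h ⟨by omega, by simpa using hb⟩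

theorem coeff_singPart_neg (a : ℂ) (f : RatFunc ℂ) {j : ℤ} (hj : j < 0) :
    (expAt a (singPart a f)).coeff j = (expAt a f).coeff j := by
  rw [singPart, expAt_sum]
  simp only [expAt_mul, expAt_C, expAt_pw_self]
  rw [coeff_sum_single_neg]
  split_ifs with h
  · congr 1; omega
  · rw [vanishesTo_order _ j]
    rw [Finset.mem_Icc] at h
    omega

theorem holAt_sub_singPart (a : ℂ) (f : RatFunc ℂ) : HolAt a (f - singPart a f) := by
  intro j hj
  rw [expAt_sub, coeff_sub, coeff_singPart_neg a f hj, sub_self]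

theorem holAt_singPart {a b : ℂ} (h : b ≠ a) (f : RatFunc ℂ) : HolAt b (singPart a f) :=
  .sum fun k _ => (HolAt.C _).mul (holAt_pw h k)

theorem vanishesTo_expInf_singPart (a : ℂ) (f : RatFunc ℂ) :
    VanishesTo 1 (expInf (singPart a f)) := by
  rw [singPart, expInf_sum]
  refine .sum fun k hk => ?_
  rw [expInf_mul, expInf_C]
  rw [Finset.mem_Icc] at hk
  exact (VanishesTo.C _).mul' (vanishesTo_expInf_pw a k) (by omega)

theorem holAt_polyPart (a : ℂ) (f : RatFunc ℂ) : HolAt a (polyPart f) :=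
  .sum fun k _ => (HolAt.C _).mul (HolAt.lam.pow k)

theorem vanishesTo_expInf_sub_polyPart (f : RatFunc ℂ) :
    VanishesTo 1 (expInf f - expInf (polyPart f)) := by
  intro j hj
  rw [coeff_sub, polyPart, expInf_sum]
  simp only [expInf_mul, expInf_C, expInf_lam_pow]
  rw [coeff_sum_single_neg, sub_eq_zero]
  split_ifs with h
  · congr 1; omega
  · rw [vanishesTo_order _ j]
    rw [Finset.mem_range] at h
    omega

end GeoLax

namespace GeoLax

/-! ### The deformation operator as a derivation -/

section Deform

variable {D : Setting} {U : Set (Times D)} {α : Times D → Times D} {τ : Times D}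

/-- Moving a parameter along which some tangent vector has a nonzero component keeps the trivial
times fixed. -/
theorem normalized_update {v : Times D} (hτ : Normalized τ) (hv : Tangent v) {i : TimeIdx D}
    (hi : v i ≠ 0) (x : ℂ) : Normalized (Function.update τ i x) := by
  obtain ⟨h1, h2, h3, h4⟩ := hτ
  obtain ⟨v1, v2, v3, v4⟩ := hv
  have hinf : ∀ k, infComp v k = 0 → infComp (Function.update τ i x) k = infComp τ k := by
    intro k hk
    unfold infComp at hk ⊢
    split_ifs at hk ⊢ with hc
    · rw [Function.update_of_ne]
      rintro rfl
      exact hi hk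
    · rfl
  have hpole : ∀ s k, poleComp v s k = 0 →
      poleComp (Function.update τ i x) s k = poleComp τ s k := by
    intro s k hk
    unfold poleComp at hk ⊢
    split_ifs at hk ⊢ with hc
    · rw [Function.update_of_ne]
      rintro rfl
      exact hi hk
    · rfl
  have hpos : ∀ s, posComp v s = 0 → posComp (Function.update τ i x) s = posComp τ s := by
    intro s hk
    unfold posComp at hk ⊢
    rw [Function.update_of_ne]
    rintro rfl
    exact hi hk
  have htinf : ∀ k, infComp v k = 0 → tInf (Function.update τ i x) k = tInf τ k := by
    intro k hk
    unfold tInf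
    rw [hinf k hk]
  have htX : ∀ s k, poleComp v s k = 0 → tX (Function.update τ i x) s k = tX τ s k := by
    intro s k hk
    unfold tX
    rw [hpole s k hk]
  refine ⟨fun h => ?_, fun h => ?_, fun h h' s => ?_, fun h h' s => ?_⟩
  · rw [htinf _ (v1 h).1, htinf _ (v1 h).2]
    exact h1 h
  · rw [htinf _ (v2 h).1]
    refine ⟨(h2 h).1, fun s hs => ?_⟩
    rw [hpos s ((v2 h).2 s hs)]
    exact (h2 h).2 s hs
  · have h5 := h3 h h' s
    refine ⟨fun hs => ?_, fun hs => ?_⟩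
    · rw [hpos s (v3 h h' s (by omega))]; exact h5.1 hs
    · rw [hpos s (v3 h h' s (by omega))]; exact h5.2 hs
  · rw [hpos s (v4 h h' s).1, htX s _ (v4 h h' s).2]
    exact h4 h h' s

/-- A partial derivative occurring in `𝓛_α` with a nonzero coefficient stays inside the domain. -/
theorem eventually_update_mem_domain (hU : IsOpen U) (hτ : τ ∈ domain U) {v : Times D}
    (hv : Tangent v) {i : TimeIdx D} (hi : v i ≠ 0) :
    ∀ᶠ x in nhds (τ i), Function.update τ i x ∈ domain U := by
  have hc : Filter.Tendsto (fun x => Function.update τ i x) (nhds (τ i)) (nhds τ) := by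
    have : Continuous fun x => Function.update τ i x := continuous_const.update i continuous_id
    simpa using this.tendsto (τ i)
  filter_upwards [hc (hU.mem_nhds hτ.1)] with x hx
  exact ⟨hx, normalized_update hτ.2 hv hi x⟩

theorem differentiableAt_update (hU : IsOpen U) (hτ : τ ∈ domain U) {v : Times D}
    (hv : Tangent v) {i : TimeIdx D} (hi : v i ≠ 0) {f : Times D → ℂ}
    (hf : DifferentiableOn ℂ f (domain U)) :
    DifferentiableAt ℂ (fun x => f (Function.update τ i x)) (τ i) := by
  have h1 : DifferentiableWithinAt ℂ f (domain U) (Function.update τ i (τ i)) := by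
    simpa using hf τ hτ
  have h2 : DifferentiableAt ℂ (fun x => Function.update τ i x) (τ i) :=
    (hasDerivAt_update τ i (τ i)).differentiableAt
  exact (DifferentiableWithinAt.comp (g := f) (f := fun x => Function.update τ i x) (τ i) h1
    (s := {x | Function.update τ i x ∈ domain U}) h2.differentiableWithinAt
    (fun _ hx => hx)).differentiableAt (eventually_update_mem_domain hU hτ hv hi)

theorem deform_congr (hU : IsOpen U) (hτ : τ ∈ domain U) (hα : Tangent (α τ)) {f g : Times D → ℂ}
    (h : ∀ τ' ∈ domain U, f τ' = g τ') : deform α f τ = deform α g τ := by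
  refine Finset.sum_congr rfl fun i _ => ?_
  by_cases hi : α τ i = 0
  · rw [hi, zero_mul, zero_mul]
  · congr 1
    apply Filter.EventuallyEq.deriv_eq
    filter_upwards [eventually_update_mem_domain hU hτ hα hi] with x hx
    exact h _ hx

theorem deform_const (c : ℂ) : deform α (fun _ => c) τ = 0 := by
  simp [deform]

/-- The Leibniz rule. The summands of `𝓛_α` with vanishing coefficient, in whose direction nothing
is known to be differentiable, do not matter. -/
theorem deform_mul (hU : IsOpen U) (hτ : τ ∈ domain U) (hα : Tangent (α τ)) {f g : Times D → ℂ}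
    (hf : DifferentiableOn ℂ f (domain U)) (hg : DifferentiableOn ℂ g (domain U)) :
    deform α (fun τ' => f τ' * g τ') τ = deform α f τ * g τ + f τ * deform α g τ := by
  unfold deform
  rw [Finset.sum_mul, Finset.mul_sum, ← Finset.sum_add_distrib]
  refine Finset.sum_congr rfl fun i _ => ?_
  by_cases hi : α τ i = 0
  · simp [hi]
  · rw [deriv_fun_mul (differentiableAt_update hU hτ hα hi hf)
      (differentiableAt_update hU hτ hα hi hg), Function.update_eq_self]
    ring

theorem deform_const_mul (hU : IsOpen U) (hτ : τ ∈ domain U) (hα : Tangent (α τ)) (c : ℂ)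
    {f : Times D → ℂ} (hf : DifferentiableOn ℂ f (domain U)) :
    deform α (fun τ' => c * f τ') τ = c * deform α f τ := by
  rw [deform_mul hU hτ hα (differentiableOn_const c) hf, deform_const, zero_mul, zero_add]

theorem deform_sub (hU : IsOpen U) (hτ : τ ∈ domain U) (hα : Tangent (α τ)) {f g : Times D → ℂ}
    (hf : DifferentiableOn ℂ f (domain U)) (hg : DifferentiableOn ℂ g (domain U)) :
    deform α (fun τ' => f τ' - g τ') τ = deform α f τ - deform α g τ := by
  unfold deform
  rw [← Finset.sum_sub_distrib]
  refine Finset.sum_congr rfl fun i _ => ?_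
  by_cases hi : α τ i = 0
  · simp [hi]
  · rw [deriv_fun_sub (differentiableAt_update hU hτ hα hi hf)
      (differentiableAt_update hU hτ hα hi hg)]
    ring

theorem deform_sum (hU : IsOpen U) (hτ : τ ∈ domain U) (hα : Tangent (α τ)) {ι : Type*}
    (s : Finset ι) {f : ι → Times D → ℂ} (hf : ∀ i ∈ s, DifferentiableOn ℂ (f i) (domain U)) :
    deform α (fun τ' => ∑ i ∈ s, f i τ') τ = ∑ i ∈ s, deform α (f i) τ := by
  unfold deform
  rw [Finset.sum_comm]
  refine Finset.sum_congr rfl fun i _ => ?_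
  by_cases hi : α τ i = 0
  · simp [hi]
  · rw [deriv_fun_sum fun j hj => differentiableAt_update hU hτ hα hi (hf j hj), Finset.mul_sum]

/-- The Leibniz rule for power series, coefficient by coefficient. -/
theorem deform_coeff_mul (hU : IsOpen U) (hτ : τ ∈ domain U) (hα : Tangent (α τ))
    {P Q : Times D → PowerSeries ℂ}
    (hP : ∀ k, DifferentiableOn ℂ (fun τ' => (P τ').coeff k) (domain U))
    (hQ : ∀ k, DifferentiableOn ℂ (fun τ' => (Q τ').coeff k) (domain U)) (k : ℕ) :
    deform α (fun τ' => (P τ' * Q τ').coeff k) τ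
      = ((PowerSeries.mk fun k => deform α (fun τ' => (P τ').coeff k) τ) * Q τ
          + P τ * PowerSeries.mk fun k => deform α (fun τ' => (Q τ').coeff k) τ).coeff k := by
  simp only [PowerSeries.coeff_mul]
  rw [deform_sum hU hτ hα _ fun p _ => (hP p.1).mul (hQ p.2), map_add, PowerSeries.coeff_mul,
    PowerSeries.coeff_mul, ← Finset.sum_add_distrib]
  refine Finset.sum_congr rfl fun p _ => ?_
  rw [deform_mul hU hτ hα (hP p.1) (hQ p.2), PowerSeries.coeff_mk, PowerSeries.coeff_mk]

theorem differentiableOn_coeff_mul {S : Set (Times D)} {P Q : Times D → PowerSeries ℂ}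
    (hP : ∀ k, DifferentiableOn ℂ (fun τ' => (P τ').coeff k) S)
    (hQ : ∀ k, DifferentiableOn ℂ (fun τ' => (Q τ').coeff k) S) (k : ℕ) :
    DifferentiableOn ℂ (fun τ' => (P τ' * Q τ').coeff k) S := by
  simp only [PowerSeries.coeff_mul]
  exact DifferentiableOn.fun_sum fun p _ => (hP p.1).mul (hQ p.2)

/-- `𝓛_α` of the identity `det F = 1`. -/
theorem deformSeries_det (hU : IsOpen U) (hτ : τ ∈ domain U) (hα : Tangent (α τ))
    {F : Times D → Matrix (Fin 2) (Fin 2) (PowerSeries ℂ)} (hF : IsGauge (domain U) F) :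
    deformSeries α F τ 0 0 * F τ 1 1 + F τ 0 0 * deformSeries α F τ 1 1
      - (deformSeries α F τ 0 1 * F τ 1 0 + F τ 0 1 * deformSeries α F τ 1 0) = 0 := by
  ext k
  have h1 := deform_congr (α := α) hU hτ hα
    (f := fun τ' => (F τ' 0 0 * F τ' 1 1).coeff k - (F τ' 0 1 * F τ' 1 0).coeff k)
    (g := fun _ => (1 : PowerSeries ℂ).coeff k) fun τ' hτ' => by
      rw [← hF.2 τ' hτ', Matrix.det_fin_two, map_sub]
  rw [deform_const, deform_sub hU hτ hα (differentiableOn_coeff_mul (hF.1 0 0) (hF.1 1 1) k)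
    (differentiableOn_coeff_mul (hF.1 0 1) (hF.1 1 0) k),
    deform_coeff_mul hU hτ hα (hF.1 0 0) (hF.1 1 1),
    deform_coeff_mul hU hτ hα (hF.1 0 1) (hF.1 1 0), ← map_sub] at h1
  rw [map_zero, ← h1]
  rfl

end Deform

/-! ### Matrices gauge equivalent to a diagonal one -/

section Conjugation

variable {K : Type*} [Field K] {M F G : Matrix (Fin 2) (Fin 2) K} {T : K}

/-- If `M F = G + T F σ₃` with `det F = 1`, then `M = G F⁻¹ + T F σ₃ F⁻¹`; entry by entry. -/
theorem entries_of_mul_eq (hF : F 0 0 * F 1 1 - F 0 1 * F 1 0 = 1)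
    (h : M * F = G + T • (F * !![1, 0; 0, -1])) :
    M 0 0 = G 0 0 * F 1 1 - G 0 1 * F 1 0 + T * (1 + 2 * (F 0 1 * F 1 0)) ∧
    M 0 1 = G 0 1 * F 0 0 - G 0 0 * F 0 1 - T * (2 * (F 0 0 * F 0 1)) ∧
    M 1 0 = G 1 0 * F 1 1 - G 1 1 * F 1 0 + T * (2 * (F 1 0 * F 1 1)) ∧
    M 1 1 = G 1 1 * F 0 0 - G 1 0 * F 0 1 - T * (1 + 2 * (F 0 1 * F 1 0)) := by
  have e00 : M 0 0 * F 0 0 + M 0 1 * F 1 0 = G 0 0 + T * F 0 0 := by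
    simpa [Matrix.mul_apply, Fin.sum_univ_two] using congrFun (congrFun h 0) 0
  have e01 : M 0 0 * F 0 1 + M 0 1 * F 1 1 = G 0 1 - T * F 0 1 := by
    simpa [Matrix.mul_apply, Fin.sum_univ_two, sub_eq_add_neg] using congrFun (congrFun h 0) 1
  have e10 : M 1 0 * F 0 0 + M 1 1 * F 1 0 = G 1 0 + T * F 1 0 := by
    simpa [Matrix.mul_apply, Fin.sum_univ_two] using congrFun (congrFun h 1) 0
  have e11 : M 1 0 * F 0 1 + M 1 1 * F 1 1 = G 1 1 - T * F 1 1 := by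
    simpa [Matrix.mul_apply, Fin.sum_univ_two, sub_eq_add_neg] using congrFun (congrFun h 1) 1
  refine ⟨?_, ?_, ?_, ?_⟩
  · linear_combination F 1 1 * e00 - F 1 0 * e01 + (T - M 0 0) * hF
  · linear_combination F 0 0 * e01 - F 0 1 * e00 - M 0 1 * hF
  · linear_combination F 1 1 * e10 - F 1 0 * e11 - M 1 0 * hF
  · linear_combination F 0 0 * e11 - F 0 1 * e10 + (-T - M 1 1) * hF

/-- For `M = G F⁻¹ + T F σ₃ F⁻¹` the combination `M₁₁² + M₁₂ M₂₁`, which is `-det M` when `M` is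
traceless, differs from `T²` by a term without `T` and a term linear in `T`. -/
theorem sq_add_mul_sub_sq (hF : F 0 0 * F 1 1 - F 0 1 * F 1 0 = 1)
    (h : M * F = G + T • (F * !![1, 0; 0, -1])) :
    M 0 0 ^ 2 + M 0 1 * M 1 0 - T ^ 2
      = ((G 0 0 * F 1 1 - G 0 1 * F 1 0) * (G 0 0 * F 1 1 - G 0 1 * F 1 0)
          + (G 0 1 * F 0 0 - G 0 0 * F 0 1) * (G 1 0 * F 1 1 - G 1 1 * F 1 0))
        + T * (2 * ((G 0 0 * F 1 1 - G 0 1 * F 1 0) * (1 + 2 * (F 0 1 * F 1 0)))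
          + (G 0 1 * F 0 0 - G 0 0 * F 0 1) * (2 * (F 1 0 * F 1 1))
          - (2 * (F 0 0 * F 0 1)) * (G 1 0 * F 1 1 - G 1 1 * F 1 0)) := by
  obtain ⟨m00, m01, m10, -⟩ := entries_of_mul_eq hF h
  rw [m00, m01, m10]
  linear_combination (-4 * T ^ 2 * F 0 1 * F 1 0) * hF

end Conjugation

theorem toLaurent_det {F : Matrix (Fin 2) (Fin 2) (PowerSeries ℂ)} (h : F.det = 1) :
    toLaurent F 0 0 * toLaurent F 1 1 - toLaurent F 0 1 * toLaurent F 1 0 = 1 := by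
  rw [Matrix.det_fin_two] at h
  simp only [toLaurent, Matrix.map_apply]
  rw [← PowerSeries.coe_mul, ← PowerSeries.coe_mul, ← PowerSeries.coe_sub, h, PowerSeries.coe_one]

theorem vanishesTo_toLaurent (F : Matrix (Fin 2) (Fin 2) (PowerSeries ℂ)) (i j : Fin 2) :
    VanishesTo 0 (toLaurent F i j) := vanishesTo_coe _

theorem VanishesTo.two_mul {n : ℤ} {x : LaurentSeries ℂ} (h : VanishesTo n x) :
    VanishesTo n (2 * x) := by rw [_root_.two_mul]; exact h.add h

/-! ### Local analysis at a finite pole -/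

section FinitePole

variable {M B F G K : Matrix (Fin 2) (Fin 2) (LaurentSeries ℂ)} {T S : LaurentSeries ℂ} {r : ℤ}

/-- Local analysis of a Lax pair `M = G F⁻¹ + T F σ₃ F⁻¹`, `B = K F⁻¹ + S F σ₃ F⁻¹` at a pole of
order `r ≥ 1`, where `F`, `G`, `K` are holomorphic and the upper right entry of `M` has a pole of
exact order `r`. With `ν = B₁₂ / M₁₂`, the upper right entries give `ν T ≡ S`, hence `B ≡ ν M`,
modulo holomorphic terms; and `-det M ≡ T²` modulo a pole of order `r`, since the cross term is
`T` times a holomorphic trace. -/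
theorem local_finite (hr : 1 ≤ r) (hdet : F 0 0 * F 1 1 - F 0 1 * F 1 0 = 1)
    (hF : ∀ i j, VanishesTo 0 (F i j)) (hG : ∀ i j, VanishesTo 0 (G i j))
    (hK : ∀ i j, VanishesTo 0 (K i j)) (hT : VanishesTo (-r) T) (hS : VanishesTo (-r) S)
    (hM : M * F = G + T • (F * sigma3)) (hB : B * F = K + S • (F * sigma3))
    (hb : (M 0 1).coeff (-r) ≠ 0) :
    (∀ i j, VanishesTo (-r) (M i j)) ∧ VanishesTo 0 (B 0 1 / M 0 1) ∧ T.coeff (-r) ≠ 0 ∧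
    VanishesTo 0 (B 0 1 / M 0 1 * T - S) ∧
    (∀ i j, VanishesTo 0 (B i j - B 0 1 / M 0 1 * M i j)) ∧
    VanishesTo (-r) (M 0 0 ^ 2 + M 0 1 * M 1 0 - T ^ 2) := by
  obtain ⟨m00, m01, m10, m11⟩ := entries_of_mul_eq hdet hM
  obtain ⟨b00, b01, b10, b11⟩ := entries_of_mul_eq hdet hB
  have hm0 : M 0 1 ≠ 0 := by intro h; rw [h] at hb; simp at hb
  have hol : ∀ {N : Matrix (Fin 2) (Fin 2) (LaurentSeries ℂ)}, (∀ i j, VanishesTo 0 (N i j)) →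
      ∀ i j k l p q u v, VanishesTo 0 (N i j * F k l - N p q * F u v) := fun hN i j k l p q u v =>
    ((hN i j).mul' (hF k l) (by simp)).sub ((hN p q).mul' (hF u v) (by simp))
  have h00 : VanishesTo 0 (1 + 2 * (F 0 1 * F 1 0)) :=
    VanishesTo.one.add ((hF 0 1).mul' (hF 1 0) (by simp)).two_mul
  have h01 : VanishesTo 0 (2 * (F 0 0 * F 0 1)) := ((hF 0 0).mul' (hF 0 1) (by simp)).two_mul
  have h10 : VanishesTo 0 (2 * (F 1 0 * F 1 1)) := ((hF 1 0).mul' (hF 1 1) (by simp)).two_mul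
  have hlead : (M 0 1).coeff (-r) = -(T.coeff (-r) * (2 * (F 0 0 * F 0 1)).coeff 0) := by
    rw [m01, coeff_sub, hol hG _ _ _ _ _ _ _ _ (-r) (by omega),
      hT.coeff_mul_low h01 (add_zero _).symm, zero_sub]
  have hT0 : T.coeff (-r) ≠ 0 := fun h => hb (by rw [hlead, h, zero_mul, neg_zero])
  have hh0 : (2 * (F 0 0 * F 0 1)).coeff 0 ≠ 0 := fun h => hb (by rw [hlead, h, mul_zero, neg_zero])
  have vM : ∀ i j, VanishesTo (-r) (M i j) := by
    intro i j
    fin_cases i <;> fin_cases j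
    · exact m00 ▸ ((hol hG _ _ _ _ _ _ _ _).mono (by omega)).add (hT.mul' h00 (by omega))
    · exact m01 ▸ ((hol hG _ _ _ _ _ _ _ _).mono (by omega)).sub (hT.mul' h01 (by omega))
    · exact m10 ▸ ((hol hG _ _ _ _ _ _ _ _).mono (by omega)).add (hT.mul' h10 (by omega))
    · exact m11 ▸ ((hol hG _ _ _ _ _ _ _ _).mono (by omega)).sub (hT.mul' h00 (by omega))
  have vB01 : VanishesTo (-r) (B 0 1) :=
    b01 ▸ ((hol hK _ _ _ _ _ _ _ _).mono (by omega)).sub (hS.mul' h01 (by omega))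
  have hν : VanishesTo 0 (B 0 1 / M 0 1) := vB01.div' (vM 0 1) hb (by omega)
  set ν := B 0 1 / M 0 1 with hνdef
  have hνM : ν * M 0 1 = B 0 1 := div_mul_cancel₀ _ hm0
  have hε : VanishesTo 0 (ν * T - S) := by
    have hh : (2 * (F 0 0 * F 0 1)) ≠ 0 := by intro h; rw [h] at hh0; simp at hh0
    have : ν * T - S = (ν * (G 0 1 * F 0 0 - G 0 0 * F 0 1) - (K 0 1 * F 0 0 - K 0 0 * F 0 1))
        / (2 * (F 0 0 * F 0 1)) := by
      rw [eq_div_iff hh]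
      linear_combination ν * m01 - b01 - hνM
    rw [this]
    exact ((hν.mul' (hol hG _ _ _ _ _ _ _ _) (by simp)).sub (hol hK _ _ _ _ _ _ _ _)).div' h01 hh0
      (by simp)
  refine ⟨vM, hν, hT0, hε, fun i j => ?_, ?_⟩
  · fin_cases i <;> fin_cases j
    · have : B 0 0 - ν * M 0 0 = (K 0 0 * F 1 1 - K 0 1 * F 1 0)
          - ν * (G 0 0 * F 1 1 - G 0 1 * F 1 0) - (ν * T - S) * (1 + 2 * (F 0 1 * F 1 0)) := by
        rw [b00, m00]; ring
      exact this ▸ ((hol hK _ _ _ _ _ _ _ _).sub (hν.mul' (hol hG _ _ _ _ _ _ _ _) (by simp))).sub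
        (hε.mul' h00 (by simp))
    · have : B 0 1 - ν * M 0 1 = 0 := by rw [hνM, sub_self]
      exact this ▸ .zero 0
    · have : B 1 0 - ν * M 1 0 = (K 1 0 * F 1 1 - K 1 1 * F 1 0)
          - ν * (G 1 0 * F 1 1 - G 1 1 * F 1 0) - (ν * T - S) * (2 * (F 1 0 * F 1 1)) := by
        rw [b10, m10]; ring
      exact this ▸ ((hol hK _ _ _ _ _ _ _ _).sub (hν.mul' (hol hG _ _ _ _ _ _ _ _) (by simp))).sub
        (hε.mul' h10 (by simp))
    · have : B 1 1 - ν * M 1 1 = (K 1 1 * F 0 0 - K 1 0 * F 0 1)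
          - ν * (G 1 1 * F 0 0 - G 1 0 * F 0 1) + (ν * T - S) * (1 + 2 * (F 0 1 * F 1 0)) := by
        rw [b11, m11]; ring
      exact this ▸ ((hol hK _ _ _ _ _ _ _ _).sub (hν.mul' (hol hG _ _ _ _ _ _ _ _) (by simp))).add
        (hε.mul' h00 (by simp))
  · rw [sq_add_mul_sub_sq hdet hM]
    have hw := hol hG
    refine VanishesTo.add (VanishesTo.mono (n := 0) ?_ (by omega)) (hT.mul' (m := 0) ?_ (by omega))
    · exact ((hw _ _ _ _ _ _ _ _).mul' (hw _ _ _ _ _ _ _ _) (by simp)).add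
        ((hw _ _ _ _ _ _ _ _).mul' (hw _ _ _ _ _ _ _ _) (by simp))
    · exact (((hw _ _ _ _ _ _ _ _).mul' h00 (by simp)).two_mul.add
        ((hw _ _ _ _ _ _ _ _).mul' h10 (by simp))).sub
        (h01.mul' (hw _ _ _ _ _ _ _ _) (by simp))

end FinitePole

end GeoLax

namespace GeoLax

/-! ### Local analysis at infinity -/

section Infinity

variable {M B F G K : Matrix (Fin 2) (Fin 2) (LaurentSeries ℂ)} {T S : LaurentSeries ℂ} {r : ℤ}
  {t w : ℂ}

/-- If the leading coefficient at infinity is diagonal with distinct entries, then so is the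
leading coefficient of the gauge matrix. -/
theorem gauge_offdiag_eq_zero (hr : 1 ≤ r) (ht : t ≠ 0)
    (hF : ∀ i j, VanishesTo 0 (F i j)) (hG : ∀ i j, VanishesTo 2 (G i j))
    (hT : VanishesTo (2 - r) T) (hTt : T.coeff (2 - r) = -t)
    (hM : M * F = G + T • (F * sigma3))
    (h00 : VanishesTo (2 - r) (M 0 0)) (h00t : (M 0 0).coeff (2 - r) = -t)
    (h11 : VanishesTo (2 - r) (M 1 1)) (h11t : (M 1 1).coeff (2 - r) = t)
    (h01 : VanishesTo (3 - r) (M 0 1)) (h10 : VanishesTo (3 - r) (M 1 0)) :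
    VanishesTo 1 (F 0 1) ∧ VanishesTo 1 (F 1 0) := by
  have e01 : M 0 0 * F 0 1 + M 0 1 * F 1 1 = G 0 1 - T * F 0 1 := by
    have := congrFun (congrFun hM 0) 1
    simp [Matrix.mul_apply, Fin.sum_univ_two, sigma3] at this
    rw [this]; ring
  have e10 : M 1 0 * F 0 0 + M 1 1 * F 1 0 = G 1 0 + T * F 1 0 := by
    simpa [Matrix.mul_apply, Fin.sum_univ_two, sigma3] using congrFun (congrFun hM 1) 0
  have k01 := congrArg (fun x => x.coeff (2 - r)) e01
  have k10 := congrArg (fun x => x.coeff (2 - r)) e10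
  simp only [coeff_add, coeff_sub] at k01 k10
  rw [h00.coeff_mul_low (hF 0 1) (add_zero _).symm, (h01.mul (hF 1 1)) (2 - r) (by omega),
    hG 0 1 (2 - r) (by omega), hT.coeff_mul_low (hF 0 1) (add_zero _).symm, h00t, hTt] at k01
  rw [h11.coeff_mul_low (hF 1 0) (add_zero _).symm, (h10.mul (hF 0 0)) (2 - r) (by omega),
    hG 1 0 (2 - r) (by omega), hT.coeff_mul_low (hF 1 0) (add_zero _).symm, h11t, hTt] at k10
  have z01 : (F 0 1).coeff 0 = 0 := by
    have : t * (F 0 1).coeff 0 = 0 := by linear_combination (-1 / 2 : ℂ) * k01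
    exact (mul_eq_zero.1 this).resolve_left ht
  have z10 : (F 1 0).coeff 0 = 0 := by
    have : t * (F 1 0).coeff 0 = 0 := by linear_combination (1 / 2 : ℂ) * k10
    exact (mul_eq_zero.1 this).resolve_left ht
  constructor <;> intro k hk
  · rcases lt_or_ge k 0 with h | h
    · exact hF 0 1 k h
    · obtain rfl : k = 0 := by omega
      exact z01
  · rcases lt_or_ge k 0 with h | h
    · exact hF 1 0 k h
    · obtain rfl : k = 0 := by omega
      exact z10

theorem coeff_offdiag_mul {a b c d : LaurentSeries ℂ} (ha : VanishesTo 1 a) (hb : VanishesTo 0 b)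
    (hc : VanishesTo 0 c) (hd : VanishesTo 1 d) :
    VanishesTo 1 (a * b - c * d) ∧
      (a * b - c * d).coeff 1 = a.coeff 1 * b.coeff 0 - c.coeff 0 * d.coeff 1 :=
  ⟨(ha.mul' hb (by simp)).sub (hc.mul' hd (by simp)), by
    rw [coeff_sub, ha.coeff_mul_low hb (by simp), hc.coeff_mul_low hd (by simp)]⟩

/-- The expansion of the Lax matrix at infinity up to the orders that matter. The relation for the
upper right entry expresses its leading coefficient `w` by the gauge matrix; for `r = 1` the
derivative of the gauge matrix contributes. -/
theorem lax_expansion_inf (hr : 1 ≤ r) (hdet : F 0 0 * F 1 1 - F 0 1 * F 1 0 = 1)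
    (hF : ∀ i j, VanishesTo 0 (F i j)) (hF01 : VanishesTo 1 (F 0 1)) (hF10 : VanishesTo 1 (F 1 0))
    (hG : ∀ i j, VanishesTo 2 (G i j)) (hG01 : (G 0 1).coeff 2 = -(F 0 1).coeff 1)
    (hT : VanishesTo (2 - r) T) (hTt : T.coeff (2 - r) = -t)
    (hM : M * F = G + T • (F * sigma3)) :
    (2 ≤ r → VanishesTo (4 - r) (M 0 0 - T)) ∧
    (3 ≤ r → VanishesTo (4 - r) (M 0 0 ^ 2 + M 0 1 * M 1 0 - T ^ 2)) ∧
    (M 0 1).coeff (3 - r)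
      = (2 * t - if r = 1 then 1 else 0) * ((F 0 0).coeff 0 * (F 0 1).coeff 1) := by
  obtain ⟨m00, m01, m10, m11⟩ := entries_of_mul_eq hdet hM
  have hol : ∀ i j k l p q u v, VanishesTo 2 (G i j * F k l - G p q * F u v) :=
    fun i j k l p q u v =>
      ((hG i j).mul' (hF k l) (by simp)).sub ((hG p q).mul' (hF u v) (by simp))
  have h00 : VanishesTo 2 (2 * (F 0 1 * F 1 0)) := (hF01.mul' hF10 (by norm_num)).two_mul
  have h00' : VanishesTo 0 (1 + 2 * (F 0 1 * F 1 0)) := VanishesTo.one.add (h00.mono (by norm_num))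
  have h01 : VanishesTo 1 (2 * (F 0 0 * F 0 1)) := ((hF 0 0).mul' hF01 (by simp)).two_mul
  have h10 : VanishesTo 1 (2 * (F 1 0 * F 1 1)) := (hF10.mul' (hF 1 1) (by simp)).two_mul
  have c01 : (2 * (F 0 0 * F 0 1)).coeff 1 = 2 * ((F 0 0).coeff 0 * (F 0 1).coeff 1) := by
    rw [_root_.two_mul, coeff_add, (hF 0 0).coeff_mul_low hF01 (by simp)]
    ring
  refine ⟨fun h => ?_, fun h => ?_, ?_⟩
  · have : M 0 0 - T = G 0 0 * F 1 1 - G 0 1 * F 1 0 + T * (2 * (F 0 1 * F 1 0)) := by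
      rw [m00]; ring
    exact this ▸ ((hol _ _ _ _ _ _ _ _).mono (by omega)).add (hT.mul' h00 (by omega))
  · rw [sq_add_mul_sub_sq hdet hM]
    refine VanishesTo.add (VanishesTo.mono (n := 2 + 2) ?_ (by omega))
      (hT.mul' (m := 2) ?_ (by omega))
    · exact ((hol _ _ _ _ _ _ _ _).mul (hol _ _ _ _ _ _ _ _)).add
        ((hol _ _ _ _ _ _ _ _).mul (hol _ _ _ _ _ _ _ _))
    · exact (((hol _ _ _ _ _ _ _ _).mul' h00' (by simp)).two_mul.add
        ((hol _ _ _ _ _ _ _ _).mul' h10 (by norm_num))).sub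
        (h01.mul' (hol _ _ _ _ _ _ _ _) (by norm_num))
  · rw [m01, coeff_sub, hT.coeff_mul_low h01 (by ring), hTt, c01]
    split_ifs with h
    · rw [h, coeff_sub, (hG 0 1).coeff_mul_low (hF 0 0) (by norm_num),
        ((hG 0 0).mul hF01) _ (by norm_num), hG01]
      ring
    · rw [hol _ _ _ _ _ _ _ _ _ (by omega)]
      ring

/-- The auxiliary matrix near infinity. With `ν = B₁₂ / M₁₂`, the matrix `B - ν M` is holomorphic
with diagonal constant term, which the normalization `w` and its derivative `dw` determine. For
`r = 1` the matrix `B` itself is holomorphic, and its constant term involves the leading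
coefficient of `ν`. -/
theorem auxiliary_expansion_inf (hr : 1 ≤ r) (hdet : F 0 0 * F 1 1 - F 0 1 * F 1 0 = 1)
    (hF : ∀ i j, VanishesTo 0 (F i j)) (hF01 : VanishesTo 1 (F 0 1)) (hF10 : VanishesTo 1 (F 1 0))
    (hG : ∀ i j, VanishesTo 2 (G i j))
    (hK : ∀ i j, VanishesTo 0 (K i j)) (hK01 : VanishesTo 1 (K 0 1)) (hK10 : VanishesTo 1 (K 1 0))
    (hS : VanishesTo (3 - r) S) (hS0 : r ≤ 3 → S = 0)
    (hM : M * F = G + T • (F * sigma3)) (hB : B * F = K + S • (F * sigma3))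
    (hb : VanishesTo (3 - r) (M 0 1)) (hbw : (M 0 1).coeff (3 - r) = w) (hw : w ≠ 0)
    {κ dw : ℂ} (hκ : κ = 2 * t - if r = 1 then 1 else 0)
    (hwκ : w = κ * ((F 0 0).coeff 0 * (F 0 1).coeff 1))
    (hdw : dw = κ * ((K 0 0).coeff 0 * (F 0 1).coeff 1 + (F 0 0).coeff 0 * (K 0 1).coeff 1)) :
    (3 ≤ r → VanishesTo 1 (B 0 1 / M 0 1)) ∧ (r = 2 → VanishesTo 0 (B 0 1 / M 0 1)) ∧
    (r = 1 → VanishesTo (-1) (B 0 1 / M 0 1)) ∧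
    (2 ≤ r → VanishesTo 0 (B 0 1 / M 0 1 * T - S)) ∧
    (2 ≤ r → VanishesTo 1 (B 1 0 - B 0 1 / M 0 1 * M 1 0)) ∧
    (2 ≤ r → VanishesTo 0 (B 0 0 - B 0 1 / M 0 1 * M 0 0)) ∧
    (2 ≤ r → (B 0 0 - B 0 1 / M 0 1 * M 0 0).coeff 0 = dw / (2 * w)) ∧
    (r ≤ 2 → VanishesTo 1 (B 1 0)) ∧ (r = 1 → VanishesTo 0 (B 0 0)) ∧
    (r = 1 → (B 0 0).coeff 0 = dw / (2 * w) + (1 / 2 - t) * (B 0 1 / M 0 1).coeff (-1)) ∧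
    (r ≤ 3 → VanishesTo 1 (B 0 1)) := by
  obtain ⟨m00, m01, m10, m11⟩ := entries_of_mul_eq hdet hM
  obtain ⟨b00, b01, b10, b11⟩ := entries_of_mul_eq hdet hB
  have hb0 : (M 0 1).coeff (3 - r) ≠ 0 := by rwa [hbw]
  have hm0 : M 0 1 ≠ 0 := by intro h; rw [h] at hb0; simp at hb0
  have hol : ∀ i j k l p q u v, VanishesTo 2 (G i j * F k l - G p q * F u v) :=
    fun i j k l p q u v =>
      ((hG i j).mul' (hF k l) (by simp)).sub ((hG p q).mul' (hF u v) (by simp))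
  have h00 : VanishesTo 2 (2 * (F 0 1 * F 1 0)) := (hF01.mul' hF10 (by norm_num)).two_mul
  have h00' : VanishesTo 0 (1 + 2 * (F 0 1 * F 1 0)) := VanishesTo.one.add (h00.mono (by norm_num))
  have c00 : (1 + 2 * (F 0 1 * F 1 0)).coeff 0 = 1 := by
    rw [coeff_add, h00 0 (by norm_num)]; simp
  have h01 : VanishesTo 1 (2 * (F 0 0 * F 0 1)) := ((hF 0 0).mul' hF01 (by simp)).two_mul
  have h10 : VanishesTo 1 (2 * (F 1 0 * F 1 1)) := (hF10.mul' (hF 1 1) (by simp)).two_mul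
  have c01 : (2 * (F 0 0 * F 0 1)).coeff 1 = 2 * ((F 0 0).coeff 0 * (F 0 1).coeff 1) := by
    rw [_root_.two_mul, coeff_add, (hF 0 0).coeff_mul_low hF01 (by simp)]
    ring
  -- the four constants entering the leading coefficients
  have hff : (F 0 0).coeff 0 * (F 1 1).coeff 0 = 1 := by
    have := congrArg (fun x => x.coeff 0) hdet
    simp only [coeff_sub] at this
    rw [(hF 0 0).coeff_mul_low (hF 1 1) (by simp), (hF01.mul hF10) 0 (by norm_num)] at this
    simpa using this
  have hf : (F 0 0).coeff 0 ≠ 0 := left_ne_zero_of_mul_eq_one hff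
  have hκ0 : κ ≠ 0 := by rintro rfl; exact hw (by rw [hwκ, zero_mul])
  have hf12 : (F 0 1).coeff 1 ≠ 0 := by intro h; exact hw (by rw [hwκ, h]; ring)
  have hf11 : (F 1 1).coeff 0 = 1 / (F 0 0).coeff 0 := by field_simp; linear_combination hff
  obtain ⟨v01, v01c⟩ := coeff_offdiag_mul hK01 (hF 0 0) (hK 0 0) hF01
  have v10 := (coeff_offdiag_mul hK10 (hF 1 1) (hK 1 1) hF10).1
  have v00 : VanishesTo 0 (K 0 0 * F 1 1 - K 0 1 * F 1 0) :=
    ((hK 0 0).mul' (hF 1 1) (by simp)).sub ((hK 0 1).mul' (hF 1 0) (by simp))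
  have v00c : (K 0 0 * F 1 1 - K 0 1 * F 1 0).coeff 0 = (K 0 0).coeff 0 * (F 1 1).coeff 0 := by
    rw [coeff_sub, (hK 0 0).coeff_mul_low (hF 1 1) (by simp), (hK01.mul hF10) 0 (by norm_num),
      sub_zero]
  have vB01 : VanishesTo (min 1 (4 - r)) (B 0 1) :=
    b01 ▸ (v01.mono (min_le_left _ _)).sub (hS.mul' h01 (by omega))
  have vB01' : r ≤ 3 → VanishesTo 1 (B 0 1) := fun h => vB01.mono (by omega)
  have hν3 : 3 ≤ r → VanishesTo 1 (B 0 1 / M 0 1) := fun h => vB01.div' hb hb0 (by omega)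
  have hν2 : 2 ≤ r → VanishesTo 0 (B 0 1 / M 0 1) := fun h => vB01.div' hb hb0 (by omega)
  have hν1 : r = 1 → VanishesTo (-1) (B 0 1 / M 0 1) := fun h => vB01.div' hb hb0 (by omega)
  set ν := B 0 1 / M 0 1 with hνdef
  have hνM : ν * M 0 1 = B 0 1 := div_mul_cancel₀ _ hm0
  have hεeq : (ν * T - S) * (2 * (F 0 0 * F 0 1))
      = ν * (G 0 1 * F 0 0 - G 0 0 * F 0 1) - (K 0 1 * F 0 0 - K 0 0 * F 0 1) := by
    linear_combination ν * m01 - b01 - hνM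
  have hc0 : (2 * (F 0 0 * F 0 1)).coeff 1 ≠ 0 := by
    rw [c01]; exact mul_ne_zero two_ne_zero (mul_ne_zero hf hf12)
  have hε : 2 ≤ r → VanishesTo 0 (ν * T - S) := fun h => by
    have hh : (2 * (F 0 0 * F 0 1)) ≠ 0 := by intro h; rw [h] at hc0; simp at hc0
    rw [(eq_div_iff hh).2 hεeq]
    exact (((hν2 h).mul' (hol _ _ _ _ _ _ _ _) (by norm_num)).sub v01).div' h01 hc0 (by simp)
  have hεc : 2 ≤ r → (ν * T - S).coeff 0 * (2 * ((F 0 0).coeff 0 * (F 0 1).coeff 1))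
      = -((K 0 1).coeff 1 * (F 0 0).coeff 0 - (K 0 0).coeff 0 * (F 0 1).coeff 1) := fun h => by
    rw [← c01, ← (hε h).coeff_mul_low h01 (zero_add 1).symm, hεeq, coeff_sub, v01c,
      (hν2 h).mul (hol _ _ _ _ _ _ _ _) 1 (by norm_num), zero_sub]
  have e00 : B 0 0 - ν * M 0 0 = (K 0 0 * F 1 1 - K 0 1 * F 1 0)
      - ν * (G 0 0 * F 1 1 - G 0 1 * F 1 0) - (ν * T - S) * (1 + 2 * (F 0 1 * F 1 0)) := by
    rw [b00, m00]; ring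
  have e10 : B 1 0 - ν * M 1 0 = (K 1 0 * F 1 1 - K 1 1 * F 1 0)
      - ν * (G 1 0 * F 1 1 - G 1 1 * F 1 0) - (ν * T - S) * (2 * (F 1 0 * F 1 1)) := by
    rw [b10, m10]; ring
  refine ⟨hν3, fun h => hν2 h.ge, hν1, hε, fun h => ?_, fun h => ?_, fun h => ?_, fun h => ?_,
    fun h => ?_, fun h => ?_, vB01'⟩
  · exact e10 ▸ (v10.sub ((hν2 h).mul' (hol _ _ _ _ _ _ _ _) (by norm_num))).sub
      ((hε h).mul' h10 (by simp))
  · exact e00 ▸ (v00.sub ((hν2 h).mul' (hol _ _ _ _ _ _ _ _) (by norm_num))).sub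
      ((hε h).mul' h00' (by simp))
  · have hε0 : (ν * T - S).coeff 0
        = -((K 0 1).coeff 1 * (F 0 0).coeff 0 - (K 0 0).coeff 0 * (F 0 1).coeff 1)
          / (2 * ((F 0 0).coeff 0 * (F 0 1).coeff 1)) := by
      rw [← hεc h, mul_div_cancel_right₀ _ (mul_ne_zero two_ne_zero (mul_ne_zero hf hf12))]
    rw [e00, coeff_sub, coeff_sub, v00c, (hν2 h).mul (hol _ _ _ _ _ _ _ _) 0 (by norm_num),
      (hε h).coeff_mul_low h00' (by simp), c00, hε0, hwκ, hdw, hf11]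
    field_simp
    ring
  · rw [b10, hS0 (by omega), zero_mul, add_zero]
    exact v10
  · rw [b00, hS0 (by omega), zero_mul, add_zero]
    exact v00
  · have hν := congrArg (fun x => x.coeff 1) hνM
    simp only [b01, hS0 (by omega : r ≤ 3), zero_mul, sub_zero] at hν
    rw [(hν1 h).coeff_mul_low hb (by omega), hbw, v01c, hwκ] at hν
    rw [if_pos h] at hκ
    rw [b00, hS0 (by omega), zero_mul, add_zero, v00c, hf11, hwκ, hdw]
    have ht : t = (κ + 1) / 2 := by rw [hκ]; ring
    have hν' : ν.coeff (-1)
        = ((K 0 1).coeff 1 * (F 0 0).coeff 0 - (K 0 0).coeff 0 * (F 0 1).coeff 1)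
        / (κ * ((F 0 0).coeff 0 * (F 0 1).coeff 1)) := by
      rw [← hν, mul_div_cancel_right₀ _ (mul_ne_zero hκ0 (mul_ne_zero hf hf12))]
    rw [hν', ht]
    field_simp
    ring

end Infinity

end GeoLax

namespace GeoLax

/-! ### Exact orders and subleading coefficients -/

/-- The Laurent series `x` has order exactly `n`. -/
def HasOrder (n : ℤ) (x : LaurentSeries ℂ) : Prop := VanishesTo n x ∧ x.coeff n ≠ 0

namespace HasOrder

variable {n m : ℤ} {x y : LaurentSeries ℂ}

theorem mul (hx : HasOrder n x) (hy : HasOrder m y) : HasOrder (n + m) (x * y) :=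
  ⟨hx.1.mul hy.1, by rw [hx.1.coeff_mul_low hy.1 rfl]; exact mul_ne_zero hx.2 hy.2⟩

theorem one : HasOrder 0 (1 : LaurentSeries ℂ) := ⟨.one, by simp⟩

theorem C {c : ℂ} (hc : c ≠ 0) : HasOrder 0 (HahnSeries.C c : LaurentSeries ℂ) :=
  ⟨.C c, by simpa using hc⟩

theorem ne_zero (hx : HasOrder n x) : x ≠ 0 := by
  rintro rfl
  exact hx.2 rfl

theorem div (hx : HasOrder n x) (hy : HasOrder m y) : HasOrder (n - m) (x / y) := by
  have h := hx.1.div hy.1 hy.2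
  refine ⟨h, fun h0 => hx.2 ?_⟩
  have h1 := h.coeff_mul_low hy.1 (sub_add_cancel n m).symm
  rwa [div_mul_cancel₀ _ hy.ne_zero, h0, zero_mul] at h1

theorem pow (hx : HasOrder n x) (k : ℕ) : HasOrder (k * n) (x ^ k) := by
  induction k with
  | zero => simpa using one
  | succ k ih => rw [pow_succ]; convert ih.mul hx using 1; push_cast; ring

theorem prod {ι : Type*} {s : Finset ι} {f : ι → LaurentSeries ℂ} {n : ι → ℤ}
    (h : ∀ i ∈ s, HasOrder (n i) (f i)) : HasOrder (∑ i ∈ s, n i) (∏ i ∈ s, f i) := by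
  classical
  induction s using Finset.induction_on with
  | empty => simpa using one
  | insert i s hi ih =>
    rw [Finset.sum_insert hi, Finset.prod_insert hi]
    exact (h i (Finset.mem_insert_self i s)).mul
      (ih fun j hj => h j (Finset.mem_insert_of_mem hj))

end HasOrder

/-- `x = zⁿ (1 + e z + ⋯)`. -/
def HasMonicExpansion (n : ℤ) (e : ℂ) (x : LaurentSeries ℂ) : Prop :=
  VanishesTo n x ∧ x.coeff n = 1 ∧ x.coeff (n + 1) = e

namespace HasMonicExpansion

variable {n m : ℤ} {d e : ℂ} {x y : LaurentSeries ℂ}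

theorem mul (hx : HasMonicExpansion n d x) (hy : HasMonicExpansion m e y) :
    HasMonicExpansion (n + m) (d + e) (x * y) :=
  ⟨hx.1.mul hy.1, by rw [hx.1.coeff_mul_low hy.1 rfl, hx.2.1, hy.2.1, one_mul], by
    rw [hx.1.coeff_mul_succ hy.1 rfl, hx.2.1, hx.2.2, hy.2.1, hy.2.2]; ring⟩

theorem one : HasMonicExpansion 0 0 (1 : LaurentSeries ℂ) := ⟨.one, by simp, by simp⟩

theorem div (hx : HasMonicExpansion n d x) (hy : HasMonicExpansion m e y) :
    HasMonicExpansion (n - m) (d - e) (x / y) := by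
  have hy0 : y.coeff m ≠ 0 := by rw [hy.2.1]; exact one_ne_zero
  have h := hx.1.div hy.1 hy0
  have hyne : y ≠ 0 := HasOrder.ne_zero ⟨hy.1, hy0⟩
  have h0 := h.coeff_mul_low hy.1 (sub_add_cancel n m).symm
  have h1 := h.coeff_mul_succ hy.1 (l := n + 1) (by ring)
  rw [div_mul_cancel₀ _ hyne, hx.2.1, hy.2.1, mul_one] at h0
  rw [div_mul_cancel₀ _ hyne, hx.2.2, hy.2.1, hy.2.2, ← h0] at h1
  exact ⟨h, h0.symm, by linear_combination -h1⟩

theorem pow (hx : HasMonicExpansion n d x) (k : ℕ) :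
    HasMonicExpansion (k * n) (k * d) (x ^ k) := by
  induction k with
  | zero => simpa using one
  | succ k ih => rw [pow_succ]; convert ih.mul hx using 1 <;> push_cast <;> ring

theorem prod {ι : Type*} {s : Finset ι} {f : ι → LaurentSeries ℂ} {n : ι → ℤ} {e : ι → ℂ}
    (h : ∀ i ∈ s, HasMonicExpansion (n i) (e i) (f i)) :
    HasMonicExpansion (∑ i ∈ s, n i) (∑ i ∈ s, e i) (∏ i ∈ s, f i) := by
  classical
  induction s using Finset.induction_on with
  | empty => simpa using one
  | insert i s hi ih =>
    rw [Finset.sum_insert hi, Finset.sum_insert hi, Finset.prod_insert hi]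
    exact (h i (Finset.mem_insert_self i s)).mul
      (ih fun j hj => h j (Finset.mem_insert_of_mem hj))

end HasMonicExpansion

theorem hasOrder_expAt_lam_sub (a x : ℂ) [Decidable (a = x)] :
    HasOrder (if a = x then 1 else 0) (expAt a (lam - RatFunc.C x)) := by
  split_ifs with h
  · subst h
    rw [expAt_lam_sub_self]
    exact ⟨.single 1 1, by simp⟩
  · exact ⟨holAt_lam_sub a x, by rw [coeff_zero_expAt_lam_sub]; exact sub_ne_zero.2 h⟩

theorem hasMonicExpansion_lam_sub (x : ℂ) :
    HasMonicExpansion (-1) (-x) (expInf (lam - RatFunc.C x)) := by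
  refine ⟨vanishesTo_expInf_lam_sub x, coeff_expInf_lam_sub x, ?_⟩
  rw [expInf_lam_sub, coeff_sub]
  simp

theorem hasMonicExpansion_pw (x : ℂ) (k : ℕ) :
    HasMonicExpansion k (k * x) (expInf ((lam - RatFunc.C x) ^ k)⁻¹) := by
  rw [expInf_inv, expInf_pow, inv_eq_one_div]
  convert HasMonicExpansion.one.div ((hasMonicExpansion_lam_sub x).pow k) using 1 <;> ring

section Factorized

variable {D : Setting} {g : ℕ} (τ : Times D) {w : ℂ} (q : Fin g → ℂ)

open Classical in
/-- The order of `factorized` at `a`: the number of `q_j` equal to `a` minus the order of the pole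
there. -/
theorem hasOrder_expAt_factorized (hw : w ≠ 0) (a : ℂ) :
    HasOrder ((∑ j, if a = q j then 1 else 0) - ∑ s, (D.r s : ℤ) * if a = posComp τ s then 1 else 0)
      (expAt a (factorized τ w q)) := by
  rw [factorized, expAt_div, expAt_mul, expAt_C, expAt_prod, expAt_prod]
  refine HasOrder.div ?_ ?_
  · simpa using (HasOrder.C hw).mul (HasOrder.prod (s := Finset.univ)
      fun j _ => hasOrder_expAt_lam_sub a (q j))
  · refine HasOrder.prod fun s _ => ?_
    rw [expAt_pow]
    exact (hasOrder_expAt_lam_sub a _).pow _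

/-- The degree of `factorized` is `r_∞ - 3`, and its subleading coefficient involves only the sums
of the zeros and of the poles. -/
theorem factorized_expInf (w : ℂ) (hg : g + 3 = D.rInf + ∑ s, D.r s) :
    ∃ x, expInf (factorized τ w q) = C w * x ∧ HasMonicExpansion (3 - (D.rInf : ℤ))
      (-(∑ j, q j - ∑ s, (D.r s : ℂ) * posComp τ s)) x := by
  refine ⟨(∏ j, expInf (lam - RatFunc.C (q j)))
    / ∏ s, expInf ((lam - RatFunc.C (posComp τ s)) ^ D.r s), ?_, ?_⟩
  · rw [factorized, expInf_div, expInf_mul, expInf_C, expInf_prod, expInf_prod, mul_div_assoc]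
  · have h1 := HasMonicExpansion.prod (s := Finset.univ)
      fun j _ => hasMonicExpansion_lam_sub (q j)
    have h2 : HasMonicExpansion (∑ s, (D.r s : ℤ) * -1) (∑ s, (D.r s : ℂ) * -posComp τ s)
        (∏ s, expInf ((lam - RatFunc.C (posComp τ s)) ^ D.r s)) := by
      refine HasMonicExpansion.prod fun s _ => ?_
      rw [expInf_pow]
      exact (hasMonicExpansion_lam_sub _).pow _
    convert h1.div h2 using 1
    · have : (g : ℤ) + 3 = D.rInf + ∑ s, (D.r s : ℤ) := by exact_mod_cast hg
      simp only [Finset.sum_const, Finset.card_univ, Fintype.card_fin, mul_neg, mul_one,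
        Finset.sum_neg_distrib]
      simp
      linarith
    · simp only [mul_neg, Finset.sum_neg_distrib]
      ring

end Factorized

/-! ### Explicit polar and polynomial parts -/

section Polar

variable {ι : Type*} [Fintype ι] (x : ι → ℂ) (r : ι → ℕ) (c : ι → ℕ → ℂ)

/-- The rational function with coefficients `c s k` of the powers `-k`, `1 ≤ k ≤ r s`, of
(spectral parameter) - `x s`. -/
noncomputable def polar : RatFunc ℂ :=
  ∑ s, ∑ k ∈ Finset.Icc 1 (r s), RatFunc.C (c s k) * ((lam - RatFunc.C (x s)) ^ k)⁻¹

/-- The polynomial of degree less than `N` with coefficients `c`. -/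
noncomputable def polyOf (N : ℕ) (c : ℕ → ℂ) : RatFunc ℂ :=
  ∑ k ∈ Finset.range N, RatFunc.C (c k) * lam ^ k

variable {x r c}

theorem holAt_polar {a : ℂ} (h : ∀ s, a ≠ x s) : HolAt a (polar x r c) :=
  .sum fun s _ => .sum fun k _ => (HolAt.C _).mul (holAt_pw (h s) k)

theorem coeff_expAt_polar (hx : Function.Injective x) (s : ι) {j : ℕ} (hj : 1 ≤ j) :
    (expAt (x s) (polar x r c)).coeff (-(j : ℤ)) = if j ≤ r s then c s j else 0 := by
  classical
  rw [polar, ← Finset.add_sum_erase _ _ (Finset.mem_univ s), expAt_add, coeff_add,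
    (HolAt.sum fun t ht => HolAt.sum fun k _ => (HolAt.C _).mul (holAt_pw
      (fun h => Finset.ne_of_mem_erase ht (hx h).symm) k) :
        HolAt (x s) (∑ t ∈ Finset.univ.erase s, ∑ k ∈ Finset.Icc 1 (r t),
          RatFunc.C (c t k) * ((lam - RatFunc.C (x t)) ^ k)⁻¹)) _ (by omega), add_zero, expAt_sum]
  simp only [expAt_mul, expAt_C, expAt_pw_self]
  rw [coeff_sum_single_neg]
  simp only [neg_neg, Int.toNat_natCast, Finset.mem_Icc]
  exact if_congr (by omega) rfl rfl

theorem vanishesTo_expAt_polar (hx : Function.Injective x) (s : ι) :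
    VanishesTo (-(r s : ℤ)) (expAt (x s) (polar x r c)) := by
  intro k hk
  obtain ⟨j, rfl⟩ : ∃ j : ℕ, k = -(j : ℤ) := ⟨(-k).toNat, by omega⟩
  rw [coeff_expAt_polar hx s (by omega), if_neg (by omega)]

theorem vanishesTo_expInf_polar : VanishesTo 1 (expInf (polar x r c)) := by
  rw [polar, expInf_sum]
  refine .sum fun s _ => ?_
  rw [expInf_sum]
  refine .sum fun k hk => ?_
  rw [expInf_mul, expInf_C]
  rw [Finset.mem_Icc] at hk
  exact (VanishesTo.C _).mul' (vanishesTo_expInf_pw _ k) (by omega)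

theorem coeff_one_expInf_polar (hr : ∀ s, 1 ≤ r s) :
    (expInf (polar x r c)).coeff 1 = ∑ s, c s 1 := by
  rw [polar, expInf_sum, coeff_sum]
  refine Finset.sum_congr rfl fun s _ => ?_
  rw [expInf_sum, coeff_sum, Finset.sum_eq_single 1]
  · have := (hasMonicExpansion_pw (x s) 1).2.1
    rw [Nat.cast_one] at this
    rw [expInf_mul, expInf_C, coeff_C_mul', this, mul_one]
  · intro k hk hk1
    rw [Finset.mem_Icc] at hk
    rw [expInf_mul, expInf_C, coeff_C_mul', vanishesTo_expInf_pw _ k _ (by omega), mul_zero]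
  · intro h
    exact absurd (Finset.mem_Icc.2 ⟨le_rfl, hr s⟩) h

theorem coeff_two_expInf_polar (hr : ∀ s, 1 ≤ r s) (h2 : ∀ s, r s < 2 → c s 2 = 0) :
    (expInf (polar x r c)).coeff 2 = ∑ s, (c s 2 + x s * c s 1) := by
  rw [polar, expInf_sum, coeff_sum]
  refine Finset.sum_congr rfl fun s _ => ?_
  have e1 : (expInf ((lam - RatFunc.C (x s)) ^ 1)⁻¹).coeff 2 = x s := by
    simpa using (hasMonicExpansion_pw (x s) 1).2.2
  have e2 : (expInf ((lam - RatFunc.C (x s)) ^ 2)⁻¹).coeff 2 = 1 := by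
    simpa using (hasMonicExpansion_pw (x s) 2).2.1
  rw [expInf_sum, coeff_sum]
  simp only [expInf_mul, expInf_C, coeff_C_mul']
  by_cases h : r s < 2
  · obtain h1 : r s = 1 := le_antisymm (by omega) (hr s)
    rw [h1, Finset.Icc_self, Finset.sum_singleton, e1, h2 s h]
    ring
  · rw [← Finset.sum_subset (s₁ := {1, 2})]
    · rw [Finset.sum_pair (by norm_num), e1, e2]
      ring
    · intro k hk
      simp only [Finset.mem_insert, Finset.mem_singleton] at hk
      rw [Finset.mem_Icc]
      omega
    · intro k hk hk'
      simp only [Finset.mem_insert, Finset.mem_singleton, Finset.mem_Icc] at hk hk'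
      rw [vanishesTo_expInf_pw _ k _ (by omega), mul_zero]

theorem holAt_polyOf (a : ℂ) (N : ℕ) (c : ℕ → ℂ) : HolAt a (polyOf N c) :=
  .sum fun k _ => (HolAt.C _).mul (HolAt.lam.pow k)

theorem coeff_expInf_polyOf (N : ℕ) (c : ℕ → ℂ) (j : ℤ) :
    (expInf (polyOf N c)).coeff j = if 0 ≤ -j ∧ (-j).toNat < N then c (-j).toNat else 0 := by
  rw [polyOf, expInf_sum]
  simp only [expInf_mul, expInf_C, expInf_lam_pow]
  rw [coeff_sum_single_neg]
  simp only [Finset.mem_range]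

theorem vanishesTo_expInf_polyOf (N : ℕ) (c : ℕ → ℂ) :
    VanishesTo (1 - (N : ℤ)) (expInf (polyOf N c)) := fun k hk => by
  rw [coeff_expInf_polyOf, if_neg (by omega)]

end Polar

/-! ### The residue theorem -/

theorem coeff_one_expInf_singPart (a : ℂ) (f : RatFunc ℂ) :
    (expInf (singPart a f)).coeff 1 = (expAt a f).coeff (-1) := by
  rw [singPart, expInf_sum, coeff_sum]
  by_cases h : 1 ≤ (-(expAt a f).order).toNat
  · rw [Finset.sum_eq_single 1]
    · have := (hasMonicExpansion_pw a 1).2.1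
      rw [Nat.cast_one] at this
      rw [expInf_mul, expInf_C, coeff_C_mul', this, mul_one, Nat.cast_one]
    · intro k hk hk1
      rw [Finset.mem_Icc] at hk
      rw [expInf_mul, expInf_C, coeff_C_mul', vanishesTo_expInf_pw _ k _ (by omega), mul_zero]
    · exact fun h' => absurd (Finset.mem_Icc.2 ⟨le_rfl, h⟩) h'
  · rw [Finset.sum_eq_zero, vanishesTo_order _ _ (by omega)]
    intro k hk
    rw [Finset.mem_Icc] at hk
    omega

theorem coeff_one_expInf_polyPart (f : RatFunc ℂ) : (expInf (polyPart f)).coeff 1 = 0 := by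
  have := coeff_expInf_polyOf ((-(expInf f).order).toNat + 1)
    (fun k => (expInf f).coeff (-(k : ℤ))) 1
  rw [if_neg (by omega)] at this
  exact this

theorem holAt_sub_sum_singPart {ι : Type*} [Fintype ι] {x : ι → ℂ} (hx : Function.Injective x)
    (f : ι → RatFunc ℂ) (s : ι) : HolAt (x s) (f s - ∑ t, singPart (x t) (f t)) := by
  classical
  rw [← Finset.add_sum_erase _ _ (Finset.mem_univ s), ← sub_sub]
  exact (holAt_sub_singPart _ _).sub (.sum fun t ht => holAt_singPart
    (fun h => Finset.ne_of_mem_erase ht (hx h).symm) _)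

/-- The residue theorem: the residues at the finite poles add up to the coefficient of the inverse
of the spectral parameter at infinity. -/
theorem coeff_one_expInf_eq_sum_residues {ι : Type*} [Fintype ι] {x : ι → ℂ}
    (hx : Function.Injective x) {f : RatFunc ℂ} (hf : ∀ a, (∀ s, a ≠ x s) → HolAt a f) :
    (expInf f).coeff 1 = ∑ s, (expAt (x s) f).coeff (-1) := by
  have h : f = ∑ s, singPart (x s) f + polyPart f := by
    refine eq_of_holAt_sub (fun a => ?_) ?_
    · rw [← sub_sub]
      refine HolAt.sub ?_ (holAt_polyPart a f)
      by_cases ha : ∃ s, a = x s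
      · obtain ⟨s, rfl⟩ := ha
        exact holAt_sub_sum_singPart hx (fun _ => f) s
      · push Not at ha
        exact (hf a ha).sub (.sum fun s _ => holAt_singPart (ha s) f)
    · rw [expInf_add, ← sub_sub, sub_right_comm, expInf_sum]
      exact (vanishesTo_expInf_sub_polyPart f).sub (.sum fun s _ => vanishesTo_expInf_singPart _ f)
  conv_lhs => rw [h, expInf_add, expInf_sum, coeff_add, coeff_sum, coeff_one_expInf_polyPart,
    add_zero]
  exact Finset.sum_congr rfl fun s _ => coeff_one_expInf_singPart _ f

end GeoLax

namespace GeoLax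

variable {D : Setting}

theorem VanishesTo.succ {n : ℤ} {x : LaurentSeries ℂ} (h : VanishesTo n x) (h0 : x.coeff n = 0) :
    VanishesTo (n + 1) x := fun k hk => by
  rcases lt_or_ge k n with h1 | h1
  · exact h k h1
  · obtain rfl : k = n := by omega
    exact h0

/-! ### The Lax matrix at infinity -/

/-- The entries of a representative in polar form, with its normalization. -/
theorem IsRepresentative.exists_entry {τ : Times D} {w : ℂ} {M : Matrix (Fin 2) (Fin 2) (RatFunc ℂ)}
    (h : IsRepresentative τ w M) :
    ∃ (LI : ℕ → Matrix (Fin 2) (Fin 2) ℂ) (LX : Fin D.n → ℕ → Matrix (Fin 2) (Fin 2) ℂ),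
      (∀ k, (LI k).trace = 0) ∧ (∀ s k, (LX s k).trace = 0) ∧ (∀ s k, D.r s ≤ k → LX s k = 0) ∧
      (∀ i j, M i j = polyOf (D.rInf - 1) (fun k => LI (k + 1) i j)
        + polar (posComp τ) D.r (fun s k => LX s (k - 1) i j)) ∧
      (3 ≤ D.rInf →
        LI (D.rInf - 1) = !![-tInf τ (D.rInf - 1), 0; 0, tInf τ (D.rInf - 1)] ∧
        LI (D.rInf - 2) 0 1 = w) ∧
      (D.rInf = 2 → LI 1 = !![-tInf τ 1, 0; 0, tInf τ 1] ∧ (∑ s, LX s 0) 0 1 = w) ∧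
      (D.rInf = 1 → ∑ s, LX s 0 = !![-tInf τ 0, 0; 0, tInf τ 0] ∧
        (∑ s, LX s 1 + ∑ s, posComp τ s • LX s 0) 0 1 = w) := by
  obtain ⟨-, LI, LX, h1, h2, h3, h4, -, -, h5, h6, h7⟩ := h
  refine ⟨LI, LX, h1, h2, h3, fun i j => ?_, h5, h6, h7⟩
  rw [h4]
  simp only [Matrix.add_apply, Matrix.sum_apply, Matrix.smul_apply, Matrix.map_apply, smul_eq_mul,
    polyOf, polar]
  congr 1
  · refine Finset.sum_nbij' (fun k => k - 1) (fun k => k + 1) ?_ ?_ ?_ ?_ ?_ <;>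
      simp only [Finset.mem_Icc, Finset.mem_range] <;> intro k hk
    · omega
    · omega
    · omega
    · omega
    · rw [Nat.sub_add_cancel hk.1, mul_comm]
  · refine Finset.sum_congr rfl fun s _ => ?_
    refine Finset.sum_nbij' (fun k => k + 1) (fun k => k - 1) ?_ ?_ ?_ ?_ ?_ <;>
      simp only [Finset.mem_Icc, Finset.mem_range] <;> intro k hk
    · omega
    · omega
    · omega
    · omega
    · rw [Nat.add_sub_cancel, mul_comm]

theorem IsRepresentative.trace_eq {τ : Times D} {w : ℂ} {M : Matrix (Fin 2) (Fin 2) (RatFunc ℂ)}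
    (h : IsRepresentative τ w M) : M 1 1 = -M 0 0 := by
  obtain ⟨LI, LX, h1, h2, -, h4, -⟩ := h.exists_entry
  have e1 : ∀ k, LI k 1 1 = -LI k 0 0 := fun k => by
    have := h1 k; rw [Matrix.trace_fin_two] at this; linear_combination this
  have e2 : ∀ s k, LX s k 1 1 = -LX s k 0 0 := fun s k => by
    have := h2 s k; rw [Matrix.trace_fin_two] at this; linear_combination this
  rw [h4, h4]
  simp only [polyOf, polar, e1, e2, map_neg, neg_mul, Finset.sum_neg_distrib]
  ring

theorem IsRepresentative.holAt {τ : Times D} {w : ℂ} {M : Matrix (Fin 2) (Fin 2) (RatFunc ℂ)}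
    (h : IsRepresentative τ w M) {a : ℂ} (ha : ∀ s, a ≠ posComp τ s) (i j : Fin 2) :
    HolAt a (M i j) := by
  obtain ⟨LI, LX, -, -, -, h4, -⟩ := h.exists_entry
  rw [h4]
  exact (holAt_polyOf _ _ _).add (holAt_polar ha)

/-- The normalization at infinity in terms of expansions, uniformly in the order of the pole. -/
theorem IsRepresentative.expInf_entries {τ : Times D} {w : ℂ}
    {M : Matrix (Fin 2) (Fin 2) (RatFunc ℂ)} (h : IsRepresentative τ w M) :
    (∀ i j, VanishesTo (2 - (D.rInf : ℤ)) (expInf (M i j))) ∧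
    (expInf (M 0 0)).coeff (2 - (D.rInf : ℤ)) = -tInf τ (D.rInf - 1) ∧
    (expInf (M 1 1)).coeff (2 - (D.rInf : ℤ)) = tInf τ (D.rInf - 1) ∧
    VanishesTo (3 - (D.rInf : ℤ)) (expInf (M 0 1)) ∧
    VanishesTo (3 - (D.rInf : ℤ)) (expInf (M 1 0)) ∧
    (expInf (M 0 1)).coeff (3 - (D.rInf : ℤ)) = w := by
  obtain ⟨LI, LX, -, -, h3, h4, h5, h6, h7⟩ := h.exists_entry
  have hr := D.one_le_rInf
  have van : ∀ i j, VanishesTo (2 - (D.rInf : ℤ)) (expInf (M i j)) := fun i j => by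
    rw [h4, expInf_add]
    exact ((vanishesTo_expInf_polyOf _ _).mono (by omega)).add
      (vanishesTo_expInf_polar.mono (by omega))
  have big : ∀ i j, ∀ k : ℕ, 1 ≤ k → k ≤ D.rInf - 1 →
      (expInf (M i j)).coeff (1 - (k : ℤ)) = LI k i j := fun i j k hk hk' => by
    rw [h4, expInf_add, coeff_add, vanishesTo_expInf_polar _ (by omega), add_zero,
      coeff_expInf_polyOf, if_pos (by omega)]
    congr
    omega
  have one : D.rInf ≤ 2 → ∀ i j, (expInf (M i j)).coeff 1 = (∑ s, LX s 0) i j := fun _ i j => by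
    rw [h4, expInf_add, coeff_add, coeff_expInf_polyOf, if_neg (by omega), zero_add,
      coeff_one_expInf_polar D.one_le_r, Matrix.sum_apply]
  have two : ∀ i j, (expInf (M i j)).coeff 2
      = (∑ s, LX s 1 + ∑ s, posComp τ s • LX s 0) i j := fun i j => by
    rw [h4, expInf_add, coeff_add, coeff_expInf_polyOf, if_neg (by omega), zero_add,
      coeff_two_expInf_polar D.one_le_r fun s hs => by
        simp [h3 s 1 (by omega)]]
    simp [Matrix.sum_apply, Finset.sum_add_distrib]
  have lead : ∀ i j, (expInf (M i j)).coeff (2 - (D.rInf : ℤ))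
      = (!![-tInf τ (D.rInf - 1), 0; 0, tInf τ (D.rInf - 1)] : Matrix (Fin 2) (Fin 2) ℂ) i j := by
    intro i j
    rcases (by omega : D.rInf = 1 ∨ D.rInf = 2 ∨ 3 ≤ D.rInf) with h | h | h
    · rw [← (by omega : 1 = (2 - (D.rInf : ℤ))), one (by omega), (h7 h).1, h]
    · rw [(by push_cast; omega : (2 - (D.rInf : ℤ)) = 1 - ((1 : ℕ) : ℤ)),
        big i j 1 le_rfl (by omega), (h6 h).1, h]
    · rw [(by omega : (2 - (D.rInf : ℤ)) = 1 - ((D.rInf - 1 : ℕ) : ℤ)),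
        big i j _ (by omega) (by omega), (h5 h).1]
  refine ⟨van, by rw [lead]; simp, by rw [lead]; simp, ?_, ?_, ?_⟩
  · exact ((van 0 1).succ (by rw [lead]; simp)).mono (by omega)
  · exact ((van 1 0).succ (by rw [lead]; simp)).mono (by omega)
  · rcases (by omega : D.rInf = 1 ∨ D.rInf = 2 ∨ 3 ≤ D.rInf) with h | h | h
    · rw [← (by omega : 2 = (3 - (D.rInf : ℤ))), two, (h7 h).2]
    · rw [← (by omega : 1 = (3 - (D.rInf : ℤ))), one (by omega), (h6 h).2]
    · rw [(by omega : (3 - (D.rInf : ℤ)) = 1 - ((D.rInf - 2 : ℕ) : ℤ)),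
        big 0 1 _ (by omega) (by omega), (h5 h).2]

theorem IsRepresentative.tInf_ne_zero {τ : Times D} {w : ℂ}
    {M : Matrix (Fin 2) (Fin 2) (RatFunc ℂ)} (h : IsRepresentative τ w M) :
    tInf τ (D.rInf - 1) ≠ 0 := by
  obtain ⟨-, -, -, -, -, -, -, h, -⟩ := h
  exact h

/-! ### The exponents -/

theorem coeff_dLamTX (τ : Times D) (s : Fin D.n) (j : ℤ) :
    (dLamTX τ s).coeff j = if j ≤ -1 ∧ -(D.r s : ℤ) ≤ j then tX τ s (-j - 1).toNat else 0 := by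
  rw [dLamTX, coeff_sum]
  simp only [coeff_single]
  split_ifs with h
  · rw [Finset.sum_eq_single (-j - 1).toNat]
    · rw [if_pos (by omega)]
    · intro b _ hb
      rw [if_neg (by omega)]
    · intro h'
      rw [Finset.mem_range] at h'
      omega
  · refine Finset.sum_eq_zero fun b hb => ?_
    rw [Finset.mem_range] at hb
    rw [if_neg (by omega)]

theorem vanishesTo_dLamTX (τ : Times D) (s : Fin D.n) : VanishesTo (-(D.r s : ℤ)) (dLamTX τ s) :=
  fun k hk => by rw [coeff_dLamTX, if_neg (by omega)]

theorem coeff_deformTX (v τ : Times D) (s : Fin D.n) (j : ℤ) :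
    (deformTX v τ s).coeff j = -(poleComp v s (-j).toNat / ((-j).toNat : ℂ))
      - posComp v s * (dLamTX τ s).coeff j := by
  rw [deformTX, coeff_sub, coeff_C_mul', coeff_neg, coeff_sum]
  congr 2
  simp only [coeff_single]
  by_cases h : 1 ≤ -j ∧ -j ≤ (D.r s - 1 : ℕ)
  · rw [Finset.sum_eq_single (-j).toNat]
    · rw [if_pos (by omega)]
    · intro b _ hb
      rw [if_neg (by omega)]
    · intro h'
      rw [Finset.mem_Icc] at h'
      omega
  · rw [poleComp, dif_neg (by omega), zero_div]
    refine Finset.sum_eq_zero fun b hb => ?_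
    rw [Finset.mem_Icc] at hb
    rw [if_neg (by omega)]

theorem vanishesTo_deformTX (v τ : Times D) (s : Fin D.n) :
    VanishesTo (-(D.r s : ℤ)) (deformTX v τ s) := fun k hk => by
  rw [coeff_deformTX, vanishesTo_dLamTX τ s k hk, poleComp, dif_neg (by omega)]
  simp

theorem coeff_dLamTInf (τ : Times D) (j : ℤ) :
    (dLamTInf τ).coeff j = if j ≤ 1 ∧ 2 - (D.rInf : ℤ) ≤ j then -tInf τ (1 - j).toNat else 0 := by
  rw [dLamTInf, coeff_neg, coeff_sum]
  simp only [coeff_single]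
  split_ifs with h
  · rw [Finset.sum_eq_single (1 - j).toNat]
    · rw [if_pos (by omega)]
    · intro b _ hb
      rw [if_neg (by omega)]
    · intro h'
      rw [Finset.mem_range] at h'
      omega
  · rw [Finset.sum_eq_zero, neg_zero]
    intro b hb
    rw [Finset.mem_range] at hb
    rw [if_neg (by omega)]

theorem vanishesTo_dLamTInf (τ : Times D) : VanishesTo (2 - (D.rInf : ℤ)) (dLamTInf τ) :=
  fun k hk => by rw [coeff_dLamTInf, if_neg (by omega)]

theorem coeff_deformTInf (v : Times D) (j : ℤ) :
    (deformTInf v).coeff j = -(infComp v (-j).toNat / ((-j).toNat : ℂ)) := by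
  rw [deformTInf, coeff_neg, coeff_sum]
  congr 1
  simp only [coeff_single]
  by_cases h : 1 ≤ -j ∧ -j ≤ (D.rInf - 1 : ℕ)
  · rw [Finset.sum_eq_single (-j).toNat]
    · rw [if_pos (by omega)]
    · intro b _ hb
      rw [if_neg (by omega)]
    · intro h'
      rw [Finset.mem_Icc] at h'
      omega
  · rw [infComp, dif_neg (by omega), zero_div]
    refine Finset.sum_eq_zero fun b hb => ?_
    rw [Finset.mem_Icc] at hb
    rw [if_neg (by omega)]

/-- The two highest irregular times at infinity are trivial, so tangent vectors have no component
along them. -/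
theorem infComp_of_tangent {v : Times D} (hv : Tangent v) {k : ℕ} (hk : D.rInf - 2 ≤ k) :
    infComp v k = 0 := by
  by_cases h : 1 ≤ k ∧ k ≤ D.rInf - 1
  · rcases (by omega : D.rInf = 2 ∨ 3 ≤ D.rInf) with h2 | h2
    · rw [(by omega : k = 1)]
      exact (hv.2.1 h2).1
    · rcases (by omega : k = D.rInf - 1 ∨ k = D.rInf - 2) with rfl | rfl
      · exact (hv.1 h2).1
      · exact (hv.1 h2).2
  · rw [infComp, dif_neg h]

theorem vanishesTo_deformTInf {v : Times D} (hv : Tangent v) :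
    VanishesTo (3 - (D.rInf : ℤ)) (deformTInf v) := fun k hk => by
  rw [coeff_deformTInf]
  rcases lt_or_ge k 0 with h | h
  · rw [infComp_of_tangent hv (by omega), zero_div, neg_zero]
  · rw [(by omega : (-k).toNat = 0), infComp, dif_neg (by omega), zero_div, neg_zero]

theorem deformTInf_eq_zero {v : Times D} (hv : Tangent v) (h : D.rInf ≤ 3) : deformTInf v = 0 := by
  ext k
  rw [coeff_deformTInf]
  by_cases hk : (-k).toNat = 0
  · rw [hk, infComp, dif_neg (by omega), zero_div, neg_zero, coeff_zero]
  · rw [infComp_of_tangent hv (by omega), zero_div, neg_zero, coeff_zero]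

/-- The leading irregular time (or monodromy) at infinity is constant on the slice. -/
theorem tInf_top_eq {τ τ' : Times D} (h : Normalized τ) (h' : Normalized τ') :
    tInf τ (D.rInf - 1) = tInf τ' (D.rInf - 1) := by
  have hr := D.one_le_rInf
  rcases (by omega : D.rInf = 1 ∨ D.rInf = 2 ∨ 3 ≤ D.rInf) with h1 | h1 | h1
  · rw [h1]; rfl
  · have e : D.rInf - 1 = 1 := by omega
    rw [e, (h.2.1 h1).1, (h'.2.1 h1).1]
  · rw [(h.1 h1).1, (h'.1 h1).1]

/-! ### Local data of a Lax pair -/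

theorem toLaurent_dz_coeff_zero (F : Matrix (Fin 2) (Fin 2) (PowerSeries ℂ)) (i j : Fin 2) :
    (toLaurent (dz F) i j).coeff 0 = (toLaurent F i j).coeff 1 := by
  simp only [toLaurent, dz, Matrix.map_apply]
  rw [coeff_coe_zero, coeff_coe_one, PowerSeries.coeff_derivative]
  simp

/-- What the formal solutions imply for a Lax pair at a finite pole, with `ν = A₁₂ / L₁₂` and `T`
the exponent: `ν` is holomorphic, `ν T' = 𝓛_α[T] + O(1)`, `A = ν L + O(1)` and
`-det L = T'² + O(z^{-r})`. -/
structure FiniteData (τ v : Times D) (L A : Matrix (Fin 2) (Fin 2) (RatFunc ℂ)) (s : Fin D.n) :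
    Prop where
  van_L : ∀ i j, VanishesTo (-(D.r s : ℤ)) (expAt (posComp τ s) (L i j))
  van_nu : VanishesTo 0 (expAt (posComp τ s) (A 0 1 / L 0 1))
  t_ne : tX τ s (D.r s - 1) ≠ 0
  nu_T : VanishesTo 0 (expAt (posComp τ s) (A 0 1 / L 0 1) * dLamTX τ s - deformTX v τ s)
  hol_A : ∀ i j, HolAt (posComp τ s) (A i j - A 0 1 / L 0 1 * L i j)
  det : VanishesTo (-(D.r s : ℤ))
    (expAt (posComp τ s) (L 0 0 ^ 2 + L 0 1 * L 1 0) - dLamTX τ s ^ 2)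

theorem IsLaxPair.finiteData {U : Set (Times D)} {ω : Times D → ℂ} {α : Times D → Times D}
    {L A : Times D → Matrix (Fin 2) (Fin 2) (RatFunc ℂ)} (h : IsLaxPair U ω α L A) {τ : Times D}
    (hτ : τ ∈ domain U) (s : Fin D.n)
    (hb : (expAt (posComp τ s) (L τ 0 1)).coeff (-(D.r s : ℤ)) ≠ 0) :
    FiniteData τ (α τ) (L τ) (A τ) s := by
  obtain ⟨F, hF, hs⟩ := h.solves_pole s
  obtain ⟨hM, hB⟩ := hs τ hτ
  have hr := D.one_le_r s
  have hG : ∀ i j, VanishesTo 0 ((toLaurent (deformSeries α F τ)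
      - (HahnSeries.C (posComp (α τ) s) : LaurentSeries ℂ) • toLaurent (dz (F τ))) i j) :=
    fun i j => (vanishesTo_toLaurent _ i j).sub
      ((VanishesTo.C _).mul' (vanishesTo_toLaurent _ i j) (by simp))
  obtain ⟨h1, h2, h3, h4, h5, h6⟩ := local_finite (M := (L τ).map (expAt (posComp τ s)))
    (B := (A τ).map (expAt (posComp τ s))) (by omega : 1 ≤ (D.r s : ℤ))
    (toLaurent_det (hF.2 τ hτ)) (vanishesTo_toLaurent _) (vanishesTo_toLaurent _) hG
    (vanishesTo_dLamTX τ s) (vanishesTo_deformTX (α τ) τ s) hM hB hb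
  simp only [Matrix.map_apply] at h1 h2 h4 h5 h6
  refine ⟨h1, by rwa [expAt_div], ?_, by rwa [expAt_div], fun i j => ?_, ?_⟩
  · rw [coeff_dLamTX, if_pos (by omega)] at h3
    convert h3 using 2
    omega
  · rw [HolAt, expAt_sub, expAt_mul, expAt_div]
    exact h5 i j
  · rw [expAt_add, expAt_pow, expAt_mul]
    exact h6

/-- What the formal solutions imply for a Lax pair at infinity, with `ν = A₁₂ / L₁₂`, `w` the
normalization constant and `dw` its derivative. For `r_∞ = 1`, where `ν` may have a pole, the
matrix `A` itself is holomorphic. -/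
structure InfinityData (τ v : Times D) (w dw : ℂ) (L A : Matrix (Fin 2) (Fin 2) (RatFunc ℂ)) :
    Prop where
  trace_A : A 1 1 = -A 0 0
  van_L00 : 2 ≤ D.rInf → VanishesTo (4 - (D.rInf : ℤ)) (expInf (L 0 0) - dLamTInf τ)
  det : 3 ≤ D.rInf → VanishesTo (4 - (D.rInf : ℤ))
    (expInf (L 0 0 ^ 2 + L 0 1 * L 1 0) - dLamTInf τ ^ 2)
  van_nu_three : 3 ≤ D.rInf → VanishesTo 1 (expInf (A 0 1 / L 0 1))
  van_nu_two : D.rInf = 2 → VanishesTo 0 (expInf (A 0 1 / L 0 1))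
  van_nu_one : D.rInf = 1 → VanishesTo (-1) (expInf (A 0 1 / L 0 1))
  nu_T : 2 ≤ D.rInf → VanishesTo 0 (expInf (A 0 1 / L 0 1) * dLamTInf τ - deformTInf v)
  van_A10_sub : 2 ≤ D.rInf → VanishesTo 1 (expInf (A 1 0 - A 0 1 / L 0 1 * L 1 0))
  van_A00_sub : 2 ≤ D.rInf → VanishesTo 0 (expInf (A 0 0 - A 0 1 / L 0 1 * L 0 0))
  coeff_A00_sub : 2 ≤ D.rInf →
    (expInf (A 0 0 - A 0 1 / L 0 1 * L 0 0)).coeff 0 = dw / (2 * w)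
  van_A10 : D.rInf ≤ 2 → VanishesTo 1 (expInf (A 1 0))
  van_A00 : D.rInf = 1 → VanishesTo 0 (expInf (A 0 0))
  coeff_A00 : D.rInf = 1 → (expInf (A 0 0)).coeff 0
    = dw / (2 * w) + (1 / 2 - tInf τ 0) * (expInf (A 0 1 / L 0 1)).coeff (-1)
  van_A01 : D.rInf ≤ 3 → VanishesTo 1 (expInf (A 0 1))

theorem IsLaxPair.infinityData {U : Set (Times D)} {ω : Times D → ℂ} {α : Times D → Times D}
    {L A : Times D → Matrix (Fin 2) (Fin 2) (RatFunc ℂ)} (h : IsLaxPair U ω α L A) {τ : Times D}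
    (hτ : τ ∈ domain U) : InfinityData τ (α τ) (ω τ) (deform α ω τ) (L τ) (A τ) := by
  obtain ⟨F, hF, hs⟩ := h.solves_inf
  have hr : (1 : ℤ) ≤ D.rInf := by exact_mod_cast D.one_le_rInf
  have hα := h.tangent τ hτ
  have hTt : ∀ τ' : Times D, (dLamTInf τ' : LaurentSeries ℂ).coeff (2 - (D.rInf : ℤ))
      = -tInf τ' (D.rInf - 1) := fun τ' => by
    rw [coeff_dLamTInf, if_pos (by omega)]
    congr 2
    omega
  set G : Times D → Matrix (Fin 2) (Fin 2) (LaurentSeries ℂ) :=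
    fun τ' => -((single 2 1 : LaurentSeries ℂ) • toLaurent (dz (F τ'))) with hGdef
  have hG : ∀ τ' i j, VanishesTo 2 (G τ' i j) := fun τ' i j =>
    ((VanishesTo.single 2 1).mul' (vanishesTo_toLaurent _ i j) (by simp)).neg
  have hG01 : ∀ τ', (G τ' 0 1).coeff 2 = -(toLaurent (F τ') 0 1).coeff 1 := fun τ' => by
    rw [← toLaurent_dz_coeff_zero]
    change (-((single 2 1 : LaurentSeries ℂ) * toLaurent (dz (F τ')) 0 1)).coeff 2 = _
    rw [coeff_neg, coeff_single_mul, one_mul, sub_self]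
  have hoff : ∀ τ' ∈ domain U,
      VanishesTo 1 (toLaurent (F τ') 0 1) ∧ VanishesTo 1 (toLaurent (F τ') 1 0) := by
    intro τ' hτ'
    obtain ⟨e1, e2, e3, e4, e5, e6⟩ := (h.representative τ' hτ').expInf_entries
    exact gauge_offdiag_eq_zero (M := (L τ').map expInf) hr
      (h.representative τ' hτ').tInf_ne_zero (vanishesTo_toLaurent _) (hG τ')
      (vanishesTo_dLamTInf τ') (hTt τ') (hs τ' hτ').1 (e1 0 0) e2 (e1 1 1) e3 e4 e5
  have hlax := fun τ' (hτ' : τ' ∈ domain U) =>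
    lax_expansion_inf (M := (L τ').map expInf) hr (toLaurent_det (hF.2 τ' hτ'))
      (vanishesTo_toLaurent _) (hoff τ' hτ').1 (hoff τ' hτ').2 (hG τ') (hG01 τ')
      (vanishesTo_dLamTInf τ') (hTt τ') (hs τ' hτ').1
  -- the relation between `ω` and the gauge matrix on the whole slice, and its derivative
  set κ : ℂ := 2 * tInf τ (D.rInf - 1) - if (D.rInf : ℤ) = 1 then 1 else 0 with hκ
  have hω : ∀ τ' ∈ domain U, ω τ' = κ * ((F τ' 0 0).coeff 0 * (F τ' 0 1).coeff 1) := by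
    intro τ' hτ'
    have h1 := (hlax τ' hτ').2.2
    have h2 := (h.representative τ' hτ').expInf_entries.2.2.2.2.2
    simp only [Matrix.map_apply] at h1
    rw [h2, toLaurent, Matrix.map_apply, Matrix.map_apply, coeff_coe_zero, coeff_coe_one] at h1
    rw [h1, hκ, tInf_top_eq hτ'.2 hτ.2]
  have hdω : deform α ω τ = κ * ((deformSeries α F τ 0 0).coeff 0 * (F τ 0 1).coeff 1
      + (F τ 0 0).coeff 0 * (deformSeries α F τ 0 1).coeff 1) := by
    rw [deform_congr h.isOpen hτ hα hω, deform_const_mul h.isOpen hτ hα κ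
      ((hF.1 0 0 0).fun_mul (hF.1 0 1 1)), deform_mul h.isOpen hτ hα (hF.1 0 0 0) (hF.1 0 1 1)]
    simp [deformSeries]
  have hK : ∀ i j, (∀ τ' ∈ domain U, VanishesTo 1 (toLaurent (F τ') i j)) →
      VanishesTo 1 (toLaurent (deformSeries α F τ) i j) := by
    intro i j hij
    refine vanishesTo_one_coe ?_
    have : ∀ τ' ∈ domain U, (F τ' i j).coeff 0 = (fun _ => 0 : Times D → ℂ) τ' := fun τ' hτ' => by
      have := hij τ' hτ' 0 (by norm_num)
      rwa [toLaurent, Matrix.map_apply, coeff_coe_zero] at this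
    rw [deformSeries, Matrix.of_apply, PowerSeries.coeff_mk,
      deform_congr h.isOpen hτ hα this, deform_const]
  obtain ⟨e1, e2, e3, e4, e5, e6⟩ := (h.representative τ hτ).expInf_entries
  obtain ⟨l1, l3, -⟩ := hlax τ hτ
  obtain ⟨a1, a2, a3, a4, a5, a6, a7, a8, a9, a10, a11⟩ :=
    auxiliary_expansion_inf (M := (L τ).map expInf) (B := (A τ).map expInf) hr
      (toLaurent_det (hF.2 τ hτ)) (vanishesTo_toLaurent _) (hoff τ hτ).1 (hoff τ hτ).2 (hG τ)
      (vanishesTo_toLaurent (deformSeries α F τ)) (hK 0 1 fun τ' hτ' => (hoff τ' hτ').1)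
      (hK 1 0 fun τ' hτ' => (hoff τ' hτ').2) (vanishesTo_deformTInf hα)
      (fun h3 => deformTInf_eq_zero hα (by exact_mod_cast h3)) (hs τ hτ).1 (hs τ hτ).2 e4 e6
      (h.representative τ hτ).1 hκ
      (by
        rw [toLaurent, Matrix.map_apply, Matrix.map_apply, coeff_coe_zero, coeff_coe_one]
        exact hω τ hτ)
      (dw := deform α ω τ)
      (by
        simp only [toLaurent, Matrix.map_apply]
        rw [coeff_coe_zero, coeff_coe_one, coeff_coe_zero, coeff_coe_one]
        exact hdω)
  simp only [Matrix.map_apply] at l1 l3 a1 a2 a3 a4 a5 a6 a7 a8 a9 a10 a11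
  refine ⟨?_, fun h => l1 (by omega), fun h => ?_, fun h => ?_, fun h => ?_, fun h => ?_,
    fun h => ?_, fun h => ?_, fun h => ?_, fun h => ?_, fun h => a8 (by omega),
    fun h => a9 (by omega), fun h' => ?_, fun h => a11 (by omega)⟩
  · -- `tr A` is the logarithmic derivative of `det F = 1`
    obtain ⟨b00, -, -, b11⟩ := entries_of_mul_eq (toLaurent_det (hF.2 τ hτ)) (hs τ hτ).2
    have hd := congrArg (fun f : PowerSeries ℂ => (f : LaurentSeries ℂ))
      (deformSeries_det h.isOpen hτ hα hF)
    simp only [PowerSeries.coe_add, PowerSeries.coe_sub, PowerSeries.coe_mul,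
      PowerSeries.coe_zero] at hd
    rw [eq_neg_iff_add_eq_zero]
    apply expInf_injective
    rw [expInf_add, expInf_zero]
    simp only [Matrix.map_apply, toLaurent] at b00 b11
    rw [b00, b11]
    linear_combination hd
  · rw [expInf_add, expInf_pow, expInf_mul]; exact l3 (by omega)
  · rw [expInf_div]; exact a1 (by omega)
  · rw [expInf_div]; exact a2 (by omega)
  · rw [expInf_div]; exact a3 (by omega)
  · rw [expInf_div]; exact a4 (by omega)
  · rw [expInf_sub, expInf_mul, expInf_div]; exact a5 (by omega)
  · rw [expInf_sub, expInf_mul, expInf_div]; exact a6 (by omega)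
  · rw [expInf_sub, expInf_mul, expInf_div]; exact a7 (by omega)
  · rw [expInf_div, a10 (by omega), h']

end GeoLax

namespace GeoLax

variable {D : Setting}

/-! ### Comparison of rational functions by their polar parts -/

theorem holAt_sub_of_coeff {a : ℂ} {f g : RatFunc ℂ}
    (h : ∀ j : ℕ, 1 ≤ j → (expAt a f).coeff (-(j : ℤ)) = (expAt a g).coeff (-(j : ℤ))) :
    HolAt a (f - g) := fun k hk => by
  obtain ⟨j, rfl⟩ : ∃ j : ℕ, k = -(j : ℤ) := ⟨(-k).toNat, by omega⟩
  rw [expAt_sub, coeff_sub, h j (by omega), sub_self]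

theorem vanishesTo_one_sub_of_coeff {x y : LaurentSeries ℂ}
    (h : ∀ j : ℕ, x.coeff (-(j : ℤ)) = y.coeff (-(j : ℤ))) : VanishesTo 1 (x - y) := fun k hk => by
  obtain ⟨j, rfl⟩ : ∃ j : ℕ, k = -(j : ℤ) := ⟨(-k).toNat, by omega⟩
  rw [coeff_sub, h j, sub_self]

/-- A rational function is the sum of its polynomial part and of its polar parts. -/
theorem eq_add_polar {ι : Type*} [Fintype ι] {x : ι → ℂ} (hx : Function.Injective x) {r : ι → ℕ}
    {c : ι → ℕ → ℂ} {f p : RatFunc ℂ} (hf : ∀ a, (∀ s, a ≠ x s) → HolAt a f)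
    (hv : ∀ s, VanishesTo (-(r s : ℤ)) (expAt (x s) f))
    (hc : ∀ s j, 1 ≤ j → j ≤ r s → (expAt (x s) f).coeff (-(j : ℤ)) = c s j)
    (hp : ∀ a, HolAt a p) (hinf : VanishesTo 1 (expInf f - expInf p)) :
    f = p + polar x r c := by
  refine eq_of_holAt_sub (fun a => ?_) ?_
  · rw [sub_add_eq_sub_sub_swap]
    refine HolAt.sub ?_ (hp a)
    by_cases ha : ∃ s, a = x s
    · obtain ⟨s, rfl⟩ := ha
      refine holAt_sub_of_coeff fun j hj => ?_
      rw [coeff_expAt_polar hx s hj]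
      split_ifs with h
      · exact hc s j hj h
      · exact hv s _ (by omega)
    · push Not at ha
      exact (hf a ha).sub (holAt_polar ha)
  · rw [expInf_add, ← sub_sub]
    exact hinf.sub vanishesTo_expInf_polar

section Residues

variable {ι : Type*} [Fintype ι] {x : ι → ℂ} (hx : Function.Injective x) {f : RatFunc ℂ}
  (hf : ∀ a, (∀ s, a ≠ x s) → HolAt a f)

theorem coeff_expAt_lam_mul (a : ℂ) (f : RatFunc ℂ) (k : ℤ) :
    (expAt a (lam * f)).coeff k = a * (expAt a f).coeff k + (expAt a f).coeff (k - 1) := by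
  rw [expAt_mul, expAt_lam, add_mul, coeff_add, coeff_C_mul', coeff_single_mul, one_mul]

theorem coeff_expInf_lam_mul (f : RatFunc ℂ) (k : ℤ) :
    (expInf (lam * f)).coeff k = (expInf f).coeff (k + 1) := by
  rw [expInf_mul, expInf_lam, coeff_single_mul, one_mul, sub_neg_eq_add]

include hx hf

theorem coeff_two_expInf_eq_sum :
    (expInf f).coeff 2
      = ∑ s, (x s * (expAt (x s) f).coeff (-1) + (expAt (x s) f).coeff (-2)) := by
  have h := coeff_one_expInf_eq_sum_residues hx (f := lam * f) fun a ha => HolAt.lam.mul (hf a ha)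
  simp only [coeff_expInf_lam_mul, coeff_expAt_lam_mul] at h
  exact h

theorem coeff_three_expInf_eq_sum :
    (expInf f).coeff 3 = ∑ s, (x s ^ 2 * (expAt (x s) f).coeff (-1)
      + 2 * x s * (expAt (x s) f).coeff (-2) + (expAt (x s) f).coeff (-3)) := by
  have h := coeff_two_expInf_eq_sum hx (f := lam * f) fun a ha => HolAt.lam.mul (hf a ha)
  simp only [coeff_expInf_lam_mul, coeff_expAt_lam_mul] at h
  rw [(by norm_num : (3 : ℤ) = 2 + 1), h]
  refine Finset.sum_congr rfl fun s _ => ?_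
  norm_num
  ring

end Residues

/-! ### Lax pairs with their coordinates -/

/-- The numbers collected in `c` are those of the Lax pair `(L, A)` for the deformation vector `v`:
the coordinates `Q` and the coefficients `ν` are expansion coefficients of `L₁₂` and of
`ν = A₁₂ / L₁₂`, and `(L, A)` has the local properties forced by the formal solutions. -/
structure Describes (c : Coords D) (v : Times D) (L A : Matrix (Fin 2) (Fin 2) (RatFunc ℂ)) :
    Prop where
  inj : Function.Injective c.X
  norm : Normalized c.τ
  rep : IsRepresentative c.τ c.ω L
  A_hol : ∀ a, (∀ s, a ≠ c.X s) → ∀ i j, HolAt a (A i j)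
  ord : ∀ s, HasOrder (-(D.r s : ℤ)) (expAt (c.X s) (L 0 1))
  fin : ∀ s, FiniteData c.τ v L A s
  inf : InfinityData c.τ v c.ω c.dω L A
  QX_eq : ∀ s k, c.QX s k = (expAt (c.X s) (L 0 1)).coeff (-(k : ℤ))
  QI_eq : ∀ k, c.QI k = (expInf (L 0 1)).coeff (-(k : ℤ))
  nuX_eq : ∀ s k, c.νX s k = (expAt (c.X s) (A 0 1 / L 0 1)).coeff (k : ℤ)
  nuI_eq : ∀ k, c.νI k = (expInf (A 0 1 / L 0 1)).coeff k

namespace Describes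

variable {c : Coords D} {v : Times D} {L A : Matrix (Fin 2) (Fin 2) (RatFunc ℂ)}
  (h : Describes c v L A)

include h

theorem omega_ne : c.ω ≠ 0 := h.rep.1

theorem L_hol {a : ℂ} (ha : ∀ s, a ≠ c.X s) (i j : Fin 2) : HolAt a (L i j) := h.rep.holAt ha i j

theorem van_L (s : Fin D.n) (i j : Fin 2) : VanishesTo (-(D.r s : ℤ)) (expAt (c.X s) (L i j)) :=
  (h.fin s).van_L i j

theorem van_nu (s : Fin D.n) : VanishesTo 0 (expAt (c.X s) (A 0 1 / L 0 1)) := (h.fin s).van_nu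

theorem van_b : VanishesTo (3 - (D.rInf : ℤ)) (expInf (L 0 1)) := h.rep.expInf_entries.2.2.2.1

theorem coeff_b : (expInf (L 0 1)).coeff (3 - (D.rInf : ℤ)) = c.ω :=
  h.rep.expInf_entries.2.2.2.2.2

theorem b_ne : L 0 1 ≠ 0 := by
  intro h0
  have := h.coeff_b
  rw [h0, expInf_zero] at this
  exact h.omega_ne this.symm

theorem nu_mul_b : A 0 1 / L 0 1 * L 0 1 = A 0 1 := div_mul_cancel₀ _ h.b_ne

theorem QI_top (h3 : 3 ≤ D.rInf) : c.QI (D.rInf - 3) = c.ω := by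
  rw [h.QI_eq, ← h.coeff_b]
  congr 1
  omega

theorem hol_A_sub (s : Fin D.n) (i j : Fin 2) :
    HolAt (c.X s) (A i j - A 0 1 / L 0 1 * L i j) := (h.fin s).hol_A i j

theorem van_A (s : Fin D.n) (i j : Fin 2) : VanishesTo (-(D.r s : ℤ)) (expAt (c.X s) (A i j)) := by
  have h1 : A i j = (A i j - A 0 1 / L 0 1 * L i j) + A 0 1 / L 0 1 * L i j := by ring
  rw [h1, expAt_add, expAt_mul]
  exact ((h.hol_A_sub s i j).mono (by omega)).add ((h.van_nu s).mul' (h.van_L s i j) (by omega))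

/-- At a finite pole, `A` and `ν L` have the same singular part. -/
theorem coeff_expAt_A (s : Fin D.n) (i j : Fin 2) {k : ℕ} (hk : 1 ≤ k) :
    (expAt (c.X s) (A i j)).coeff (-(k : ℤ))
      = ∑ m ∈ Finset.range (D.r s + 1 - k),
          c.νX s m * (expAt (c.X s) (L i j)).coeff (-((k + m : ℕ) : ℤ)) := by
  have h1 : A i j = (A i j - A 0 1 / L 0 1 * L i j) + A 0 1 / L 0 1 * L i j := by ring
  rw [h1, expAt_add, expAt_mul, coeff_add, h.hol_A_sub s i j _ (by omega), zero_add]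
  by_cases hkr : k ≤ D.r s
  · have h2 := (h.van_nu s).coeff_mul (h.van_L s i j) (D.r s - k)
    rw [(by omega : 0 + -(D.r s : ℤ) + ((D.r s - k : ℕ) : ℤ) = -(k : ℤ)),
      (by omega : D.r s - k + 1 = D.r s + 1 - k)] at h2
    rw [h2]
    refine Finset.sum_congr rfl fun m hm => ?_
    rw [h.nuX_eq, zero_add]
    congr 2
    rw [Finset.mem_range] at hm
    omega
  · rw [(h.van_nu s).mul (h.van_L s i j) _ (by omega), (by omega : D.r s + 1 - k = 0),
      Finset.range_zero, Finset.sum_empty]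

theorem coeff_expAt_A01 (s : Fin D.n) {j : ℕ} (hj : 1 ≤ j) :
    (expAt (c.X s) (A 0 1)).coeff (-(j : ℤ))
      = ∑ k ∈ Finset.Icc j (D.r s), c.νX s (k - j) * c.QX s k := by
  rw [h.coeff_expAt_A s 0 1 hj]
  refine Finset.sum_nbij' (fun m => j + m) (fun k => k - j) ?_ ?_ ?_ ?_ ?_ <;>
    simp only [Finset.mem_Icc, Finset.mem_range] <;> intro m hm
  · omega
  · omega
  · omega
  · omega
  · rw [h.QX_eq, Nat.add_sub_cancel_left]

theorem A01_hol : ∀ a, (∀ s, a ≠ c.X s) → HolAt a (A 0 1) := fun a ha => h.A_hol a ha 0 1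

theorem b_hol : ∀ a, (∀ s, a ≠ c.X s) → HolAt a (L 0 1) := fun _ ha => h.L_hol ha 0 1

theorem nuQ₁_eq : c.nuQ₁ = (expInf (A 0 1)).coeff 1 := by
  rw [coeff_one_expInf_eq_sum_residues h.inj h.A01_hol, Coords.nuQ₁]
  exact Finset.sum_congr rfl fun s _ => (h.coeff_expAt_A01 s (j := 1) le_rfl).symm

theorem nuQ₂_eq : c.nuQ₂ = (expInf (A 0 1)).coeff 2 := by
  rw [coeff_two_expInf_eq_sum h.inj h.A01_hol, Coords.nuQ₂]
  refine Finset.sum_congr rfl fun s _ => ?_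
  rw [← h.coeff_expAt_A01 s (j := 1) le_rfl, ← h.coeff_expAt_A01 s (j := 2) (by norm_num)]
  exact add_comm _ _

theorem sum_QX_one : ∑ s, c.QX s 1 = (expInf (L 0 1)).coeff 1 := by
  rw [coeff_one_expInf_eq_sum_residues h.inj h.b_hol]
  exact Finset.sum_congr rfl fun s _ => h.QX_eq s 1

theorem sum_QX_two : ∑ s, (c.QX s 2 + c.X s * c.QX s 1) = (expInf (L 0 1)).coeff 2 := by
  rw [coeff_two_expInf_eq_sum h.inj h.b_hol]
  refine Finset.sum_congr rfl fun s _ => ?_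
  rw [h.QX_eq, h.QX_eq, add_comm]
  rfl

theorem sigma_eq : c.sigma = (expInf (L 0 1)).coeff 3 := by
  rw [coeff_three_expInf_eq_sum h.inj h.b_hol, Coords.sigma]
  refine Finset.sum_congr rfl fun s _ => ?_
  rw [h.QX_eq, h.QX_eq, h.QX_eq]
  rfl

/-! ### The coefficients `ν` -/

/-- The Toeplitz system at `X_s`, as the coefficients of `ν T' = 𝓛_α[T] + O(1)`. -/
theorem sum_nuX_mul (s : Fin D.n) {i : ℕ} (hi : i < D.r s) :
    ∑ j ∈ Finset.range (i + 1), c.νX s j * tX c.τ s (D.r s - 1 - (i - j))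
      = -(poleComp v s (D.r s - i) / ((D.r s - i : ℕ) : ℂ))
        - posComp v s * tX c.τ s (D.r s - 1 - i) := by
  have h1 := (h.fin s).nu_T (-((D.r s - i : ℕ) : ℤ)) (by omega)
  have h2 := (h.van_nu s).coeff_mul (vanishesTo_dLamTX c.τ s) i
  rw [coeff_sub, (by omega : -((D.r s - i : ℕ) : ℤ) = 0 + -(D.r s : ℤ) + (i : ℤ)),
    sub_eq_zero] at h1
  change ((expAt (c.X s) (A 0 1 / L 0 1)) * dLamTX c.τ s).coeff (0 + -(D.r s : ℤ) + (i : ℤ))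
    = (deformTX v c.τ s).coeff (0 + -(D.r s : ℤ) + (i : ℤ)) at h1
  rw [h2, coeff_deformTX, coeff_dLamTX, if_pos (by omega)] at h1
  rw [(by omega : (-(0 + -(D.r s : ℤ) + (i : ℤ))).toNat = D.r s - i),
    (by omega : (-(0 + -(D.r s : ℤ) + (i : ℤ)) - 1).toNat = D.r s - 1 - i)] at h1
  rw [← h1]
  refine Finset.sum_congr rfl fun j hj => ?_
  rw [Finset.mem_range] at hj
  rw [h.nuX_eq, zero_add, coeff_dLamTX, if_pos (by omega)]
  congr 2
  omega

theorem nuX_zero (s : Fin D.n) : c.νX s 0 = -posComp v s := by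
  have h1 := h.sum_nuX_mul s (i := 0) (D.one_le_r s)
  have h2 : poleComp v s (D.r s - 0) = 0 := by
    rw [poleComp, dif_neg]
    have := D.one_le_r s
    omega
  have h3 : tX c.τ s (D.r s - 1) ≠ 0 := (h.fin s).t_ne
  rw [h2] at h1
  simp only [zero_add, Finset.sum_range_one, Nat.sub_zero, zero_div, neg_zero, zero_sub,
    ← neg_mul] at h1
  exact mul_right_cancel₀ h3 h1

end Describes

theorem sum_fin_ite_le {n : ℕ} (i : Fin n) (f : ℕ → ℂ) (g : ℕ → ℂ) :
    ∑ j : Fin n, (if j ≤ i then f j else 0) * g j = ∑ j ∈ Finset.range (i + 1), f j * g j := by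
  have h1 : ∀ j : Fin n, (if j ≤ i then f j else 0) * g j
      = (fun k : ℕ => if k ≤ i then f k * g k else 0) j := fun j => by
    simp only [Fin.le_def, ite_mul, zero_mul]
  simp_rw [h1]
  rw [Fin.sum_univ_eq_sum_range (fun k : ℕ => if k ≤ (i : ℕ) then f k * g k else 0) n,
    ← Finset.sum_filter]
  refine Finset.sum_congr ?_ fun _ _ => rfl
  ext k
  rw [Finset.mem_filter, Finset.mem_range, Finset.mem_range]
  have := i.2
  omega

namespace Describes

variable {c : Coords D} {v : Times D} {L A : Matrix (Fin 2) (Fin 2) (RatFunc ℂ)}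
  (h : Describes c v L A)

include h

theorem matX_mulVec (s : Fin D.n) :
    (matX c.τ s).mulVec (fun i : Fin (D.r s - 1) => c.νX s ((i : ℕ) + 1))
      = fun i : Fin (D.r s - 1) => -(poleComp v s (D.r s - 1 - (i : ℕ))
          / ((D.r s - 1 - (i : ℕ) : ℕ) : ℂ)) := by
  funext i
  have hi := i.2
  have h1 := h.sum_nuX_mul s (i := i + 1) (by omega)
  rw [Finset.sum_range_succ', h.nuX_zero, Nat.sub_zero] at h1
  change ∑ j : Fin (D.r s - 1), (if j ≤ i then tX c.τ s (D.r s - 1 - ((i : ℕ) - (j : ℕ))) else 0)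
    * c.νX s ((j : ℕ) + 1) = _
  rw [sum_fin_ite_le i (fun j => tX c.τ s (D.r s - 1 - ((i : ℕ) - j))) (fun j => c.νX s (j + 1)),
    (by omega : D.r s - 1 - (i : ℕ) = D.r s - (i + 1))]
  simp only [Nat.add_sub_add_right] at h1
  simp only [mul_comm (tX _ _ _)]
  linear_combination h1

theorem matInf_mulVec :
    (matInf c.τ).mulVec (fun i : Fin (D.rInf - 3) => c.νI (((i : ℕ) : ℤ) + 1))
      = fun i : Fin (D.rInf - 3) => infComp v (D.rInf - 3 - (i : ℕ))
          / ((D.rInf - 3 - (i : ℕ) : ℕ) : ℂ) := by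
  funext i
  have hi := i.2
  have h1 := h.inf.nu_T (by omega) (3 - (D.rInf : ℤ) + i) (by omega)
  have h2 := (h.inf.van_nu_three (by omega)).coeff_mul (vanishesTo_dLamTInf c.τ) i
  rw [(by ring : 1 + (2 - (D.rInf : ℤ)) + (i : ℕ) = 3 - (D.rInf : ℤ) + i)] at h2
  rw [coeff_sub, sub_eq_zero, h2, coeff_deformTInf,
    (by omega : (-(3 - (D.rInf : ℤ) + i)).toNat = D.rInf - 3 - i)] at h1
  change ∑ j : Fin (D.rInf - 3), (if j ≤ i then tInf c.τ (D.rInf - 1 - ((i : ℕ) - (j : ℕ))) else 0)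
    * c.νI (((j : ℕ) : ℤ) + 1) = _
  rw [sum_fin_ite_le i (fun j => tInf c.τ (D.rInf - 1 - ((i : ℕ) - j)))
    (fun j => c.νI ((j : ℤ) + 1)), ← neg_inj, ← h1, ← Finset.sum_neg_distrib]
  refine Finset.sum_congr rfl fun j hj => ?_
  rw [Finset.mem_range] at hj
  rw [h.nuI_eq, coeff_dLamTInf, if_pos (by omega), mul_comm, add_comm (j : ℤ) 1, mul_neg]
  congr 4
  omega

/-- The expansion of `A₁₂ = ν L₁₂` at infinity, from its first possibly nonzero coefficient on. -/
theorem coeff_expInf_A01 (h3 : 3 ≤ D.rInf) (k : ℕ) :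
    (expInf (A 0 1)).coeff (4 - (D.rInf : ℤ) + k)
      = ∑ i ∈ Finset.range (k + 1),
        c.νI (i + 1) * (expInf (L 0 1)).coeff (3 - (D.rInf : ℤ) + k - i) := by
  rw [← h.nu_mul_b, expInf_mul, (by ring : 4 - (D.rInf : ℤ) + k = 1 + (3 - (D.rInf : ℤ)) + k),
    (h.inf.van_nu_three h3).coeff_mul h.van_b k]
  refine Finset.sum_congr rfl fun i _ => ?_
  rw [h.nuI_eq, add_comm 1 (i : ℤ)]

theorem omega_mul_nuI_sub_two (h3 : 3 ≤ D.rInf) :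
    c.ω * c.νI ((D.rInf : ℤ) - 2)
      = c.nuQ₁ - ∑ j ∈ Finset.Icc 1 (D.rInf - 3), c.νI j * c.QI (j - 1) := by
  obtain ⟨n, hn⟩ : ∃ n, D.rInf = n + 3 := ⟨D.rInf - 3, by omega⟩
  have h1 := h.coeff_expInf_A01 h3 n
  have hb := h.coeff_b
  rw [hn] at h1 hb ⊢
  push_cast at h1 hb ⊢
  rw [(by ring : 4 - ((n : ℤ) + 3) + n = 1), ← h.nuQ₁_eq, Finset.sum_range_succ,
    add_sub_cancel_right, hb] at h1
  rw [h1, (by ring : (n : ℤ) + 3 - 2 = n + 1)]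
  have h2 : ∑ i ∈ Finset.range n, c.νI (i + 1) * (expInf (L 0 1)).coeff (3 - ((n : ℤ) + 3) + n - i)
      = ∑ j ∈ Finset.Icc 1 n, c.νI j * c.QI (j - 1) := by
    refine Finset.sum_nbij' (fun i => i + 1) (fun j => j - 1) ?_ ?_ ?_ ?_ ?_ <;>
      simp only [Finset.mem_Icc, Finset.mem_range] <;> intro m hm
    · omega
    · omega
    · omega
    · omega
    · rw [h.QI_eq, Nat.add_sub_cancel]
      push_cast
      congr 2
      ring
  rw [h2]
  ring

theorem omega_mul_nuI_sub_one (h3 : 3 ≤ D.rInf) :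
    c.ω * c.νI ((D.rInf : ℤ) - 1)
      = c.nuQ₂ - ∑ j ∈ Finset.Icc 2 (D.rInf - 2), c.νI j * c.QI (j - 2)
        - c.νI 1 * ∑ s, c.QX s 1 := by
  obtain ⟨n, hn⟩ : ∃ n, D.rInf = n + 3 := ⟨D.rInf - 3, by omega⟩
  have h1 := h.coeff_expInf_A01 h3 (n + 1)
  have hb := h.coeff_b
  rw [hn] at h1 hb ⊢
  rw [Finset.sum_range_succ, Finset.sum_range_succ'] at h1
  push_cast at h1 hb ⊢
  rw [(by ring : 4 - ((n : ℤ) + 3) + (n + 1) = 2), ← h.nuQ₂_eq, add_sub_cancel_right, hb,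
    (by ring : 3 - ((n : ℤ) + 3) + (n + 1) - 0 = 1), ← h.sum_QX_one] at h1
  rw [h1, (by ring : (n : ℤ) + 3 - 1 = n + 1 + 1)]
  have h2 : ∑ i ∈ Finset.range n, c.νI (i + 1 + 1)
        * (expInf (L 0 1)).coeff (3 - ((n : ℤ) + 3) + (n + 1) - (i + 1))
      = ∑ j ∈ Finset.Icc 2 (n + 1), c.νI j * c.QI (j - 2) := by
    refine Finset.sum_nbij' (fun i => i + 2) (fun j => j - 2) ?_ ?_ ?_ ?_ ?_ <;>
      simp only [Finset.mem_Icc, Finset.mem_range] <;> intro m hm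
    · omega
    · omega
    · omega
    · omega
    · rw [h.QI_eq, Nat.add_sub_cancel]
      push_cast
      congr 2
      ring
  rw [h2]
  ring

theorem nuQ₁_of_rInf_eq_two (h2 : D.rInf = 2) : c.nuQ₁ = c.ω * c.νI 0 := by
  have hb := h.van_b
  have hbc := h.coeff_b
  rw [h2] at hb hbc
  rw [h.nuQ₁_eq, ← h.nu_mul_b, expInf_mul,
    (h.inf.van_nu_two h2).coeff_mul_low hb (by norm_num), hbc, h.nuI_eq, mul_comm]

theorem nuQ_of_rInf_eq_one (h1 : D.rInf = 1) : c.ω * c.νI (-1) = c.nuQ₁ ∧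
    c.sigma * c.νI (-1) + c.ω * c.νI 0 = c.nuQ₂ := by
  have hb := h.van_b
  have hbc := h.coeff_b
  rw [h1] at hb hbc
  constructor
  · rw [h.nuQ₁_eq, ← h.nu_mul_b, expInf_mul,
      (h.inf.van_nu_one h1).coeff_mul_low hb (by norm_num), hbc, h.nuI_eq, mul_comm]
  · rw [h.nuQ₂_eq, h.sigma_eq, ← h.nu_mul_b, expInf_mul (A 0 1 / L 0 1),
      (h.inf.van_nu_one h1).coeff_mul_succ hb (by norm_num), hbc, h.nuI_eq, h.nuI_eq]
    norm_num
    ring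

/-! ### The upper right entries -/

theorem L01_eq : L 0 1 = c.L12 := by
  have h1 : L 0 1 = (polyOf (D.rInf - 3) c.QI
      + if 3 ≤ D.rInf then RatFunc.C c.ω * lam ^ (D.rInf - 3) else 0) + polar c.X D.r c.QX := by
    refine eq_add_polar h.inj h.b_hol (fun s => h.van_L s 0 1) (fun s j _ _ => (h.QX_eq s j).symm)
      (fun a => (holAt_polyOf _ _ _).add ?_) (vanishesTo_one_sub_of_coeff fun j => ?_)
    · split_ifs
      · exact (HolAt.C _).mul (HolAt.lam.pow _)
      · exact .zero
    · rw [expInf_add, coeff_add, coeff_expInf_polyOf]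
      rcases lt_trichotomy (j + 3) D.rInf with hj | hj | hj
      · rw [if_pos (by omega), if_pos (by omega), expInf_mul, expInf_C, coeff_C_mul',
          expInf_lam_pow, coeff_single, if_neg (by omega), mul_zero, add_zero, h.QI_eq]
        simp
      · rw [if_neg (by omega), if_pos (by omega), expInf_mul, expInf_C, coeff_C_mul',
          expInf_lam_pow, coeff_single, if_pos (by omega), mul_one, zero_add, ← h.coeff_b]
        congr 1
        omega
      · rw [if_neg (by omega), zero_add, h.van_b _ (by omega)]
        split_ifs with h3
        · rw [expInf_mul, expInf_C, coeff_C_mul', expInf_lam_pow, coeff_single, if_neg (by omega),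
            mul_zero]
        · rw [expInf_zero, coeff_zero]
  conv_lhs => rw [h1]
  rw [Coords.L12, polyOf, polar]
  simp only [Coords.pw]
  ring

end Describes

end GeoLax

namespace GeoLax

variable {D : Setting}

/-! ### Values at a point of holomorphy -/

theorem HolAt.coeff_zero_mul {a : ℂ} {f g : RatFunc ℂ} (hf : HolAt a f) (hg : HolAt a g) :
    (expAt a (f * g)).coeff 0 = (expAt a f).coeff 0 * (expAt a g).coeff 0 := by
  rw [expAt_mul]
  exact VanishesTo.coeff_mul_low hf hg (add_zero 0).symm

theorem HolAt.coeff_zero_pow {a : ℂ} {f : RatFunc ℂ} (hf : HolAt a f) (k : ℕ) :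
    (expAt a (f ^ k)).coeff 0 = (expAt a f).coeff 0 ^ k := by
  induction k with
  | zero => simp [expAt_one]
  | succ k ih => rw [pow_succ, pow_succ, (hf.pow k).coeff_zero_mul hf, ih]

theorem coeff_zero_expAt_C (a c : ℂ) : (expAt a (RatFunc.C c)).coeff 0 = c := by
  rw [expAt_C, C_apply, coeff_single_same]

theorem coeff_zero_expAt_lam (a : ℂ) : (expAt a lam).coeff 0 = a := by
  rw [expAt_lam, coeff_add, C_apply, coeff_single_same, coeff_single_of_ne (by norm_num), add_zero]

theorem coeff_zero_expAt_pw {a x : ℂ} (h : a ≠ x) (k : ℕ) :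
    (expAt a ((lam - RatFunc.C x) ^ k)⁻¹).coeff 0 = ((a - x) ^ k)⁻¹ := by
  have h1 := (holAt_pw h k).coeff_zero_mul ((holAt_lam_sub a x).pow k)
  rw [inv_mul_cancel₀ (pow_ne_zero _ (lam_sub_ne_zero x)), expAt_one,
    (holAt_lam_sub a x).coeff_zero_pow, coeff_zero_expAt_lam_sub] at h1
  exact eq_inv_of_mul_eq_one_left (h1.symm.trans (by simp))

theorem coeff_zero_expAt_polyOf (a : ℂ) (N : ℕ) (c : ℕ → ℂ) :
    (expAt a (polyOf N c)).coeff 0 = ∑ k ∈ Finset.range N, c k * a ^ k := by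
  rw [polyOf, expAt_sum, coeff_sum]
  refine Finset.sum_congr rfl fun k _ => ?_
  rw [(HolAt.C _).coeff_zero_mul (HolAt.lam.pow k), HolAt.lam.coeff_zero_pow, coeff_zero_expAt_C,
    coeff_zero_expAt_lam]

theorem coeff_zero_expAt_polar {ι : Type*} [Fintype ι] {x : ι → ℂ} {r : ι → ℕ} {c : ι → ℕ → ℂ}
    {a : ℂ} (h : ∀ s, a ≠ x s) : (expAt a (polar x r c)).coeff 0
      = ∑ s, ∑ k ∈ Finset.Icc 1 (r s), c s k * ((a - x s) ^ k)⁻¹ := by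
  rw [polar, expAt_sum, coeff_sum]
  refine Finset.sum_congr rfl fun s _ => ?_
  rw [expAt_sum, coeff_sum]
  refine Finset.sum_congr rfl fun k _ => ?_
  rw [(HolAt.C _).coeff_zero_mul (holAt_pw (h s) k), coeff_zero_expAt_C,
    coeff_zero_expAt_pw (h s)]

/-! ### Derivatives of the coordinates `Q` -/

section Derivatives

variable {g : ℕ} (τ : Times D) (w : ℂ) (q : Fin g → ℂ) (i : Fin g)

/-- `factorized` with its `i`-th zero removed. -/
noncomputable def cofactor : RatFunc ℂ :=
  RatFunc.C w * (∏ j ∈ Finset.univ.erase i, (lam - RatFunc.C (q j)))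
    / ∏ s, (lam - RatFunc.C (posComp τ s)) ^ D.r s

theorem factorized_update (x : ℂ) : factorized τ w (Function.update q i x)
    = (lam - RatFunc.C x) * cofactor τ w q i := by
  have : ∏ j ∈ Finset.univ.erase i, (lam - RatFunc.C (Function.update q i x j))
      = ∏ j ∈ Finset.univ.erase i, (lam - RatFunc.C (q j)) :=
    Finset.prod_congr rfl fun j hj => by rw [Function.update_of_ne (Finset.ne_of_mem_erase hj)]
  rw [factorized, cofactor, ← Finset.mul_prod_erase _ _ (Finset.mem_univ i), this,
    Function.update_self]
  ring

theorem factorized_eq_mul_cofactor :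
    factorized τ w q = (lam - RatFunc.C (q i)) * cofactor τ w q i := by
  rw [← factorized_update, Function.update_eq_self]

theorem deriv_sub_mul_const (u v x : ℂ) : deriv (fun x => u - x * v) x = -v := by
  simp

theorem deriv_QInf (k : ℕ) : deriv (fun x => QInf τ w (Function.update q i x) k) (q i)
    = -(expInf (cofactor τ w q i)).coeff (-(k : ℤ)) := by
  simp only [QInf, factorized_update, sub_mul, expInf_sub, coeff_sub, expInf_mul (RatFunc.C _),
    expInf_C, coeff_C_mul']
  exact deriv_sub_mul_const _ _ _

theorem deriv_QX (s : Fin D.n) (k : ℕ) :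
    deriv (fun x => QX τ w (Function.update q i x) s k) (q i)
      = -(expAt (posComp τ s) (cofactor τ w q i)).coeff (-(k : ℤ)) := by
  simp only [QX, factorized_update, sub_mul, expAt_sub, coeff_sub, expAt_mul _ (RatFunc.C _),
    expAt_C, coeff_C_mul']
  exact deriv_sub_mul_const _ _ _

end Derivatives

theorem sum_Icc_sub_pred (f : ℕ → ℂ) (n : ℕ) :
    ∑ k ∈ Finset.Icc 1 n, (f k - f (k - 1)) = f n - f 0 := by
  induction n with
  | zero => simp
  | succ n ih => rw [Finset.sum_Icc_succ_top (by omega), ih, Nat.add_sub_cancel]; ring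

/-- Abel summation for the polynomial part: multiplication by (spectral parameter) - `x` becomes
`β k - x β (k + 1)` on coefficients, and evaluation at `x` telescopes. -/
theorem telescope_poly (N : ℕ) (x : ℂ) (P β : ℕ → ℂ) (hβ : β N = 0) :
    ∑ k ∈ Finset.range N,
        (∑ m ∈ Finset.range (N - k), P m * (β (k + m) - x * β (k + 1 + m))) * x ^ k
      = ∑ m ∈ Finset.range N, P m * β m := by
  simp_rw [Finset.sum_mul]
  rw [Finset.sum_comm' (t' := Finset.range N) (s' := fun m => Finset.range (N - m))
    (by intro a b; simp only [Finset.mem_range]; omega)]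
  refine Finset.sum_congr rfl fun m hm => ?_
  rw [Finset.mem_range] at hm
  have h1 : ∀ k, P m * (β (k + m) - x * β (k + 1 + m)) * x ^ k
      = P m * ((fun k => β (k + m) * x ^ k) k - (fun k => β (k + m) * x ^ k) (k + 1)) := fun k => by
    simp only [pow_succ]; ring
  simp_rw [h1]
  rw [← Finset.mul_sum, Finset.sum_range_sub' (fun k => β (k + m) * x ^ k),
    (by omega : N - m + m = N), hβ]
  simp

/-- Abel summation for the polar parts, `u` being (evaluation point) - (pole). -/
theorem telescope_polar (r : ℕ) {u : ℂ} (hu : u ≠ 0) (P β : ℕ → ℂ) (hβ : β (r + 1) = 0) :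
    ∑ k ∈ Finset.Icc 1 r, (∑ m ∈ Finset.Icc 1 (r + 1 - k),
        P m * (β (k + m) - u * β (k + m - 1))) * (u ^ k)⁻¹
      = -∑ m ∈ Finset.Icc 1 r, P m * β m := by
  simp_rw [Finset.sum_mul]
  rw [Finset.sum_comm' (t' := Finset.Icc 1 r) (s' := fun m => Finset.Icc 1 (r + 1 - m))
    (by intro a b; simp only [Finset.mem_Icc]; omega), ← Finset.sum_neg_distrib]
  refine Finset.sum_congr rfl fun m hm => ?_
  rw [Finset.mem_Icc] at hm
  have h1 : ∀ k ∈ Finset.Icc 1 (r + 1 - m), P m * (β (k + m) - u * β (k + m - 1)) * (u ^ k)⁻¹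
      = P m * ((fun k => β (k + m) * (u ^ k)⁻¹) k - (fun k => β (k + m) * (u ^ k)⁻¹) (k - 1)) := by
    intro k hk
    rw [Finset.mem_Icc] at hk
    obtain ⟨k, rfl⟩ : ∃ k', k = k' + 1 := ⟨k - 1, by omega⟩
    simp only [Nat.add_sub_cancel, (by omega : k + 1 + m - 1 = k + m), pow_succ]
    field_simp
  rw [Finset.sum_congr rfl h1, ← Finset.mul_sum,
    sum_Icc_sub_pred (fun k => β (k + m) * (u ^ k)⁻¹), (by omega : r + 1 - m + m = r + 1), hβ]
  simp

/-! ### The upper left entry of the Lax matrix -/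

namespace Coords

variable (c : Coords D)

/-- `(t_{∞,r_∞-1} · + g₀) / ω`, the factor of the `(1,2)` entry in the `(1,1)` entry. -/
noncomputable def linFactor : RatFunc ℂ :=
  (RatFunc.C (c.tI (D.rInf - 1)) * lam + RatFunc.C c.g₀) / RatFunc.C c.ω

/-- The coefficients of the polynomial part of the part of the `(1,1)` entry that is bilinear in
`P` and `Q`. -/
noncomputable def basePolyCoeff (k : ℕ) : ℂ :=
  -(c.ω * c.PI (D.rInf - 4 - k)) - ∑ m ∈ Finset.range (D.rInf - 4 - k), c.PI m * c.QI (k + 1 + m)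

/-- The coefficients of the polar parts of the same expression. -/
noncomputable def ringCoeff (s : Fin D.n) (k : ℕ) : ℂ :=
  ∑ m ∈ Finset.Icc 1 (D.r s + 1 - k), c.PX s m * c.QX s (k + m - 1)

theorem ring11_eq : c.ring11 = polar c.X D.r c.ringCoeff := by
  simp only [ring11, polar, ringCoeff, pw, map_sum, Finset.sum_mul]

theorem L11_eq : c.L11
    = polyOf (D.rInf - 3) c.basePolyCoeff + c.ring11 - c.linFactor * c.L12 := by
  rw [L11, ← linFactor]
  congr 2
  have h1 : ∑ k ∈ Finset.range (D.rInf - 4), ∑ m ∈ Finset.range (D.rInf - 4 - k),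
        RatFunc.C (c.PI m * c.QI (k + 1 + m)) * lam ^ k
      = ∑ k ∈ Finset.range (D.rInf - 3), ∑ m ∈ Finset.range (D.rInf - 4 - k),
        RatFunc.C (c.PI m * c.QI (k + 1 + m)) * lam ^ k := by
    refine Finset.sum_subset (fun k hk => ?_) fun k hk hk' => ?_
    · rw [Finset.mem_range] at hk ⊢
      omega
    · rw [Finset.mem_range] at hk hk'
      rw [(by omega : D.rInf - 4 - k = 0), Finset.range_zero, Finset.sum_empty]
  rw [h1, polyOf, Finset.mul_sum, ← Finset.sum_sub_distrib]
  refine Finset.sum_congr rfl fun k _ => ?_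
  rw [basePolyCoeff, map_sub, map_neg, map_mul, map_sum, sub_mul, Finset.sum_mul]
  ring

theorem linFactor_eq : c.linFactor = RatFunc.C (c.tI (D.rInf - 1) / c.ω) * lam
    + RatFunc.C (c.g₀ / c.ω) := by
  rw [linFactor, map_div₀, map_div₀, add_div]
  ring

theorem coeff_expAt_linFactor_mul (a : ℂ) (f : RatFunc ℂ) (k : ℤ) :
    (expAt a (c.linFactor * f)).coeff k
      = c.tI (D.rInf - 1) / c.ω * (a * (expAt a f).coeff k + (expAt a f).coeff (k - 1))
        + c.g₀ / c.ω * (expAt a f).coeff k := by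
  rw [linFactor_eq, add_mul, expAt_add, coeff_add, mul_assoc, expAt_mul a (RatFunc.C _),
    expAt_mul a (RatFunc.C _), expAt_C, expAt_C, coeff_C_mul', coeff_C_mul', coeff_expAt_lam_mul]

theorem coeff_expInf_linFactor_mul (f : RatFunc ℂ) (k : ℤ) :
    (expInf (c.linFactor * f)).coeff k
      = c.tI (D.rInf - 1) / c.ω * (expInf f).coeff (k + 1) + c.g₀ / c.ω * (expInf f).coeff k := by
  rw [linFactor_eq, add_mul, expInf_add, coeff_add, mul_assoc, expInf_mul (RatFunc.C _),
    expInf_mul (RatFunc.C _), expInf_C, expInf_C, coeff_C_mul', coeff_C_mul', coeff_expInf_lam_mul]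

theorem holAt_linFactor (a : ℂ) : HolAt a c.linFactor := by
  rw [linFactor_eq]
  exact ((HolAt.C _).mul HolAt.lam).add (.C _)

end Coords

/-- The subleading coefficient of the `(1,2)` entry at infinity, from which `g₀` is read off. -/
theorem IsGeometricDarboux.coeff_expInf_succ {g : ℕ} {τ : Times D} {w : ℂ}
    {M : Matrix (Fin 2) (Fin 2) (RatFunc ℂ)} {q : Fin g → ℂ} {PInf : ℕ → ℂ} {PX : Fin D.n → ℕ → ℂ}
    (hQP : IsGeometricDarboux τ w M q PInf PX) (hg : g + 3 = D.rInf + ∑ s, D.r s) :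
    (expInf (M 0 1)).coeff (4 - (D.rInf : ℤ))
      = -(w * (∑ j, q j - ∑ s, (D.r s : ℂ) * posComp τ s)) := by
  obtain ⟨x, hx, hx'⟩ := factorized_expInf τ q w hg
  rw [hQP.entry12, hx, coeff_C_mul', (by ring : 4 - (D.rInf : ℤ) = 3 - (D.rInf : ℤ) + 1), hx'.2.2]
  ring

namespace Describes

variable {c : Coords D} {v : Times D} {L A : Matrix (Fin 2) (Fin 2) (RatFunc ℂ)}
  (h : Describes c v L A)

include h

theorem van_L00 : VanishesTo (2 - (D.rInf : ℤ)) (expInf (L 0 0)) := h.rep.expInf_entries.1 0 0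

theorem coeff_L00 : (expInf (L 0 0)).coeff (2 - (D.rInf : ℤ)) = -c.tI (D.rInf - 1) :=
  h.rep.expInf_entries.2.1

theorem coeff_L00_succ (h2 : 2 ≤ D.rInf) :
    (expInf (L 0 0)).coeff (3 - (D.rInf : ℤ)) = -c.tI (D.rInf - 2) := by
  have h1 := h.inf.van_L00 h2 (3 - (D.rInf : ℤ)) (by omega)
  rw [coeff_sub, coeff_dLamTInf, if_pos (by omega), sub_eq_zero] at h1
  rw [h1]
  congr 2
  omega

theorem basePolyCoeff_eq {k : ℕ} (hk : k < D.rInf - 3) :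
    c.basePolyCoeff k = -∑ m ∈ Finset.range (D.rInf - 3 - k), c.PI m * c.QI (k + 1 + m) := by
  rw [Coords.basePolyCoeff, (by omega : D.rInf - 3 - k = D.rInf - 4 - k + 1),
    Finset.sum_range_succ, (by omega : k + 1 + (D.rInf - 4 - k) = D.rInf - 3), h.QI_top (by omega)]
  ring

section Darboux

variable {g : ℕ} {q : Fin g → ℂ} (hQP : IsGeometricDarboux c.τ c.ω L q c.PI c.PX)
  (hg : g + 3 = D.rInf + ∑ s, D.r s) (hg₀ : c.g₀ = gZero c.τ L q)

include hQP

/-- The defining relation of `P` says that the part of the `(1,1)` entry bilinear in `P` and `Q`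
takes the value `p_i` at `q_i`. -/
theorem eval_base (i : Fin g) :
    (expAt (q i) (polyOf (D.rInf - 3) c.basePolyCoeff + c.ring11)).coeff 0
      = (expAt (q i) (L 0 0)).coeff 0 := by
  have hqX : ∀ s, q i ≠ c.X s := hQP.q_ne i
  have hB := hQP.entry12
  rw [factorized_eq_mul_cofactor c.τ c.ω q i] at hB
  set B := cofactor c.τ c.ω q i with hBdef
  set βI : ℕ → ℂ := fun k => (expInf B).coeff (-(k : ℤ)) with hβI
  set β : Fin D.n → ℕ → ℂ := fun s k => (expAt (c.X s) B).coeff (-(k : ℤ)) with hβ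
  have hBdiv : B = L 0 1 / (lam - RatFunc.C (q i)) := by
    rw [hB, mul_div_cancel_left₀ _ (lam_sub_ne_zero _)]
  have hQI : ∀ k, c.QI (k + 1) = βI k - q i * βI (k + 1) := fun k => by
    rw [h.QI_eq, hB, sub_mul, expInf_sub, coeff_sub, coeff_expInf_lam_mul, expInf_mul, expInf_C,
      coeff_C_mul']
    simp only [hβI]
    congr 2
    push_cast
    ring
  have hQX : ∀ s k, 1 ≤ k → c.QX s k = β s (k + 1) - (q i - c.X s) * β s k := fun s k _ => by
    rw [h.QX_eq, hB, sub_mul, expAt_sub, coeff_sub, coeff_expAt_lam_mul, expAt_mul, expAt_C,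
      coeff_C_mul']
    simp only [hβ]
    rw [(by push_cast; ring : (-((k + 1 : ℕ) : ℤ)) = -(k : ℤ) - 1)]
    ring
  have hβI0 : βI (D.rInf - 3) = 0 := by
    have : VanishesTo (4 - (D.rInf : ℤ)) (expInf B) := by
      rw [hBdiv, expInf_div]
      exact h.van_b.div' (vanishesTo_expInf_lam_sub _) (by rw [coeff_expInf_lam_sub]; simp)
        (by omega)
    by_cases h3 : 3 ≤ D.rInf
    · exact this _ (by omega)
    · exact this _ (by omega)
  have hβ0 : ∀ s, β s (D.r s + 1) = 0 := fun s => by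
    have : VanishesTo (-(D.r s : ℤ)) (expAt (c.X s) B) := by
      rw [hBdiv, expAt_div]
      exact (h.van_L s 0 1).div' (holAt_lam_sub _ _)
        (by rw [coeff_zero_expAt_lam_sub]; exact sub_ne_zero.2 (hqX s).symm) (by omega)
    exact this _ (by omega)
  have hL : HolAt (q i) (L 0 0) := h.L_hol hqX 0 0
  rw [← hL.eval_eq, hQP.p_eq i, expAt_add, coeff_add, coeff_zero_expAt_polyOf, Coords.ring11_eq,
    coeff_zero_expAt_polar hqX]
  simp only [deriv_QInf, deriv_QX]
  congr 1
  · have h1 := telescope_poly (D.rInf - 3) (q i) c.PI βI hβI0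
    simp only [mul_neg, Finset.sum_neg_distrib]
    refine Eq.trans ?_ (congrArg Neg.neg h1)
    rw [← Finset.sum_neg_distrib]
    refine Finset.sum_congr rfl fun k hk => ?_
    rw [Finset.mem_range] at hk
    rw [h.basePolyCoeff_eq hk, neg_mul]
    congr 2
    refine Finset.sum_congr rfl fun m _ => ?_
    rw [(by ring : k + 1 + m = k + m + 1), hQI]
  · refine Finset.sum_congr rfl fun s _ => ?_
    have h1 := telescope_polar (D.r s) (sub_ne_zero.2 (hqX s)) (c.PX s) (β s) (hβ0 s)
    simp only [mul_neg, Finset.sum_neg_distrib]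
    refine Eq.trans ?_ h1
    refine Finset.sum_congr rfl fun k hk => ?_
    rw [Finset.mem_Icc] at hk
    congr 1
    refine Finset.sum_congr rfl fun m hm => ?_
    rw [Finset.mem_Icc] at hm
    rw [hQX _ _ (by omega), (by omega : k + m - 1 + 1 = k + m)]

/-- The constraints on `P`, imposed for `r_∞ ≤ 2`, say that the first coefficients of `ring11` at
infinity vanish. -/
theorem vanishesTo_expInf_ring11 :
    VanishesTo (max 1 (4 - (D.rInf : ℤ))) (expInf c.ring11) := by
  have hr := D.one_le_rInf
  have h1 : VanishesTo 1 (expInf c.ring11) := by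
    rw [Coords.ring11_eq]; exact vanishesTo_expInf_polar
  have e1 : (expInf c.ring11).coeff 1
      = ∑ s, ∑ m ∈ Finset.Icc 1 (D.r s), c.PX s m * GeoLax.QX c.τ c.ω q s m := by
    rw [Coords.ring11_eq, coeff_one_expInf_polar D.one_le_r]
    refine Finset.sum_congr rfl fun s _ => Finset.sum_congr rfl fun m _ => ?_
    rw [h.QX_eq, hQP.entry12, Nat.add_sub_cancel_left]
    rfl
  have e2 : (expInf c.ring11).coeff 2
      = ∑ s, ∑ m ∈ Finset.Icc 1 (D.r s - 1), c.PX s m * GeoLax.QX c.τ c.ω q s (m + 1)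
        + ∑ s, ∑ m ∈ Finset.Icc 1 (D.r s),
          posComp c.τ s * c.PX s m * GeoLax.QX c.τ c.ω q s m := by
    rw [Coords.ring11_eq, coeff_two_expInf_polar D.one_le_r fun s hs => by
      rw [Coords.ringCoeff, (by omega : D.r s + 1 - 2 = 0)]; simp, ← Finset.sum_add_distrib]
    refine Finset.sum_congr rfl fun s _ => ?_
    rw [Coords.ringCoeff, Coords.ringCoeff, Finset.mul_sum]
    congr 1
    · rw [(by omega : D.r s + 1 - 2 = D.r s - 1)]
      refine Finset.sum_congr rfl fun m _ => ?_
      rw [h.QX_eq, hQP.entry12, (by omega : 2 + m - 1 = m + 1)]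
      rfl
    · refine Finset.sum_congr rfl fun m _ => ?_
      rw [h.QX_eq, hQP.entry12, Nat.add_sub_cancel_left, ← mul_assoc]
      rfl
  rcases (by omega : D.rInf = 1 ∨ D.rInf = 2 ∨ 3 ≤ D.rInf) with h' | h' | h'
  · rw [hQP.constraint₁ (by omega)] at e1
    rw [hQP.constraint₂ h'] at e2
    exact ((h1.succ e1).succ e2).mono (by omega)
  · rw [hQP.constraint₁ (by omega)] at e1
    exact (h1.succ e1).mono (by omega)
  · exact h1.mono (by omega)

include hg hg₀

/-- The difference of the two sides vanishes at the zeros `q_i` of `L₁₂`, by the definition of `P`,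
and is small at infinity, by the choice of `g₀` and the constraints on `P`. Its quotient by `L₁₂`
has no poles and vanishes at infinity. -/
theorem L00_add_eq : L 0 0 + c.linFactor * L 0 1
    = polyOf (D.rInf - 3) c.basePolyCoeff + c.ring11 := by
  have hr := D.one_le_rInf
  set E := L 0 0 + c.linFactor * L 0 1 - (polyOf (D.rInf - 3) c.basePolyCoeff + c.ring11) with hE
  have hω := h.omega_ne
  have hinf : VanishesTo (4 - (D.rInf : ℤ)) (expInf E) := by
    rw [hE, expInf_sub, expInf_add (polyOf _ _)]
    refine VanishesTo.sub ?_ (VanishesTo.add ?_ ((h.vanishesTo_expInf_ring11 hQP).mono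
      (le_max_right _ _)))
    · have e0 : VanishesTo (2 - (D.rInf : ℤ)) (expInf (L 0 0 + c.linFactor * L 0 1)) := by
        rw [expInf_add]
        refine h.van_L00.add fun k hk => ?_
        rw [Coords.coeff_expInf_linFactor_mul, h.van_b _ (by omega), h.van_b _ (by omega)]
        ring
      have e1 : (expInf (L 0 0 + c.linFactor * L 0 1)).coeff (2 - (D.rInf : ℤ)) = 0 := by
        rw [expInf_add, coeff_add, Coords.coeff_expInf_linFactor_mul, h.coeff_L00,
          (by ring : 2 - (D.rInf : ℤ) + 1 = 3 - D.rInf), h.coeff_b, h.van_b _ (by omega)]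
        field_simp
        ring
      have e2 : (expInf (L 0 0 + c.linFactor * L 0 1)).coeff (3 - (D.rInf : ℤ)) = 0 := by
        rw [expInf_add, coeff_add, Coords.coeff_expInf_linFactor_mul,
          (by ring : 3 - (D.rInf : ℤ) + 1 = 4 - D.rInf), h.coeff_b, hQP.coeff_expInf_succ hg, hg₀,
          gZero]
        split_ifs with h2
        · rw [h.coeff_L00_succ h2]
          simp only [Coords.tI]
          field_simp
          ring
        · obtain h1 : D.rInf = 1 := by omega
          have h3 := coeff_two_expInf_eq_sum h.inj (f := L 0 0) fun a ha => h.L_hol ha 0 0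
          rw [(by omega : 3 - (D.rInf : ℤ) = 2), h3, (by omega : D.rInf - 1 = 0)]
          simp only [Coords.tI, Coords.X]
          field_simp
          ring
      exact ((e0.succ e1).succ (by rwa [(by ring : 2 - (D.rInf : ℤ) + 1 = 3 - D.rInf)])).mono
        (by omega)
    · by_cases h3 : 3 ≤ D.rInf
      · exact (vanishesTo_expInf_polyOf _ _).mono (by omega)
      · rw [(by omega : D.rInf - 3 = 0), polyOf, Finset.range_zero, Finset.sum_empty, expInf_zero]
        exact .zero _
  have hdiv : E / L 0 1 = 0 := by
    classical
    refine eq_zero_of_holAt (fun a => ?_) ?_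
    · rw [HolAt, expAt_div]
      by_cases ha : ∃ s, a = c.X s
      · obtain ⟨s, rfl⟩ := ha
        have : VanishesTo (-(D.r s : ℤ)) (expAt (c.X s) E) := by
          rw [hE, expAt_sub, expAt_add, expAt_mul, expAt_add, Coords.ring11_eq]
          exact ((h.van_L s 0 0).add (VanishesTo.mul' (c.holAt_linFactor _) (h.van_L s 0 1)
            (by omega))).sub (((holAt_polyOf _ _ _).mono (by omega)).add
              (vanishesTo_expAt_polar h.inj s))
        exact this.div' (h.ord s).1 (h.ord s).2 (by omega)
      · push Not at ha
        have hEa : HolAt a E := ((h.L_hol ha 0 0).add ((c.holAt_linFactor a).mul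
          (h.b_hol a ha))).sub ((holAt_polyOf _ _ _).add (by
            rw [Coords.ring11_eq]; exact holAt_polar ha))
        have hord := hasOrder_expAt_factorized c.τ q hω a
        have hX : ∀ s, ¬ a = posComp c.τ s := ha
        simp only [← hQP.entry12, hX, if_false, mul_zero, Finset.sum_const_zero, sub_zero] at hord
        by_cases hq : ∃ i, a = q i
        · obtain ⟨i, rfl⟩ := hq
          have h1 : (∑ j, if q i = q j then 1 else 0 : ℤ) = 1 := by
            rw [Finset.sum_eq_single i]
            · simp
            · exact fun j _ hj => if_neg fun e => hj (hQP.q_injective e).symm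
            · simp
          rw [h1] at hord
          refine VanishesTo.div' (n := 1) (VanishesTo.succ hEa ?_) hord.1 hord.2 (by omega)
          rw [hE, expAt_sub, coeff_sub, h.eval_base hQP i, expAt_add, coeff_add, expAt_mul,
            VanishesTo.mul (c.holAt_linFactor (q i)) hord.1 _ (by norm_num)]
          ring
        · push Not at hq
          simp only [hq, if_false, Finset.sum_const_zero] at hord
          exact VanishesTo.div' hEa hord.1 hord.2 (by omega)
    · rw [expInf_div]
      exact hinf.div' h.van_b (by rw [h.coeff_b]; exact hω) (by omega)
  rcases div_eq_zero_iff.1 hdiv with h0 | h0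
  · exact sub_eq_zero.1 h0
  · exact absurd h0 h.b_ne

theorem L00_eq : L 0 0 = c.L11 := by
  rw [Coords.L11_eq, ← h.L00_add_eq hQP hg hg₀, ← h.L01_eq]
  ring

end Darboux

end Describes

end GeoLax

namespace GeoLax

variable {D : Setting}

namespace Describes

variable {c : Coords D} {v : Times D} {L A : Matrix (Fin 2) (Fin 2) (RatFunc ℂ)}
  (h : Describes c v L A)

include h

/-! ### The first row of the auxiliary matrix -/

theorem A01_eq : A 0 1 = c.A12 := by
  have hr := D.one_le_rInf
  have h1 : A 0 1 = ((if 4 ≤ D.rInf then RatFunc.C (c.ω * c.νI 1) * lam ^ (D.rInf - 4) else 0)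
      + polyOf (D.rInf - 4) fun j => c.ω * c.νI ((D.rInf : ℤ) - 3 - j)
          + ∑ k ∈ Finset.Icc (j + 1) (D.rInf - 4), c.νI ((k : ℤ) - j) * c.QI k)
      + polar c.X D.r fun s j => ∑ k ∈ Finset.Icc j (D.r s), c.νX s (k - j) * c.QX s k := by
    refine eq_add_polar h.inj h.A01_hol (fun s => h.van_A s 0 1)
      (fun s j hj _ => h.coeff_expAt_A01 s hj) (fun a => HolAt.add ?_ (holAt_polyOf _ _ _)) ?_
    · split_ifs
      · exact (HolAt.C _).mul (HolAt.lam.pow _)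
      · exact .zero
    · by_cases h4 : 4 ≤ D.rInf
      · refine vanishesTo_one_sub_of_coeff fun j => ?_
        rw [if_pos h4, expInf_add, coeff_add, expInf_mul, expInf_C, coeff_C_mul', expInf_lam_pow,
          coeff_single, coeff_expInf_polyOf]
        by_cases hj : j + 4 ≤ D.rInf
        · obtain ⟨n, hn⟩ : ∃ n, D.rInf = n + 4 + j := ⟨D.rInf - 4 - j, by omega⟩
          have h2 := h.coeff_expInf_A01 (by omega) n
          have hb := h.coeff_b
          rw [Finset.sum_range_succ, (by omega : 4 - (D.rInf : ℤ) + (n : ℤ) = -(j : ℤ)),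
            add_sub_cancel_right, hb] at h2
          have h3 : ∑ i ∈ Finset.range n,
                c.νI (i + 1) * (expInf (L 0 1)).coeff (3 - (D.rInf : ℤ) + n - i)
              = ∑ k ∈ Finset.Icc (j + 1) (D.rInf - 4), c.νI ((k : ℤ) - j) * c.QI k := by
            refine Finset.sum_nbij' (fun i => j + 1 + i) (fun k => k - (j + 1)) ?_ ?_ ?_ ?_ ?_ <;>
              simp only [Finset.mem_Icc, Finset.mem_range] <;> intro m hm
            · omega
            · omega
            · omega
            · omega
            · rw [h.QI_eq, (by push_cast; ring : ((j + 1 + m : ℕ) : ℤ) - j = m + 1)]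
              congr 2
              rw [hn]
              push_cast
              ring
          rw [h2, h3]
          rcases Nat.eq_zero_or_pos n with rfl | hn0
          · rw [if_pos (by omega), if_neg (by omega), Finset.Icc_eq_empty (by omega),
              Finset.sum_empty, Nat.cast_zero, zero_add, zero_add, add_zero, mul_comm, mul_one]
          · rw [if_neg (by omega), if_pos (by omega), (by omega : (- -(j : ℤ)).toNat = j),
              (by omega : (D.rInf : ℤ) - 3 - j = n + 1)]
            ring
        · rw [if_neg (by omega), if_neg (by omega), ← h.nu_mul_b, expInf_mul,
            (h.inf.van_nu_three (by omega)).mul h.van_b _ (by omega)]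
          ring
      · rw [if_neg h4, (by omega : D.rInf - 4 = 0), polyOf, Finset.range_zero, Finset.sum_empty,
          add_zero, expInf_zero, sub_zero]
        exact h.inf.van_A01 (by omega)
  conv_lhs => rw [h1]
  rfl

end Describes

/-- The term of order `r_s`, written separately in `A11Sing`, has the same shape as the others once
`Q_{X_s,r_s+1} = 0` is used. -/
theorem Coords.A11Sing_eq (c : Coords D) (hQ : ∀ s, c.QX s (D.r s + 1) = 0) :
    c.A11Sing = polar c.X D.r fun s k => ∑ i ∈ Finset.range (D.r s + 1 - k), c.νX s i
      * (c.ringCoeff s (k + i) - ((c.tI (D.rInf - 1) * c.X s + c.g₀) / c.ω * c.QX s (k + i)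
          + c.tI (D.rInf - 1) / c.ω * c.QX s (k + i + 1))) := by
  rw [A11Sing, polar, ← Finset.sum_add_distrib]
  refine Finset.sum_congr rfl fun s _ => ?_
  have hr := D.one_le_r s
  obtain ⟨r, hr'⟩ : ∃ r, D.r s = r + 1 := ⟨D.r s - 1, by omega⟩
  rw [hr', Finset.sum_Icc_succ_top (by omega), Nat.add_sub_cancel, add_comm]
  simp only [pw]
  congr 1
  · refine Finset.sum_congr rfl fun k hk => ?_
    rw [Finset.mem_Icc] at hk
    congr 2
    have e1 : ∑ i ∈ Finset.range (r + 1 - k + 1), c.νX s i * c.QX s (k + i + 1)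
        = ∑ i ∈ Finset.range (r + 1 - k), c.νX s i * c.QX s (k + i + 1) := by
      rw [Finset.sum_range_succ, (by omega : k + (r + 1 - k) + 1 = D.r s + 1), hQ, mul_zero,
        add_zero]
    rw [(by omega : r + 1 + 1 - k = r + 1 - k + 1), ← e1, Finset.mul_sum, Finset.mul_sum,
      ← Finset.sum_sub_distrib, ← Finset.sum_sub_distrib]
    refine Finset.sum_congr rfl fun i _ => ?_
    rw [Coords.ringCoeff, hr', mul_sub, Finset.mul_sum,
      (by omega : r + 1 + 1 - (k + i) = r + 1 - k + 1 - i)]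
    simp only [mul_assoc]
    ring
  · rw [Nat.add_sub_cancel_left, Finset.sum_range_one, Coords.ringCoeff, hr', add_zero,
      Nat.add_sub_cancel_left, Finset.Icc_self, Finset.sum_singleton, Nat.add_sub_cancel, ← hr', hQ]
    congr 2
    ring

namespace Describes

variable {c : Coords D} {v : Times D} {L A : Matrix (Fin 2) (Fin 2) (RatFunc ℂ)}
  (h : Describes c v L A)

include h

theorem tI_normalized (h3 : 3 ≤ D.rInf) : c.tI (D.rInf - 1) = 1 ∧ c.tI (D.rInf - 2) = 0 :=
  h.norm.1 h3

/-- At infinity, `A₁₁` and `ν L₁₁` have the same polynomial part up to a constant. -/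
theorem coeff_expInf_A00 (h2 : 2 ≤ D.rInf) (j : ℕ) : (expInf (A 0 0)).coeff (-(j : ℤ))
    = (if j = 0 then c.dω / (2 * c.ω) else 0)
      + (expInf (A 0 1 / L 0 1) * expInf (L 0 0)).coeff (-(j : ℤ)) := by
  have h1 : A 0 0 = (A 0 0 - A 0 1 / L 0 1 * L 0 0) + A 0 1 / L 0 1 * L 0 0 := by ring
  rw [h1, expInf_add, coeff_add, expInf_mul]
  congr 1
  split_ifs with h0
  · rw [h0, Nat.cast_zero, neg_zero]
    exact h.inf.coeff_A00_sub h2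
  · exact h.inf.van_A00_sub h2 _ (by omega)

section Base

variable (hbase : L 0 0 + c.linFactor * L 0 1
    = polyOf (D.rInf - 3) c.basePolyCoeff + c.ring11)

include hbase

theorem coeff_expInf_L00 {j : ℕ} (hj : j + 4 ≤ D.rInf) : (expInf (L 0 0)).coeff (-(j : ℤ))
    = c.basePolyCoeff j - (c.tI (D.rInf - 1) / c.ω * (expInf (L 0 1)).coeff (1 - (j : ℤ))
        + c.g₀ / c.ω * c.QI j) := by
  rw [eq_sub_of_add_eq hbase, expInf_sub, expInf_add, coeff_sub, coeff_add, coeff_expInf_polyOf,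
    if_pos (by omega), c.coeff_expInf_linFactor_mul, Coords.ring11_eq,
    vanishesTo_expInf_polar _ (by omega), h.QI_eq, (by ring : -(j : ℤ) + 1 = 1 - j)]
  simp

/-- The singular part of `A₁₁` at `X_s` is that of `ν L₁₁`. -/
theorem A00_singular (s : Fin D.n) {k : ℕ} (hk : 1 ≤ k) (hkr : k ≤ D.r s) :
    (expAt (c.X s) (A 0 0)).coeff (-(k : ℤ)) = ∑ i ∈ Finset.range (D.r s + 1 - k), c.νX s i
      * (c.ringCoeff s (k + i) - ((c.tI (D.rInf - 1) * c.X s + c.g₀) / c.ω * c.QX s (k + i)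
          + c.tI (D.rInf - 1) / c.ω * c.QX s (k + i + 1))) := by
  rw [h.coeff_expAt_A s 0 0 hk]
  refine Finset.sum_congr rfl fun i hi => ?_
  rw [Finset.mem_range] at hi
  rw [eq_sub_of_add_eq hbase, expAt_sub, expAt_add, coeff_sub, coeff_add,
    holAt_polyOf _ _ _ _ (by omega), Coords.ring11_eq, coeff_expAt_polar h.inj s (by omega),
    if_pos (by omega), c.coeff_expAt_linFactor_mul, h.QX_eq, h.QX_eq]
  rw [(by push_cast; ring : (-((k + i + 1 : ℕ) : ℤ)) = -((k + i : ℕ) : ℤ) - 1)]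
  ring

theorem A11Poly_coeff (j : ℕ) :
    (expInf (A 0 0)).coeff (-(j : ℤ)) = (expInf c.A11Poly).coeff (-(j : ℤ)) := by
  have hr := D.one_le_rInf
  have hC : ∀ x : ℂ, (expInf (RatFunc.C x)).coeff (-(j : ℤ)) = if j = 0 then x else 0 := by
    intro x
    rw [expInf_C, C_apply]
    split_ifs with h0
    · rw [h0, Nat.cast_zero, neg_zero, coeff_single_same]
    · rw [coeff_single_of_ne (by omega)]
  have hmon : ∀ (p : Prop) [Decidable p] (x : ℂ) (k : ℕ),
      (expInf (if p then RatFunc.C x * lam ^ k else 0)).coeff (-(j : ℤ))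
        = if p ∧ j = k then x else 0 := by
    intro p _ x k
    by_cases hp : p
    · rw [if_pos hp, expInf_mul, expInf_C, coeff_C_mul', expInf_lam_pow]
      by_cases hj : j = k
      · rw [hj, coeff_single_same, if_pos ⟨hp, rfl⟩, mul_one]
      · rw [coeff_single_of_ne (by omega), if_neg (fun h => hj h.2), mul_zero]
    · rw [if_neg hp, if_neg (fun h => hp h.1), expInf_zero, coeff_zero]
  have hω := h.omega_ne
  rw [Coords.A11Poly]
  rcases (by omega : D.rInf = 1 ∨ D.rInf = 2 ∨ 3 ≤ D.rInf) with h1 | h1 | h1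
  · rw [if_neg (by omega), if_pos h1, if_neg (by omega), if_neg (by omega), if_neg (by omega), h1,
      Finset.range_eq_empty_iff.2 (by omega), Finset.sum_empty, sub_zero, sub_zero, sub_zero,
      sub_zero, sub_zero, ← map_add, hC]
    split_ifs with h0
    · rw [h0, Nat.cast_zero, neg_zero, h.inf.coeff_A00 h1, h.nuI_eq, Coords.tI]
      field_simp
    · exact h.inf.van_A00 h1 _ (by omega)
  · rw [if_pos h1, if_neg (by omega), if_neg (by omega), if_neg (by omega), if_neg (by omega), h1,
      Finset.range_eq_empty_iff.2 (by omega), Finset.sum_empty, add_zero, sub_zero, sub_zero,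
      sub_zero, sub_zero, ← map_sub, hC, h.coeff_expInf_A00 (by omega)]
    have hL := h.van_L00
    have hLc := h.coeff_L00
    rw [h1] at hL hLc
    split_ifs with h0
    · rw [h0, Nat.cast_zero, neg_zero, (h.inf.van_nu_two h1).coeff_mul_low hL (by norm_num), hLc,
        h.nuI_eq]
      field_simp
      norm_num
      ring
    · rw [(h.inf.van_nu_two h1).mul hL _ (by omega), zero_add]
  · have hν := h.inf.van_nu_three h1
    have hpoly : ∀ f : ℕ → ℂ, (expInf (∑ k ∈ Finset.range (D.rInf - 5),
        RatFunc.C (f k) * lam ^ k)).coeff (-(j : ℤ)) = if j < D.rInf - 5 then f j else 0 := by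
      intro f
      refine (coeff_expInf_polyOf (D.rInf - 5) f (-(j : ℤ))).trans ?_
      rw [neg_neg, Int.toNat_natCast]
      exact if_congr (by omega) rfl rfl
    rw [if_neg (by omega : ¬ D.rInf = 2), if_neg (by omega : ¬ D.rInf = 1), sub_zero, add_zero,
      h.coeff_expInf_A00 (by omega)]
    simp only [expInf_sub, coeff_sub, hC, hmon, hpoly]
    rw [(by ring : 1 / (2 * c.ω) * c.dω = c.dω / (2 * c.ω))]
    by_cases hj : D.rInf < j + 3
    · rw [hν.mul h.van_L00 _ (by omega), if_neg (by omega : ¬ (3 ≤ D.rInf ∧ _)),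
        if_neg (by omega : ¬ (4 ≤ D.rInf ∧ _)), if_neg (by omega : ¬ (5 ≤ D.rInf ∧ _)),
        if_neg (by omega : ¬ j < D.rInf - 5)]
      ring
    obtain ⟨n, hn⟩ : ∃ n, D.rInf = n + 3 + j := ⟨D.rInf - 3 - j, by omega⟩
    have hprod := hν.coeff_mul h.van_L00 n
    rw [(by omega : 1 + (2 - (D.rInf : ℤ)) + (n : ℤ) = -(j : ℤ))] at hprod
    have a0 : (expInf (L 0 0)).coeff (2 - (D.rInf : ℤ)) = -c.tI (D.rInf - 1) := h.coeff_L00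
    have a1 : (expInf (L 0 0)).coeff (3 - (D.rInf : ℤ)) = 0 := by
      rw [h.coeff_L00_succ (by omega), (h.tI_normalized h1).2, neg_zero]
    have a2 : 5 ≤ D.rInf → (expInf (L 0 0)).coeff (4 - (D.rInf : ℤ)) = -c.kappa := fun h5 => by
      rw [(by omega : 4 - (D.rInf : ℤ) = -((D.rInf - 4 : ℕ) : ℤ)),
        h.coeff_expInf_L00 hbase (by omega), Coords.basePolyCoeff, Coords.kappa, Nat.sub_self,
        Finset.range_zero, Finset.sum_empty, h.QI_eq (D.rInf - 5),
        (by omega : 1 - ((D.rInf - 4 : ℕ) : ℤ) = -((D.rInf - 5 : ℕ) : ℤ))]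
      ring
    rw [hprod]
    match n, hn with
    | 0, hn =>
      rw [if_pos (by omega : 3 ≤ D.rInf ∧ j = D.rInf - 3), if_neg (by omega : ¬ (4 ≤ D.rInf ∧ _)),
        if_neg (by omega : ¬ (5 ≤ D.rInf ∧ _)), if_neg (by omega : ¬ j < D.rInf - 5),
        Finset.sum_range_one, h.nuI_eq, Nat.cast_zero, add_zero, add_zero, sub_zero, a0]
      ring
    | 1, hn =>
      rw [if_neg (by omega : ¬ (3 ≤ D.rInf ∧ _)), if_pos (by omega : 4 ≤ D.rInf ∧ j = D.rInf - 4),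
        if_neg (by omega : ¬ (5 ≤ D.rInf ∧ _)), if_neg (by omega : ¬ j < D.rInf - 5),
        Finset.sum_range_succ, Finset.sum_range_one, h.nuI_eq]
      push_cast
      rw [(by ring : 2 - (D.rInf : ℤ) + 1 - 0 = 3 - D.rInf), add_sub_cancel_right, a0, a1]
      norm_num
      ring
    | 2, hn =>
      rw [if_neg (by omega : ¬ (3 ≤ D.rInf ∧ _)), if_neg (by omega : ¬ (4 ≤ D.rInf ∧ _)),
        if_pos (by omega : 5 ≤ D.rInf ∧ j = D.rInf - 5), if_neg (by omega : ¬ j < D.rInf - 5),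
        Finset.sum_range_succ, Finset.sum_range_succ, Finset.sum_range_one, h.nuI_eq, h.nuI_eq]
      push_cast
      rw [(by ring : 2 - (D.rInf : ℤ) + 2 - 0 = 4 - D.rInf),
        (by ring : 2 - (D.rInf : ℤ) + 2 - 1 = 3 - D.rInf), add_sub_cancel_right, a0, a1,
        a2 (by omega)]
      norm_num
      ring
    | n + 3, hn =>
      have hrest : ∀ i ∈ Finset.range (n + 1), (expInf (A 0 1 / L 0 1)).coeff (1 + (i : ℤ))
            * (expInf (L 0 0)).coeff (2 - (D.rInf : ℤ) + ((n + 3 : ℕ) : ℤ) - i)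
          = -(c.νI ((i + 1 : ℕ) : ℤ) * (c.ω * c.PI (D.rInf - 4 - (i + 1) - j)
            + ∑ m ∈ Finset.range (D.rInf - 4 - (i + 1) - j), c.PI m * c.QI (j + (i + 1) + 1 + m)
            + (c.tI (D.rInf - 1) * c.QI (j + (i + 1) - 1) + c.g₀ * c.QI (j + (i + 1))) / c.ω)) := by
        intro i hi
        rw [Finset.mem_range] at hi
        rw [(by omega : 2 - (D.rInf : ℤ) + ((n + 3 : ℕ) : ℤ) - i = -((j + (i + 1) : ℕ) : ℤ)),
          h.coeff_expInf_L00 hbase (by omega), Coords.basePolyCoeff,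
          (by omega : D.rInf - 4 - (j + (i + 1)) = D.rInf - 4 - (i + 1) - j),
          h.QI_eq (j + (i + 1) - 1), h.nuI_eq,
          (by omega : 1 - ((j + (i + 1) : ℕ) : ℤ) = -((j + (i + 1) - 1 : ℕ) : ℤ)),
          (by push_cast; ring : 1 + (i : ℤ) = ((i + 1 : ℕ) : ℤ))]
        ring
      have hIcc : ∀ f : ℕ → ℂ, ∑ i ∈ Finset.Icc 1 (D.rInf - 5 - j), f i
          = ∑ i ∈ Finset.range (n + 1), f (i + 1) := fun f => by
        rw [Finset.range_eq_Ico, Finset.sum_Ico_add' f 0 (n + 1) 1]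
        refine Finset.sum_congr ?_ fun _ _ => rfl
        ext k
        rw [Finset.mem_Icc, Finset.mem_Ico]
        omega
      rw [if_neg (by omega : ¬ (3 ≤ D.rInf ∧ _)), if_neg (by omega : ¬ (4 ≤ D.rInf ∧ _)),
        if_neg (by omega : ¬ (5 ≤ D.rInf ∧ _)), if_pos (by omega : j < D.rInf - 5),
        Finset.sum_range_succ, Finset.sum_range_succ, Finset.sum_range_succ,
        Finset.sum_congr rfl hrest, hIcc, Finset.sum_neg_distrib, h.nuI_eq, h.nuI_eq,
        (by push_cast; ring : 2 - (D.rInf : ℤ) + ((n + 3 : ℕ) : ℤ) - ((n + 1 : ℕ) : ℤ)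
          = 4 - D.rInf),
        (by push_cast; ring : 2 - (D.rInf : ℤ) + ((n + 3 : ℕ) : ℤ) - ((n + 2 : ℕ) : ℤ)
          = 3 - D.rInf), add_sub_cancel_right, a0, a1, a2 (by omega),
        (by omega : (D.rInf : ℤ) - 2 - j = 1 + ((n + 3 : ℕ) : ℤ)),
        (by omega : (D.rInf : ℤ) - 4 - j = 1 + ((n + 1 : ℕ) : ℤ))]
      generalize (∑ i ∈ Finset.range (n + 1), c.νI _ * _) = x
      ring

theorem A00_eq : A 0 0 = c.A11 := by
  have h1 : A 0 0 = c.A11Poly + polar c.X D.r fun s k =>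
      ∑ i ∈ Finset.range (D.r s + 1 - k), c.νX s i
      * (c.ringCoeff s (k + i) - ((c.tI (D.rInf - 1) * c.X s + c.g₀) / c.ω * c.QX s (k + i)
          + c.tI (D.rInf - 1) / c.ω * c.QX s (k + i + 1))) := by
    refine eq_add_polar h.inj (fun a ha => h.A_hol a ha 0 0) (fun s => h.van_A s 0 0)
      (fun s k hk hkr => h.A00_singular hbase s hk hkr) (fun a => ?_)
      (vanishesTo_one_sub_of_coeff fun j => h.A11Poly_coeff hbase j)
    have hite : ∀ (p : Prop) [Decidable p] (f : RatFunc ℂ), HolAt a f →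
        HolAt a (if p then f else 0) := fun p _ f hf => by
      split_ifs
      · exact hf
      · exact .zero
    have hmon : ∀ (x : ℂ) (k : ℕ), HolAt a (RatFunc.C x * lam ^ k) := fun x k =>
      (HolAt.C _).mul (HolAt.lam.pow _)
    exact ((((((HolAt.C _).sub (hite _ _ (.C _))).add (hite _ _ (.C _))).sub
      (hite _ _ (hmon _ _))).sub (hite _ _ (hmon _ _))).sub (hite _ _ (hmon _ _))).sub
      (.sum fun k _ => hmon _ _)
  rw [Coords.A11, c.A11Sing_eq fun s => ?_]
  · exact h1
  · rw [h.QX_eq]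
    exact h.van_L s 0 1 _ (by omega)

end Base

end Describes

end GeoLax

namespace GeoLax

/-! ### Truncations of Laurent series -/

/-- Cutting off the coefficients of degree `-m` and above changes a series by terms of degree at
least `-m`. -/
theorem vanishesTo_expAt_sub_truncation {a : ℂ} {m n : ℕ} {x : LaurentSeries ℂ} {f : ℕ → ℂ}
    (hx : VanishesTo (-(n : ℤ)) x) (hf : ∀ k ∈ Finset.Icc (m + 1) n, f k = x.coeff (-(k : ℤ))) :
    VanishesTo (-(m : ℤ)) (expAt a (∑ k ∈ Finset.Icc (m + 1) n,
      RatFunc.C (f k) * ((lam - RatFunc.C a) ^ k)⁻¹) - x) := by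
  intro j hj
  rw [coeff_sub, expAt_sum]
  simp only [expAt_mul, expAt_C, expAt_pw_self]
  rw [coeff_sum_single_neg]
  split_ifs with h
  · rw [hf _ h.2, (by omega : -((-j).toNat : ℤ) = j), sub_self]
  · rw [Finset.mem_Icc] at h
    rw [hx _ (by omega), sub_self]

/-- The analogue at infinity, where the powers of the spectral parameter below `m` are cut off. -/
theorem vanishesTo_expInf_sub_truncation {m n : ℕ} {x : LaurentSeries ℂ} {f : ℕ → ℂ}
    (hx : VanishesTo (-(n : ℤ)) x) (hf : ∀ k ∈ Finset.Icc m n, f k = x.coeff (-(k : ℤ))) :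
    VanishesTo (1 - (m : ℤ)) (expInf (∑ k ∈ Finset.Icc m n, RatFunc.C (f k) * lam ^ k) - x) := by
  intro j hj
  rw [coeff_sub, expInf_sum]
  simp only [expInf_mul, expInf_C, expInf_lam_pow]
  rw [coeff_sum_single_neg]
  split_ifs with h
  · rw [hf _ h.2, (by omega : -((-j).toNat : ℤ) = j), sub_self]
  · rw [Finset.mem_Icc] at h
    rw [hx _ (by omega), sub_self]

/-- Subtracting the singular parts of functions that agree with `F` at the points `x s` up to
holomorphic terms removes all finite poles of `F`. -/
theorem holAt_sub_sum_singPart_of_holAt_sub {ι : Type*} [Fintype ι] {x : ι → ℂ}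
    (hx : Function.Injective x) {F : RatFunc ℂ} {f : ι → RatFunc ℂ}
    (hF : ∀ a, (∀ s, a ≠ x s) → HolAt a F) (hf : ∀ s, HolAt (x s) (F - f s)) (a : ℂ) :
    HolAt a (F - ∑ s, singPart (x s) (f s)) := by
  by_cases ha : ∃ s, a = x s
  · obtain ⟨s, rfl⟩ := ha
    have := (hf s).add (holAt_sub_sum_singPart hx f s)
    rwa [sub_add_sub_cancel] at this
  · push Not at ha
    exact (hF a ha).sub (.sum fun s _ => holAt_singPart (ha s) _)

theorem vanishesTo_expInf_sum_singPart {ι : Type*} [Fintype ι] (x : ι → ℂ) (f : ι → RatFunc ℂ) :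
    VanishesTo 1 (expInf (∑ s, singPart (x s) (f s))) := by
  rw [expInf_sum]
  exact .sum fun s _ => vanishesTo_expInf_singPart _ _

namespace Coords

variable {D : Setting} (c : Coords D)

/-! ### The squares of the exponents -/

theorem coeff_dLamTX_sq (s : Fin D.n) {j : ℕ} (hj : D.r s + 1 ≤ j) (hj' : j ≤ 2 * D.r s) :
    (dLamTX c.τ s ^ 2).coeff (-(j : ℤ)) = ∑ m ∈ Finset.range (2 * D.r s - j + 1),
      c.tX s (D.r s - 1 - m) * c.tX s (j + m - D.r s - 1) := by
  have h1 := (vanishesTo_dLamTX c.τ s).coeff_mul (vanishesTo_dLamTX c.τ s) (2 * D.r s - j)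
  rw [← pow_two, (by omega : -(D.r s : ℤ) + -(D.r s : ℤ) + ((2 * D.r s - j : ℕ) : ℤ) = -(j : ℤ))]
    at h1
  rw [h1]
  refine Finset.sum_congr rfl fun m hm => ?_
  rw [Finset.mem_range] at hm
  rw [coeff_dLamTX, coeff_dLamTX, if_pos (by omega), if_pos (by omega), tX, tX]
  congr 2 <;> omega

theorem coeff_dLamTInf_sq (h3 : 3 ≤ D.rInf) {j : ℕ} (hj : D.rInf - 3 ≤ j)
    (hj' : j ≤ 2 * D.rInf - 4) :
    (dLamTInf c.τ ^ 2).coeff (-(j : ℤ)) = ∑ m ∈ Finset.range (2 * D.rInf - 4 - j + 1),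
      c.tI (D.rInf - 1 - m) * c.tI (j + m + 3 - D.rInf) := by
  have h1 := (vanishesTo_dLamTInf c.τ).coeff_mul (vanishesTo_dLamTInf c.τ) (2 * D.rInf - 4 - j)
  rw [← pow_two, (by omega : 2 - (D.rInf : ℤ) + (2 - (D.rInf : ℤ)) + ((2 * D.rInf - 4 - j : ℕ) : ℤ)
    = -(j : ℤ))] at h1
  rw [h1]
  refine Finset.sum_congr rfl fun m hm => ?_
  rw [Finset.mem_range] at hm
  rw [coeff_dLamTInf, coeff_dLamTInf, if_pos (by omega), if_pos (by omega), neg_mul_neg, tI, tI]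
  congr 2 <;> omega

theorem vanishesTo_numX_sub (s : Fin D.n) :
    VanishesTo (-(D.r s : ℤ)) (expAt (c.X s) (c.numX s) - dLamTX c.τ s ^ 2) := by
  refine vanishesTo_expAt_sub_truncation
    (((vanishesTo_dLamTX c.τ s).pow 2).mono (by push_cast; omega)) fun k hk => ?_
  rw [Finset.mem_Icc] at hk
  rw [c.coeff_dLamTX_sq s hk.1 hk.2]

theorem vanishesTo_numInf_sub (h3 : 3 ≤ D.rInf) :
    VanishesTo (4 - (D.rInf : ℤ)) (expInf c.numInf - dLamTInf c.τ ^ 2) := by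
  refine VanishesTo.mono (vanishesTo_expInf_sub_truncation
    (((vanishesTo_dLamTInf c.τ).pow 2).mono (by push_cast; omega)) fun k hk => ?_)
    (by omega : 4 - (D.rInf : ℤ) ≤ 1 - ((D.rInf - 3 : ℕ) : ℤ))
  rw [Finset.mem_Icc] at hk
  rw [c.coeff_dLamTInf_sq h3 hk.1 hk.2]

theorem vanishesTo_expInf_A21Sing : VanishesTo 1 (expInf c.A21Sing) := by
  rw [A21Sing, expInf_add]
  exact (vanishesTo_expInf_sum_singPart _ _).add (vanishesTo_expInf_sum_singPart _ _)

theorem slope_eq_linFactor (h1 : D.rInf = 1) : c.slope = c.linFactor := by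
  rw [slope, linFactor, (by omega : D.rInf - 1 = 0)]

end Coords

namespace Describes

variable {D : Setting} {c : Coords D} {v : Times D} {L A : Matrix (Fin 2) (Fin 2) (RatFunc ℂ)}
  (h : Describes c v L A)

include h

/-- The coefficients of `N^ν_s` are those of `ν T'²`. -/
theorem vanishesTo_numNuX_sub (s : Fin D.n) : VanishesTo (-(D.r s : ℤ))
    (expAt (c.X s) (c.numNuX s) - expAt (c.X s) (A 0 1 / L 0 1) * dLamTX c.τ s ^ 2) := by
  have hT : VanishesTo (-(2 * D.r s : ℤ)) (dLamTX c.τ s ^ 2) :=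
    ((vanishesTo_dLamTX c.τ s).pow 2).mono (by push_cast; omega)
  refine vanishesTo_expAt_sub_truncation (((h.van_nu s).mul hT).mono (by push_cast; omega))
    fun k hk => ?_
  rw [Finset.mem_Icc] at hk
  have h1 := (h.van_nu s).coeff_mul hT (2 * D.r s - k)
  rw [(by omega : 0 + -(2 * D.r s : ℤ) + ((2 * D.r s - k : ℕ) : ℤ) = -(k : ℤ))] at h1
  rw [h1]
  refine Finset.sum_nbij' (fun j => j - k) (fun i => k + i) ?_ ?_ ?_ ?_ ?_ <;>
    simp only [Finset.mem_Icc, Finset.mem_range] <;> intro j hj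
  · omega
  · omega
  · omega
  · omega
  · rw [← Finset.sum_mul, ← c.coeff_dLamTX_sq s (by omega) (by omega), h.nuX_eq, mul_comm, zero_add]
    congr 2
    omega

/-- The coefficients of `N^ν_∞` are those of `ν T'²`. -/
theorem vanishesTo_numNuInf_sub (h3 : 3 ≤ D.rInf) : VanishesTo (4 - (D.rInf : ℤ))
    (expInf c.numNuInf - expInf (A 0 1 / L 0 1) * dLamTInf c.τ ^ 2) := by
  have hT : VanishesTo (4 - 2 * D.rInf : ℤ) (dLamTInf c.τ ^ 2) :=
    ((vanishesTo_dLamTInf c.τ).pow 2).mono (by push_cast; omega)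
  have hν := h.inf.van_nu_three h3
  refine VanishesTo.mono (vanishesTo_expInf_sub_truncation ((hν.mul hT).mono (by omega))
    fun k hk => ?_) (by omega : 4 - (D.rInf : ℤ) ≤ 1 - ((D.rInf - 3 : ℕ) : ℤ))
  rw [Finset.mem_Icc] at hk
  have h1 := hν.coeff_mul hT (2 * D.rInf - 5 - k)
  rw [(by omega : 1 + (4 - 2 * D.rInf : ℤ) + ((2 * D.rInf - 5 - k : ℕ) : ℤ) = -(k : ℤ))] at h1
  rw [h1]
  refine Finset.sum_nbij' (fun j => j - (k + 1)) (fun i => k + 1 + i) ?_ ?_ ?_ ?_ ?_ <;>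
    simp only [Finset.mem_Icc, Finset.mem_range] <;> intro j hj
  · omega
  · omega
  · omega
  · omega
  · rw [← Finset.sum_mul, ← c.coeff_dLamTInf_sq h3 (by omega) (by omega), h.nuI_eq, mul_comm]
    congr 2 <;> omega

/-! ### The entry `L₂₁` -/

/-- The difference is `(L₁₁² + L₁₂ L₂₁ - N_s) / L₁₂`, where the numerator has a pole of order at
most `r_s` and the denominator one of order exactly `r_s`. -/
theorem holAt_L10_sub (s : Fin D.n) :
    HolAt (c.X s) (L 1 0 - (c.numX s - L 0 0 ^ 2) / L 0 1) := by
  have hb := h.b_ne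
  have h1 : L 1 0 - (c.numX s - L 0 0 ^ 2) / L 0 1
      = (L 0 0 ^ 2 + L 0 1 * L 1 0 - c.numX s) / L 0 1 := by
    field_simp
    ring
  have h2 : VanishesTo (-(D.r s : ℤ)) (expAt (c.X s) (L 0 0 ^ 2 + L 0 1 * L 1 0 - c.numX s)) := by
    have := ((h.fin s).det).sub (c.vanishesTo_numX_sub s)
    rw [expAt_sub]
    rwa [← sub_sub_sub_cancel_right _ _ (dLamTX c.τ s ^ 2)]
  rw [h1, HolAt, expAt_div]
  exact h2.div' (h.ord s).1 (h.ord s).2 (by omega)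

theorem L10_eq_of_three_le (h00 : L 0 0 = c.L11) (h3 : 3 ≤ D.rInf) :
    L 1 0 = polyPart ((c.numInf - c.L11 ^ 2) / c.L12) + c.singL21 c.L11 := by
  have hb := h.b_ne
  rw [Coords.singL21, ← h00, ← h.L01_eq]
  refine eq_of_holAt_sub (fun a => ?_) ?_
  · rw [add_comm, ← sub_sub]
    exact (holAt_sub_sum_singPart_of_holAt_sub h.inj (fun a ha => h.L_hol ha 1 0)
      h.holAt_L10_sub a).sub (holAt_polyPart _ _)
  · have h1 : L 1 0 - (c.numInf - L 0 0 ^ 2) / L 0 1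
        = (L 0 0 ^ 2 + L 0 1 * L 1 0 - c.numInf) / L 0 1 := by
      field_simp
      ring
    have h2 : VanishesTo 1 (expInf (L 1 0 - (c.numInf - L 0 0 ^ 2) / L 0 1)) := by
      rw [h1, expInf_div, expInf_sub]
      have := (h.inf.det h3).sub (c.vanishesTo_numInf_sub h3)
      rw [sub_sub_sub_cancel_right] at this
      exact this.div' h.van_b (by rw [h.coeff_b]; exact h.omega_ne) (by omega)
    have h3 := (h2.add (vanishesTo_expInf_sub_polyPart ((c.numInf - L 0 0 ^ 2) / L 0 1))).sub
      (vanishesTo_expInf_sum_singPart c.X fun s => (c.numX s - L 0 0 ^ 2) / L 0 1)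
    rwa [expInf_sub, sub_add_sub_cancel, sub_sub, ← expInf_add] at h3

theorem van_L10 : VanishesTo (3 - (D.rInf : ℤ)) (expInf (L 1 0)) :=
  h.rep.expInf_entries.2.2.2.2.1

theorem L10_eq_of_eq_two (h00 : L 0 0 = c.L11) (h2 : D.rInf = 2) : L 1 0 = c.singL21 c.L11 := by
  rw [Coords.singL21, ← h00, ← h.L01_eq]
  exact eq_of_holAt_sub (holAt_sub_sum_singPart_of_holAt_sub h.inj (fun a ha => h.L_hol ha 1 0)
    h.holAt_L10_sub) ((h.van_L10.mono (by omega)).sub (vanishesTo_expInf_sum_singPart _ _))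

/-- In terms of `ring11 = L₁₁ + σ L₁₂`, with `σ` the slope, the singular parts at finite poles
take the same form, and `σ² L₁₂` has the constant term `t_{∞,0}² / ω` at infinity. -/
theorem L10_eq_of_eq_one (h1 : D.rInf = 1) (hρ : L 0 0 + c.slope * L 0 1 = c.ring11)
    (hvan : VanishesTo 3 (expInf c.ring11)) :
    L 1 0 = c.singL21 c.ring11 + 2 * c.slope * c.ring11 - c.slope ^ 2 * c.L12
        + RatFunc.C (c.tI 0 ^ 2 / c.ω) := by
  have hb := h.b_ne
  have hω := h.omega_ne
  have hσ : ∀ a, HolAt a c.slope := fun a => by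
    rw [c.slope_eq_linFactor h1]; exact c.holAt_linFactor a
  have hσv : VanishesTo (-1) (expInf c.slope) := fun k hk => by
    rw [c.slope_eq_linFactor h1, ← mul_one c.linFactor, c.coeff_expInf_linFactor_mul, expInf_one,
      VanishesTo.one _ (by omega), VanishesTo.one _ (by omega)]
    ring
  have hσc : (expInf c.slope).coeff (-1) = c.tI 0 / c.ω := by
    rw [c.slope_eq_linFactor h1, ← mul_one c.linFactor, c.coeff_expInf_linFactor_mul, expInf_one,
      h1]
    simp [coeff_one]
  rw [← h.L01_eq]
  suffices hF : L 1 0 - 2 * c.slope * c.ring11 + c.slope ^ 2 * L 0 1 - RatFunc.C (c.tI 0 ^ 2 / c.ω)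
      = c.singL21 c.ring11 by
    rw [← hF]; ring
  rw [Coords.singL21, ← h.L01_eq]
  refine eq_of_holAt_sub (holAt_sub_sum_singPart_of_holAt_sub h.inj (fun a ha => ?_) fun s => ?_) ?_
  · rw [← hρ]
    exact (((h.L_hol ha 1 0).sub (((HolAt.mul (by rw [HolAt, expAt_two]; exact .C 2) (hσ a))).mul
      ((h.L_hol ha 0 0).add ((hσ a).mul (h.b_hol a ha))))).add
        (((hσ a).pow 2).mul (h.b_hol a ha))).sub (.C _)
  · have h2 : L 1 0 - 2 * c.slope * c.ring11 + c.slope ^ 2 * L 0 1 - RatFunc.C (c.tI 0 ^ 2 / c.ω)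
          - (c.numX s - c.ring11 ^ 2) / L 0 1
        = (L 1 0 - (c.numX s - L 0 0 ^ 2) / L 0 1) - RatFunc.C (c.tI 0 ^ 2 / c.ω) := by
      rw [← hρ]
      field_simp
      ring
    rw [h2]
    exact (h.holAt_L10_sub s).sub (.C _)
  · refine VanishesTo.sub ?_ (vanishesTo_expInf_sum_singPart _ _)
    have hbv : VanishesTo 2 (expInf (L 0 1)) := h.van_b.mono (by omega)
    have hbc : (expInf (L 0 1)).coeff 2 = c.ω := by
      rw [← h.coeff_b]; congr 1; omega
    have hσ2 : VanishesTo (-2) (expInf c.slope ^ 2) := (hσv.pow 2).mono (by norm_num)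
    rw [expInf_sub, expInf_add, expInf_sub, expInf_mul, expInf_mul, expInf_mul, expInf_pow,
      expInf_C, expInf_two, add_sub_assoc]
    refine ((h.van_L10.mono (by omega)).sub ?_).add (VanishesTo.mono (VanishesTo.succ
      ((hσ2.mul' hbv (by norm_num)).sub (.C _)) ?_) le_rfl)
    · exact ((VanishesTo.C 2).mul hσv).mul' hvan (by norm_num)
    · rw [coeff_sub, hσ2.coeff_mul_low hbv (by norm_num), pow_two,
        hσv.coeff_mul_low hσv (by norm_num), hσc, hbc]
      simp
      field_simp
      ring

/-! ### The entry `A₂₁` -/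

theorem mixed_eq (h00 : L 0 0 = c.L11) (hA : A 0 0 = c.A11) :
    c.mixed = -(A 0 1 / L 0 1 * L 0 0 ^ 2 / L 0 1)
      - 2 * (L 0 0 / L 0 1) * (A 0 0 - A 0 1 / L 0 1 * L 0 0) := by
  have hb := h.b_ne
  rw [Coords.mixed, ← h00, ← hA, ← h.L01_eq, ← h.A01_eq]
  field_simp
  ring

/-- `A₂₁ = ν L₂₁ + O(1)`, where `ν L₂₁ = ν (L₁₁² + L₁₂ L₂₁) / L₁₂ - ν L₁₁² / L₁₂` and the last term
agrees with `mixed` up to `2 (L₁₁ / L₁₂) (A₁₁ - ν L₁₁)`, a holomorphic function. -/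
theorem holAt_A10_sub (h00 : L 0 0 = c.L11) (hA : A 0 0 = c.A11) (s : Fin D.n) :
    HolAt (c.X s) (A 1 0 - c.numNuX s / L 0 1 - c.mixed) := by
  have hb := h.b_ne
  have h1 : A 1 0 - c.numNuX s / L 0 1 - c.mixed = (A 1 0 - A 0 1 / L 0 1 * L 1 0)
      + (A 0 1 / L 0 1 * (L 0 0 ^ 2 + L 0 1 * L 1 0) - c.numNuX s) / L 0 1
      + 2 * (L 0 0 / L 0 1) * (A 0 0 - A 0 1 / L 0 1 * L 0 0) := by
    rw [h.mixed_eq h00 hA]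
    field_simp
    ring
  rw [h1]
  refine ((h.hol_A_sub s 1 0).add ?_).add (HolAt.mul (HolAt.mul
    (by rw [HolAt, expAt_two]; exact .C 2) ?_) (h.hol_A_sub s 0 0))
  · rw [HolAt, expAt_div]
    refine VanishesTo.div' (n := -(D.r s : ℤ)) ?_ (h.ord s).1 (h.ord s).2 (by omega)
    have := ((h.van_nu s).mul' (h.fin s).det (by rw [zero_add])).sub (h.vanishesTo_numNuX_sub s)
    rw [mul_sub] at this
    rw [expAt_sub, expAt_mul]
    change VanishesTo _ (_ * expAt (c.X s) (L 0 0 ^ 2 + L 0 1 * L 1 0) - _ - _) at this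
    rwa [sub_sub_sub_cancel_right] at this
  · rw [HolAt, expAt_div]
    exact (h.van_L s 0 0).div' (h.ord s).1 (h.ord s).2 (by omega)

theorem holAt_A10_sub_A21Sing (h00 : L 0 0 = c.L11) (hA : A 0 0 = c.A11) (a : ℂ) :
    HolAt a (A 1 0 - c.A21Sing) := by
  rw [Coords.A21Sing, ← h.L01_eq]
  by_cases ha : ∃ s, a = c.X s
  · obtain ⟨s, rfl⟩ := ha
    have := ((h.holAt_A10_sub h00 hA s).add (holAt_sub_sum_singPart h.inj
      (fun s => c.numNuX s / L 0 1) s)).add (holAt_sub_sum_singPart h.inj (fun _ => c.mixed) s)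
    convert this using 1
    ring
  · push Not at ha
    exact (h.A_hol a ha 1 0).sub ((HolAt.sum fun s _ => holAt_singPart (ha s) _).add
      (.sum fun s _ => holAt_singPart (ha s) _))

theorem A10_eq_of_le_two (h00 : L 0 0 = c.L11) (hA : A 0 0 = c.A11) (h2 : D.rInf ≤ 2) :
    A 1 0 = c.A21Sing :=
  eq_of_holAt_sub (h.holAt_A10_sub_A21Sing h00 hA)
    ((h.inf.van_A10 h2).sub c.vanishesTo_expInf_A21Sing)

/-- At infinity the term `2 (L₁₁ / L₁₂) (A₁₁ - ν L₁₁)` is not holomorphic: it grows linearly, and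
its polynomial part is the explicit correction in the formula for `A₂₁`. -/
theorem vanishesTo_correction (h3 : 3 ≤ D.rInf) :
    VanishesTo 1 (expInf (2 * (L 0 0 / L 0 1) * (A 0 0 - A 0 1 / L 0 1 * L 0 0))
      - expInf (-RatFunc.C (c.tI (D.rInf - 1) / c.ω ^ 2 * c.dω) * lam
        + RatFunc.C (2 / c.ω * resInf (A 0 0 - L 0 0 / L 0 1 * A 0 1))
        + RatFunc.C (1 / c.ω ^ 3 * (expInf (L 0 1)).coeff (4 - (D.rInf : ℤ)) * c.dω))) := by
  have hω := h.omega_ne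
  have hb := h.b_ne
  obtain ⟨ht, ht'⟩ := h.tI_normalized h3
  set e := A 0 0 - A 0 1 / L 0 1 * L 0 0 with he
  have hres : A 0 0 - L 0 0 / L 0 1 * A 0 1 = e := by
    rw [he]; ring
  have hev : VanishesTo 0 (expInf e) := h.inf.van_A00_sub (by omega)
  have he0 : (expInf e).coeff 0 = c.dω / (2 * c.ω) := h.inf.coeff_A00_sub (by omega)
  have hxv : VanishesTo (-1) (expInf (L 0 0 / L 0 1)) := by
    rw [expInf_div]
    exact h.van_L00.div' h.van_b (by rw [h.coeff_b]; exact hω) (by omega)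
  have hxb : expInf (L 0 0 / L 0 1) * expInf (L 0 1) = expInf (L 0 0) := by
    rw [← expInf_mul, div_mul_cancel₀ _ hb]
  have hx0 : (expInf (L 0 0 / L 0 1)).coeff (-1) = -(1 / c.ω) := by
    have := hxv.coeff_mul_low h.van_b (l := 2 - (D.rInf : ℤ)) (by ring)
    rw [hxb, h.coeff_L00, h.coeff_b, ht] at this
    field_simp
    exact this.symm
  have hx1 : (expInf (L 0 0 / L 0 1)).coeff 0
      = (expInf (L 0 1)).coeff (4 - (D.rInf : ℤ)) / c.ω ^ 2 := by
    have := hxv.coeff_mul_succ h.van_b (l := 3 - (D.rInf : ℤ)) (by ring)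
    rw [hxb, h.coeff_L00_succ (by omega), h.coeff_b, ht', hx0,
      (by ring : 3 - (D.rInf : ℤ) + 1 = 4 - D.rInf)] at this
    norm_num at this
    field_simp
    field_simp at this
    linear_combination -this
  have hp := hxv.mul hev
  have hp0 := hxv.coeff_mul_low hev (l := -1) (by norm_num)
  have hp1 := hxv.coeff_mul_succ hev (l := 0) (by norm_num)
  norm_num at hp0 hp1
  rw [hres, ht, resInf, mul_assoc, ← map_neg, add_assoc, ← map_add, expInf_add, expInf_mul,
    expInf_mul, expInf_mul (RatFunc.C _), expInf_C, expInf_C, expInf_lam, expInf_two]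
  have h2 : (2 : LaurentSeries ℂ) = C 2 := (map_ofNat C 2).symm
  rw [h2]
  refine VanishesTo.succ (n := 0) (VanishesTo.mono
    (VanishesTo.succ (n := -1) (fun k hk => ?_) ?_) (by norm_num)) ?_
  · rw [coeff_sub, coeff_add, coeff_C_mul', coeff_C_mul', hp _ (by omega),
      coeff_single_of_ne (by omega), C_apply, coeff_single_of_ne (by omega)]
    ring
  · rw [coeff_sub, coeff_add, coeff_C_mul', coeff_C_mul', hp0, coeff_single_same, C_apply,
      coeff_single_of_ne (by omega), hx0, he0]
    field_simp
    ring
  · rw [coeff_sub, coeff_add, coeff_C_mul', coeff_C_mul', hp1,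
      coeff_single_of_ne (by omega), C_apply, coeff_single_same, hx0, hx1, he0]
    field_simp
    ring

theorem A10_eq_of_three_le (h00 : L 0 0 = c.L11) (hA : A 0 0 = c.A11) (h3 : 3 ≤ D.rInf) : A 1 0
    = -RatFunc.C (c.tI (D.rInf - 1) / c.ω ^ 2 * c.dω) * lam
      + RatFunc.C (2 / c.ω * resInf (c.A11 - c.L11 / c.L12 * c.A12))
      + RatFunc.C (1 / c.ω ^ 3 * (expInf (L 0 1)).coeff (4 - (D.rInf : ℤ)) * c.dω)
      + polyPart (c.numNuInf / c.L12) + polyPart c.mixed + c.A21Sing := by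
  have hb := h.b_ne
  have hcorr := h.vanishesTo_correction h3
  have hL := h.L01_eq
  rw [← h00, ← hA, ← h.L01_eq, ← h.A01_eq]
  set p := -RatFunc.C (c.tI (D.rInf - 1) / c.ω ^ 2 * c.dω) * lam
      + RatFunc.C (2 / c.ω * resInf (A 0 0 - L 0 0 / L 0 1 * A 0 1))
      + RatFunc.C (1 / c.ω ^ 3 * (expInf (L 0 1)).coeff (4 - (D.rInf : ℤ)) * c.dω) with hp
  refine eq_of_holAt_sub (fun a => ?_) ?_
  · have hpa : HolAt a p :=
      (((HolAt.C _).neg.mul HolAt.lam).add (.C _)).add (.C _)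
    have := (((h.holAt_A10_sub_A21Sing h00 hA a).sub hpa).sub
      (holAt_polyPart a (c.numNuInf / L 0 1))).sub (holAt_polyPart a c.mixed)
    convert this using 1
    ring
  · have h1 : A 1 0 - c.numNuInf / L 0 1 - c.mixed = (A 1 0 - A 0 1 / L 0 1 * L 1 0)
        + (A 0 1 / L 0 1 * (L 0 0 ^ 2 + L 0 1 * L 1 0) - c.numNuInf) / L 0 1
        + 2 * (L 0 0 / L 0 1) * (A 0 0 - A 0 1 / L 0 1 * L 0 0) := by
      rw [h.mixed_eq h00 hA]
      field_simp
      ring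
    have h2 : VanishesTo 1
        (expInf ((A 0 1 / L 0 1 * (L 0 0 ^ 2 + L 0 1 * L 1 0) - c.numNuInf) / L 0 1)) := by
      rw [expInf_div]
      refine VanishesTo.div' (n := 4 - (D.rInf : ℤ)) ?_ h.van_b
        (by rw [h.coeff_b]; exact h.omega_ne) (by omega)
      have := ((h.inf.van_nu_three h3).mul' (l := 4 - (D.rInf : ℤ)) (h.inf.det h3) (by omega)).sub
        (h.vanishesTo_numNuInf_sub h3)
      rwa [mul_sub, sub_sub_sub_cancel_right, ← expInf_mul, ← expInf_sub] at this
    have h4 := congrArg expInf h1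
    simp only [expInf_add, expInf_sub] at h4 ⊢
    have h5 := ((((((h.inf.van_A10_sub (by omega)).add h2).add hcorr).add
      (vanishesTo_expInf_sub_polyPart (c.numNuInf / L 0 1))).add
      (vanishesTo_expInf_sub_polyPart c.mixed))).sub c.vanishesTo_expInf_A21Sing
    convert h5 using 1
    linear_combination h4 - expInf_sub (A 1 0) (A 0 1 / L 0 1 * L 1 0)

end Describes

end GeoLax

namespace GeoLax

/-! ### The derivative at infinity -/

theorem vanishesTo_eval₂_inf (p : Polynomial ℂ) :
    VanishesTo (-(p.natDegree : ℤ)) (p.eval₂ C (single (-1) 1 : LaurentSeries ℂ)) := fun k hk => by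
  rw [(by omega : k = -((-k).toNat : ℤ)), coeff_eval₂_inf]
  exact Polynomial.coeff_eq_zero_of_natDegree_lt (by omega)

theorem coeff_eval₂_inf_natDegree (p : Polynomial ℂ) :
    (p.eval₂ C (single (-1) 1 : LaurentSeries ℂ)).coeff (-(p.natDegree : ℤ)) = p.leadingCoeff :=
  coeff_eval₂_inf _ _

theorem vanishesTo_eval₂_inf_derivative (p : Polynomial ℂ) :
    VanishesTo (1 - (p.natDegree : ℤ))
      ((Polynomial.derivative p).eval₂ C (single (-1) 1 : LaurentSeries ℂ)) := fun k hk => by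
  rcases Nat.eq_zero_or_pos p.natDegree with h0 | h0
  · rw [Polynomial.eq_C_of_natDegree_eq_zero h0]
    simp
  · exact vanishesTo_eval₂_inf _ _ (by
      have := Polynomial.natDegree_derivative_lt h0.ne'
      omega)

theorem expInf_algebraMap (p : Polynomial ℂ) :
    expInf (algebraMap (Polynomial ℂ) (RatFunc ℂ) p)
      = p.eval₂ C (single (-1) 1 : LaurentSeries ℂ) := by
  rw [expInf, RatFunc.eval_algebraMap]
  rfl

/-- Differentiation raises the order of vanishing at infinity. -/
theorem vanishesTo_expInf_dLam {f : RatFunc ℂ} {n : ℤ} (hf : VanishesTo n (expInf f)) :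
    VanishesTo (n + 1) (expInf (dLam f)) := by
  rcases eq_or_ne f 0 with rfl | h0
  · rw [dLam, RatFunc.num_zero]
    simp only [zero_mul, sub_zero, map_zero, zero_div, expInf_zero]
    exact .zero _
  have hd : (f.denom.eval₂ C (single (-1) 1 : LaurentSeries ℂ)).coeff (-(f.denom.natDegree : ℤ))
      ≠ 0 := by
    rw [coeff_eval₂_inf_natDegree]
    exact Polynomial.leadingCoeff_ne_zero.2 f.denom_ne_zero
  have hn : n ≤ f.denom.natDegree - f.num.natDegree := by
    by_contra hlt
    push Not at hlt
    have h1 := hf.mul (vanishesTo_eval₂_inf f.denom) (-(f.num.natDegree : ℤ)) (by omega)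
    have hdne : f.denom.eval₂ C (single (-1) 1 : LaurentSeries ℂ) ≠ 0 := fun h =>
      hd (by rw [h]; rfl)
    rw [expInf_eq_div, div_mul_cancel₀ _ hdne, coeff_eval₂_inf_natDegree,
      Polynomial.leadingCoeff_eq_zero] at h1
    exact h0 ((RatFunc.num_eq_zero_iff).1 h1)
  rw [dLam, expInf_div, expInf_pow, expInf_algebraMap, expInf_algebraMap, Polynomial.eval₂_sub,
    Polynomial.eval₂_mul, Polynomial.eval₂_mul]
  have h2 : VanishesTo (1 - f.num.natDegree - f.denom.natDegree : ℤ)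
      ((Polynomial.derivative f.num).eval₂ C (single (-1) 1 : LaurentSeries ℂ)
        * f.denom.eval₂ C (single (-1) 1)
      - f.num.eval₂ C (single (-1) 1)
        * (Polynomial.derivative f.denom).eval₂ C (single (-1) 1)) :=
    ((vanishesTo_eval₂_inf_derivative _).mul' (vanishesTo_eval₂_inf _) (by omega)).sub
      ((vanishesTo_eval₂_inf _).mul' (vanishesTo_eval₂_inf_derivative _) (by omega))
  have hdv := vanishesTo_eval₂_inf f.denom
  refine h2.div' (n := 1 - f.num.natDegree - f.denom.natDegree) (m := -(f.denom.natDegree : ℤ)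
    + -(f.denom.natDegree : ℤ)) ?_ ?_ (by omega)
  · rw [pow_two]; exact hdv.mul hdv
  · rw [pow_two, hdv.coeff_mul_low hdv rfl]
    exact mul_ne_zero hd hd

/-! ### The value of `g₀` -/

namespace Describes

variable {D : Setting} {c : Coords D} {v : Times D} {L A : Matrix (Fin 2) (Fin 2) (RatFunc ℂ)}
  (h : Describes c v L A)

include h

theorem gZero_eq_of_two_le {g : ℕ} {q : Fin g → ℂ} (hQP : IsGeometricDarboux c.τ c.ω L q c.PI c.PX)
    (hg : g + 3 = D.rInf + ∑ s, D.r s) (hg₀ : c.g₀ = gZero c.τ L q) (h2 : 2 ≤ D.rInf) :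
    c.g₀ = c.tI (D.rInf - 2)
      - c.tI (D.rInf - 1) / c.ω * (expInf (L 0 1)).coeff (4 - (D.rInf : ℤ)) := by
  have hω := h.omega_ne
  rw [hQP.coeff_expInf_succ hg, hg₀, gZero, if_pos h2, Coords.tI, Coords.tI]
  field_simp
  ring

/-- The function under the residue is `a² + b c + a' - a b' / b` for `a = L₁₁`, `b = L₁₂`,
`c = L₂₁`. With `a = ring11 - σ b`, `σ` the slope, only the terms `(σ b)²` and `-σ' b` contribute to its
coefficient in degree three at infinity, which is affine in `g₀`. -/
theorem gZero_eq_of_eq_one (h1 : D.rInf = 1) (hρ : L 0 0 + c.slope * L 0 1 = c.ring11)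
    (hvan : VanishesTo 3 (expInf c.ring11)) :
    c.g₀ = 1 / c.ω * (1 / 2 - c.tI 0) * c.sigma
        - 1 / (2 * c.tI 0) * resInf (lam ^ 2 *
            (c.ring11 ^ 2 + dLam c.ring11 - RatFunc.C (c.tI 0 / c.ω) * c.L12
              - c.ring11 * (dLam c.L12 / c.L12) + RatFunc.C (c.tI 0 ^ 2 / c.ω) * c.L12
              + c.L12 * c.singL21 c.ring11)) := by
  have hb := h.b_ne
  have hω := h.omega_ne
  have ht : c.tI 0 ≠ 0 := by
    have := h.rep.tInf_ne_zero
    rwa [h1] at this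
  have hS := h.L10_eq_of_eq_one h1 hρ hvan
  rw [← h.L01_eq] at hS ⊢
  have hbv : VanishesTo 2 (expInf (L 0 1)) := h.van_b.mono (by omega)
  have hbc : (expInf (L 0 1)).coeff 2 = c.ω := by
    rw [← h.coeff_b]; congr 1; omega
  -- `σ b` has the expansion `t₀ z + (t₀ Σ / ω + g₀) z² + …`
  have hσb : ∀ k, (expInf (c.slope * L 0 1)).coeff k
      = c.tI 0 / c.ω * (expInf (L 0 1)).coeff (k + 1) + c.g₀ / c.ω * (expInf (L 0 1)).coeff k :=
    fun k => by
      rw [c.slope_eq_linFactor h1, c.coeff_expInf_linFactor_mul, h1]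
  have hyv : VanishesTo 1 (expInf (c.slope * L 0 1)) := fun k hk => by
    rw [hσb, hbv _ (by omega), hbv _ (by omega)]; ring
  have hsq := hyv.coeff_mul_succ hyv (l := 3) (by norm_num)
  rw [hσb, hσb] at hsq
  norm_num at hsq
  rw [hbv 1 (by norm_num), hbc, ← h.sigma_eq] at hsq
  have hbr : c.ring11 ^ 2 + dLam c.ring11 - RatFunc.C (c.tI 0 / c.ω) * L 0 1
        - c.ring11 * (dLam (L 0 1) / L 0 1) + RatFunc.C (c.tI 0 ^ 2 / c.ω) * L 0 1
        + L 0 1 * c.singL21 c.ring11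
      = (c.ring11 * c.ring11 + dLam c.ring11 - c.ring11 * (dLam (L 0 1) / L 0 1)
          + L 0 1 * L 1 0 - RatFunc.C 2 * (c.slope * L 0 1) * c.ring11)
        + (c.slope * L 0 1) * (c.slope * L 0 1) - RatFunc.C (c.tI 0 / c.ω) * L 0 1 := by
    rw [hS, map_ofNat]
    ring
  have hrest : VanishesTo 4 (expInf (c.ring11 * c.ring11 + dLam c.ring11
      - c.ring11 * (dLam (L 0 1) / L 0 1)
          + L 0 1 * L 1 0 - RatFunc.C 2 * (c.slope * L 0 1) * c.ring11)) := by
    rw [expInf_sub, expInf_add, expInf_sub, expInf_add, expInf_mul, expInf_mul, expInf_mul (L 0 1),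
      expInf_mul _ c.ring11, expInf_mul (RatFunc.C 2), expInf_C, expInf_div]
    have e1 : VanishesTo 1 (expInf (dLam (L 0 1)) / expInf (L 0 1)) :=
      (vanishesTo_expInf_dLam hbv).div' hbv (by rw [hbc]; exact hω) (by norm_num)
    have e2 : VanishesTo 2 (expInf (L 1 0)) := h.van_L10.mono (by omega)
    exact (((hvan.mul' hvan (by norm_num)).add (vanishesTo_expInf_dLam hvan)).sub
      (hvan.mul' e1 (by norm_num))).add (hbv.mul' e2 (by norm_num)) |>.sub
      (((VanishesTo.C 2).mul hyv).mul' hvan (by norm_num))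
  have hres : resInf (lam ^ 2 * (c.ring11 ^ 2 + dLam c.ring11 - RatFunc.C (c.tI 0 / c.ω) * L 0 1
        - c.ring11 * (dLam (L 0 1) / L 0 1) + RatFunc.C (c.tI 0 ^ 2 / c.ω) * L 0 1
        + L 0 1 * c.singL21 c.ring11))
      = -(2 * c.tI 0 * (c.tI 0 / c.ω * c.sigma + c.g₀) - c.tI 0 / c.ω * c.sigma) := by
    rw [resInf, hbr, pow_two, mul_assoc, coeff_expInf_lam_mul, coeff_expInf_lam_mul, expInf_sub,
      expInf_add, coeff_sub, coeff_add, expInf_mul (c.slope * L 0 1), expInf_mul (RatFunc.C _),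
      expInf_C, coeff_C_mul', hrest _ (by norm_num)]
    norm_num
    rw [hsq, ← h.sigma_eq]
    field_simp
    ring
  rw [hres]
  field_simp
  ring

end Describes

/-! ### The coordinates of a Lax pair -/

/-- The entry `[A_α]₁₂` in the oper gauge is `ν`. -/
theorem operA12_eq {M : Matrix (Fin 2) (Fin 2) (RatFunc ℂ)} (hM : M 0 1 ≠ 0)
    (B : Matrix (Fin 2) (Fin 2) (RatFunc ℂ)) : operA12 M B = B 0 1 / M 0 1 := by
  rw [operA12, gaugeG, Matrix.inv_def, Matrix.adjugate_fin_two_of, Matrix.det_fin_two_of,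
    Ring.inverse_eq_inv']
  simp [Matrix.mul_apply, Matrix.vecMul, dotProduct, Fin.sum_univ_two]
  field_simp

variable {D : Setting}

/-- The local data of a Lax pair and its coordinates, collected. -/
theorem IsLaxPair.describes {U : Set (Times D)} {ω : Times D → ℂ} {α : Times D → Times D}
    {L A : Times D → Matrix (Fin 2) (Fin 2) (RatFunc ℂ)} (h : IsLaxPair U ω α L A) {τ : Times D}
    (hτ : τ ∈ domain U) {g : ℕ} {q : Fin g → ℂ} {PInf : ℕ → ℂ} {PX : Fin D.n → ℕ → ℂ}
    (hQP : IsGeometricDarboux τ (ω τ) (L τ) q PInf PX) :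
    Describes (coords ω α L A τ q PInf PX) (α τ) (L τ) (A τ) := by
  classical
  have hrep := h.representative τ hτ
  have hinj : Function.Injective (posComp τ) := h.distinct τ hτ
  have hord : ∀ s, HasOrder (-(D.r s : ℤ)) (expAt (posComp τ s) (L τ 0 1)) := fun s => by
    have := hasOrder_expAt_factorized τ q hrep.1 (posComp τ s)
    rw [← hQP.entry12] at this
    convert this using 1
    have h1 : (∑ j, if posComp τ s = q j then 1 else 0 : ℤ) = 0 :=
      Finset.sum_eq_zero fun j _ => if_neg (hQP.q_ne j s).symm
    have h2 : (∑ t, (D.r t : ℤ) * if posComp τ s = posComp τ t then 1 else 0) = D.r s := by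
      rw [Finset.sum_eq_single s]
      · simp
      · exact fun t _ ht => by rw [if_neg (fun e => ht (hinj e).symm), mul_zero]
      · simp
    rw [h1, h2, zero_sub]
  have hb : L τ 0 1 ≠ 0 := fun h0 => by
    have := hrep.expInf_entries.2.2.2.2.2
    rw [h0, expInf_zero] at this
    exact hrep.1 this.symm
  exact {
    inj := hinj
    norm := hτ.2
    rep := hrep
    A_hol := fun a ha i j => (holAt_iff a _).2 (h.poles τ hτ i j a ha)
    ord := hord
    fin := fun s => h.finiteData hτ s (hord s).2
    inf := h.infinityData hτ
    QX_eq := fun s k => by rw [hQP.entry12]; rfl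
    QI_eq := fun k => by rw [hQP.entry12]; rfl
    nuX_eq := fun s k => by rw [← operA12_eq hb]; rfl
    nuI_eq := fun k => by rw [← operA12_eq hb]; rfl }

end GeoLax

theorem theorem4p1 {D : GeoLax.Setting} (U : Set (GeoLax.Times D)) (ω : GeoLax.Times D → ℂ)
    (α : GeoLax.Times D → GeoLax.Times D)
    (L A : GeoLax.Times D → Matrix (Fin 2) (Fin 2) (RatFunc ℂ))
    (hLA : GeoLax.IsLaxPair U ω α L A)
    (τ : GeoLax.Times D) (hτ : τ ∈ GeoLax.domain U)
    (g : ℕ) (hg : g + 3 = D.rInf + ∑ s, D.r s)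
    (q : Fin g → ℂ) (PInf : ℕ → ℂ) (PX : Fin D.n → ℕ → ℂ)
    (hQP : GeoLax.IsGeometricDarboux τ (ω τ) (L τ) q PInf PX)
    (c : GeoLax.Coords D) (hc : c = GeoLax.coords ω α L A τ q PInf PX) :
    -- the coefficients ν in terms of α and of the irregular times
    (∀ s, c.νX s 0 = -GeoLax.posComp (α τ) s) ∧
    (∀ s, (GeoLax.matX τ s).mulVec (fun i : Fin (D.r s - 1) => c.νX s ((i : ℕ) + 1))
      = fun i : Fin (D.r s - 1) => -(GeoLax.poleComp (α τ) s (D.r s - 1 - (i : ℕ))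
          / ((D.r s - 1 - (i : ℕ) : ℕ) : ℂ))) ∧
    ((GeoLax.matInf τ).mulVec (fun i : Fin (D.rInf - 3) => c.νI (((i : ℕ) : ℤ) + 1))
      = fun i : Fin (D.rInf - 3) => GeoLax.infComp (α τ) (D.rInf - 3 - (i : ℕ))
          / ((D.rInf - 3 - (i : ℕ) : ℕ) : ℂ)) ∧
    (3 ≤ D.rInf →
      c.ω * c.νI ((D.rInf : ℤ) - 2)
        = c.nuQ₁ - ∑ j ∈ Finset.Icc 1 (D.rInf - 3), c.νI j * c.QI (j - 1) ∧
      c.ω * c.νI ((D.rInf : ℤ) - 1)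
        = c.nuQ₂ - ∑ j ∈ Finset.Icc 2 (D.rInf - 2), c.νI j * c.QI (j - 2)
          - c.νI 1 * ∑ s, c.QX s 1) ∧
    -- the extra conditions
    (D.rInf = 2 → c.nuQ₁ = c.ω * c.νI 0) ∧
    (D.rInf = 1 → c.ω * c.νI (-1) = c.nuQ₁ ∧
      c.sigma * c.νI (-1) + c.ω * c.νI 0 = c.nuQ₂) ∧
    -- the first rows and the traces
    L τ 0 1 = c.L12 ∧ L τ 0 0 = c.L11 ∧ L τ 1 1 = -L τ 0 0 ∧
    A τ 0 1 = c.A12 ∧ A τ 0 0 = c.A11 ∧ A τ 1 1 = -A τ 0 0 ∧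
    -- the (2,1) entry of the Lax matrix
    (3 ≤ D.rInf → L τ 1 0
      = GeoLax.polyPart ((c.numInf - c.L11 ^ 2) / c.L12) + c.singL21 c.L11) ∧
    (D.rInf = 2 → L τ 1 0 = c.singL21 c.L11) ∧
    (D.rInf = 1 → L τ 0 0 + c.slope * L τ 0 1 = c.ring11 ∧
      L τ 1 0 = c.singL21 c.ring11 + 2 * c.slope * c.ring11 - c.slope ^ 2 * c.L12
        + RatFunc.C (c.tI 0 ^ 2 / c.ω)) ∧
    -- the (2,1) entry of the auxiliary matrix
    (4 ≤ D.rInf → A τ 1 0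
      = -RatFunc.C (c.tI (D.rInf - 1) / c.ω ^ 2 * c.dω) * GeoLax.lam
        + RatFunc.C (2 / c.ω * GeoLax.resInf (c.A11 - c.L11 / c.L12 * c.A12))
        + RatFunc.C (1 / c.ω ^ 3 * c.QI (D.rInf - 4) * c.dω)
        + GeoLax.polyPart (c.numNuInf / c.L12) + GeoLax.polyPart c.mixed + c.A21Sing) ∧
    (D.rInf = 3 → A τ 1 0
      = -RatFunc.C (c.tI 2 / c.ω ^ 2 * c.dω) * GeoLax.lam
        + RatFunc.C (2 / c.ω * GeoLax.resInf (c.A11 - c.L11 / c.L12 * c.A12))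
        + RatFunc.C (1 / c.ω ^ 3 * (∑ s, c.QX s 1) * c.dω)
        + GeoLax.polyPart (c.numNuInf / c.L12) + GeoLax.polyPart c.mixed + c.A21Sing) ∧
    (D.rInf = 2 → A τ 1 0 = c.A21Sing) ∧
    (D.rInf = 1 → A τ 1 0 = c.A21Sing) ∧
    -- the value of g₀
    (4 ≤ D.rInf →
      c.g₀ = c.tI (D.rInf - 2) - c.tI (D.rInf - 1) / c.ω * c.QI (D.rInf - 4) ∧
      c.g₀ = -c.QI (D.rInf - 4) / c.ω) ∧
    (D.rInf = 3 →
      c.g₀ = c.tI 1 - c.tI 2 / c.ω * ∑ s, c.QX s 1 ∧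
      c.g₀ = -(1 / c.ω) * ∑ s, c.QX s 1) ∧
    (D.rInf = 2 →
      c.g₀ = c.tI 0 - c.tI 1 / c.ω * ∑ s, (c.QX s 2 + c.X s * c.QX s 1) ∧
      c.g₀ = c.tI 0 - 1 / c.ω * ∑ s, (c.QX s 2 + c.X s * c.QX s 1)) ∧
    (D.rInf = 1 →
      c.g₀ = 1 / c.ω * (1 / 2 - c.tI 0) * c.sigma
        - 1 / (2 * c.tI 0) * GeoLax.resInf (GeoLax.lam ^ 2 *
            (c.ring11 ^ 2 + GeoLax.dLam c.ring11 - RatFunc.C (c.tI 0 / c.ω) * c.L12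
              - c.ring11 * (GeoLax.dLam c.L12 / c.L12) + RatFunc.C (c.tI 0 ^ 2 / c.ω) * c.L12
              + c.L12 * c.singL21 c.ring11))) := by
  have hg₀ : c.g₀ = GeoLax.gZero c.τ (L τ) q := by rw [hc]; rfl
  have h : GeoLax.Describes c (α τ) (L τ) (A τ) := hc ▸ hLA.describes hτ hQP
  have hτc : c.τ = τ := by rw [hc]; rfl
  have hQP' : GeoLax.IsGeometricDarboux c.τ c.ω (L τ) q c.PI c.PX := by rw [hc]; exact hQP
  subst hτc
  have hbase := h.L00_add_eq hQP' hg hg₀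
  have h00 := h.L00_eq hQP' hg hg₀
  have hA := h.A00_eq hbase
  have hvan := h.vanishesTo_expInf_ring11 hQP'
  have hρ : D.rInf = 1 → L c.τ 0 0 + c.slope * L c.τ 0 1 = c.ring11 := fun h1 => by
    rw [c.slope_eq_linFactor h1, hbase, h1, GeoLax.polyOf, Finset.range_zero, Finset.sum_empty,
      zero_add]
  have hvan1 : D.rInf = 1 → GeoLax.VanishesTo 3 (GeoLax.expInf c.ring11) := fun h1 =>
    hvan.mono (by rw [h1]; norm_num)
  refine ⟨h.nuX_zero, h.matX_mulVec, h.matInf_mulVec,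
    fun h3 => ⟨h.omega_mul_nuI_sub_two h3, h.omega_mul_nuI_sub_one h3⟩,
    h.nuQ₁_of_rInf_eq_two, h.nuQ_of_rInf_eq_one, h.L01_eq, h00, ?_, h.A01_eq, hA, h.inf.trace_A,
    h.L10_eq_of_three_le h00, h.L10_eq_of_eq_two h00,
    fun h1 => ⟨hρ h1, h.L10_eq_of_eq_one h1 (hρ h1) (hvan1 h1)⟩, fun h4 => ?_, fun h3 => ?_,
    fun h2 => h.A10_eq_of_le_two h00 hA h2.le, fun h1 => h.A10_eq_of_le_two h00 hA (by omega),
    fun h4 => ?_, fun h3 => ?_, fun h2 => ?_,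
    fun h1 => h.gZero_eq_of_eq_one h1 (hρ h1) (hvan1 h1)⟩
  · exact h.rep.trace_eq
  · rw [h.A10_eq_of_three_le h00 hA (by omega), h.QI_eq,
      (by omega : 4 - (D.rInf : ℤ) = -((D.rInf - 4 : ℕ) : ℤ))]
  · rw [h.A10_eq_of_three_le h00 hA h3.ge, h.sum_QX_one, h3]
    norm_num
  · have h1 := h.gZero_eq_of_two_le hQP' hg hg₀ (by omega)
    obtain ⟨ht, ht'⟩ := h.tI_normalized (by omega)
    rw [(by omega : 4 - (D.rInf : ℤ) = -((D.rInf - 4 : ℕ) : ℤ)), ← h.QI_eq] at h1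
    refine ⟨h1, ?_⟩
    rw [h1, ht, ht']
    ring
  · have h1 := h.gZero_eq_of_two_le hQP' hg hg₀ (by omega)
    obtain ⟨ht, ht'⟩ := h.tI_normalized h3.ge
    rw [(by omega : 4 - (D.rInf : ℤ) = 1), ← h.sum_QX_one] at h1
    rw [h3] at h1 ht ht'
    refine ⟨h1, ?_⟩
    rw [h1, ht, ht']
    ring
  · have h1 := h.gZero_eq_of_two_le hQP' hg hg₀ h2.ge
    have ht : c.tI 1 = 1 := (h.norm.2.1 h2).1
    rw [(by omega : 4 - (D.rInf : ℤ) = 2), ← h.sum_QX_two, h2] at h1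
    refine ⟨h1, ?_⟩
    rw [h1, ht]
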